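/- Let $n\geq 1$, $s\in(0,1]$, $\gamma\in(0,\frac n2)$, $p>1$, and let $\tilde\gamma>0$ be the positive root of $2\tilde\gamma^2+n\tilde\gamma-2n=0$. Suppose that $$p>1+\frac{4}{n+2\gamma}\ \text{ if }\gamma\leq\tilde\gamma,\qquad p\geq 1+\frac{2\gamma}{n}\ \text{ if }\gamma>\tilde\gamma,\qquad\text{and}\qquad p\leq\frac{n}{n-2s}\ \text{ if } n>2s.$$ All functions on $\mathbb R^n$ are complex-valued. Let $\|f\|_{H^s}=\|(1-\Delta)^{s/2}f\|_{L^2}$ and $\|f\|_{\dot H^{\sigma}}=\|(-\Delta)^{\sigma/2}f\|_{L^2}$ for $\sigma\in\mathbb R$. For $(u_0,u_1)\in\mathcal A_s:=(H^s\cap\dot H^{-\gamma})\times(L^2\cap\dot H^{-\gamma})$ put $$\|(u_0,u_1)\|_{\mathcal A_s}=\|u_0\|_{H^s}+\|u_0\|_{\dot H^{-\gamma}}+\|u_1\|_{L^2}+\|u_1\|_{\dot H^{-\gamma}}.$$ For $\epsilon>0$ consider the Cauchy problem $$u_{tt}-\Delta u+u_t=|u|^p\ \ (t>0,\ x\in\mathbb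 R^n),\qquad u(0,\cdot)=\epsilon u_0,\quad u_t(0,\cdot)=\epsilon u_1. \tag{1}$$ A global Sobolev solution of (1) is a function $u\in\mathcal C([0,\infty),H^s)$ with $|u(t,\cdot)|^p\in L^2$ for all $t\geq0$ such that, for all $t\geq 0$, $$u(t)=\epsilon E_0(t)*u_0+\epsilon E_1(t)*u_1+\int_0^tE_1(t-\tau)*|u(\tau)|^p\,\mathrm d\tau ,$$ where the convolutions are in $x$, the integral is an absolutely convergent $L^2$-valued integral, and $E_0,E_1$ are the fundamental solutions of $v_{tt}-\Delta v+v_t=0$ with initial data $(v,v_t)|_{t=0}=(\delta_0,0)$ and $(0,\delta_0)$, respectively. Then there are constants $C>0$, $\epsilon_0>0$ and $K>0$, depending only on $n,s,\gamma,p$, such that for every $\epsilon\in(0,\epsilon_0]$ and all $(u_0,u_1)\in\mathcal A_s$ with $\|(u_0,u_1)\|_{\mathcal A_s}\leq C$ the problem (1) has exactly one global Sobolev solution $u\in\mathcal C([0,\infty),H^s)$. It satisfies, for all $t\geq0$, $$\|u(t,\cdot)\|_{L^2}\leq K\epsilon(1+t)^{-\frac{\gamma}{2}}\|(u_0,u_1)\|_{\mathcal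 A_s},\qquad \|u(t,\cdot)\|_{\dot H^s}\leq K\epsilon(1+t)^{-\frac{s+\gamma}{2}}\|(u_0,u_1)\|_{\mathcal A_s}.$$ If $u_0$ and $u_1$ are real-valued, then so is $u$. -/

import Mathlib

open MeasureTheory Filter Topology
open scoped FourierTransform ENNReal

namespace DampedWave

/-- The space `L²(ℝⁿ)` of (classes of) complex-valued functions. -/
abbrev L2 (n : ℕ) : Type :=
  Lp ℂ 2 (volume : Measure (EuclideanSpace ℝ (Fin n)))

/-- The angular frequency `2π|ξ|`. The Fourier transform `𝓕` is normalized with the character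
`e^{-2πi x·ξ}`, so that `-Δ` is multiplication by `(2π|ξ|)²` on the Fourier side. -/
noncomputable def freq {n : ℕ} (ξ : EuclideanSpace ℝ (Fin n)) : ℝ :=
  2 * Real.pi * ‖ξ‖

/-- The inhomogeneous Sobolev norm `‖(1 - Δ)^{s/2} f‖_{L²}` of `f ∈ L²(ℝⁿ)`, computed on the
Fourier side; it equals `∞` exactly when `f ∉ H^s` (for `s ≥ 0`). -/
noncomputable def sobolevNorm {n : ℕ} (s : ℝ) (f : L2 n) : ℝ≥0∞ :=
  eLpNorm (fun ξ => (((1 + freq ξ ^ 2) ^ (s / 2) : ℝ) : ℂ) * (𝓕 f : L2 n) ξ) 2 volume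

/-- The homogeneous Sobolev norm `‖(-Δ)^{σ/2} f‖_{L²} = ‖ |ξ|^σ f̂ ‖_{L²}` of `f ∈ L²(ℝⁿ)`,
for a real order `σ` of either sign; it equals `∞` exactly when `f ∉ Ḣ^σ`.
(For `n ≥ 1` the frequency `ξ = 0` is a null set.) -/
noncomputable def homSobolevNorm {n : ℕ} (σ : ℝ) (f : L2 n) : ℝ≥0∞ :=
  eLpNorm (fun ξ => ((freq ξ ^ σ : ℝ) : ℂ) * (𝓕 f : L2 n) ξ) 2 volume

/-- The norm of the data space `(H^s ∩ Ḣ^{-γ}) × (L² ∩ Ḣ^{-γ})`; it is finite exactly on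
that space. -/
noncomputable def dataNorm {n : ℕ} (s γ : ℝ) (u₀ u₁ : L2 n) : ℝ≥0∞ :=
  (sobolevNorm s u₀ + homSobolevNorm (-γ) u₀) + (‖u₁‖ₑ + homSobolevNorm (-γ) u₁)

/-- `ω(r) = |1/4 - r²|^{1/2}`; the roots of `λ² + λ + r² = 0` are `-1/2 ± ω(r)` if `r ≤ 1/2`
and `-1/2 ± i ω(r)` if `r ≥ 1/2`. -/
noncomputable def rootGap (r : ℝ) : ℝ := Real.sqrt |1 / 4 - r ^ 2|

/-- `cosh (t √(1/4 - r²))`, which is a cosine for `r > 1/2`. -/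
noncomputable def genCosh (t r : ℝ) : ℝ :=
  if r ^ 2 ≤ 1 / 4 then Real.cosh (rootGap r * t) else Real.cos (rootGap r * t)

/-- `sinh (t √(1/4 - r²)) / √(1/4 - r²)`, with its limiting value `t` at `r = 1/2`. -/
noncomputable def genSinhc (t r : ℝ) : ℝ :=
  if r ^ 2 = 1 / 4 then t
  else if r ^ 2 < 1 / 4 then Real.sinh (rootGap r * t) / rootGap r
  else Real.sin (rootGap r * t) / rootGap r

/-- `K₀(t,r) = (λ₁ e^{λ₂ t} - λ₂ e^{λ₁ t}) / (λ₁ - λ₂)` with `λ₁, λ₂` the roots of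
`λ² + λ + r² = 0`: the solution of `k'' + k' + r² k = 0`, `k(0) = 1`, `k'(0) = 0`. -/
noncomputable def K0 (t r : ℝ) : ℝ :=
  Real.exp (-t / 2) * (genCosh t r + genSinhc t r / 2)

/-- `K₁(t,r) = (e^{λ₁ t} - e^{λ₂ t}) / (λ₁ - λ₂)` with `λ₁, λ₂` the roots of
`λ² + λ + r² = 0`: the solution of `k'' + k' + r² k = 0`, `k(0) = 0`, `k'(0) = 1`. -/
noncomputable def K1 (t r : ℝ) : ℝ :=
  Real.exp (-t / 2) * genSinhc t r

theorem abs_sinh_le (x : ℝ) : |Real.sinh x| ≤ |x| * Real.exp |x| := by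
  rw [Real.abs_sinh]
  have h1 := Real.add_one_le_exp (-(2 * |x|))
  have h2 : Real.exp (-(2 * |x|)) * Real.exp |x| = Real.exp (-|x|) := by
    rw [← Real.exp_add]; ring_nf
  rw [Real.sinh_eq]
  nlinarith [Real.exp_pos |x|]

theorem rootGap_le_half {r : ℝ} (h : r ^ 2 ≤ 1 / 4) : rootGap r ≤ 1 / 2 := by
  unfold rootGap
  rw [Real.sqrt_le_left (by norm_num), abs_of_nonneg (by linarith)]
  nlinarith [sq_nonneg r]

theorem rootGap_pos {r : ℝ} (h : r ^ 2 ≠ 1 / 4) : 0 < rootGap r :=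
  Real.sqrt_pos.2 (abs_pos.2 (fun h' => h (by linarith)))

theorem abs_genSinhc_le (t r : ℝ) : |genSinhc t r| ≤ |t| * Real.exp |t| := by
  have ht : |t| ≤ |t| * Real.exp |t| :=
    le_mul_of_one_le_right (abs_nonneg t) (Real.one_le_exp (abs_nonneg t))
  unfold genSinhc
  split_ifs with h1 h2
  · exact ht
  · have hω := rootGap_pos h1
    rw [abs_div, abs_of_pos hω, div_le_iff₀ hω]
    refine (abs_sinh_le _).trans ?_
    rw [abs_mul, abs_of_pos hω]
    have h3 : rootGap r * |t| ≤ |t| := by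
      have := rootGap_le_half h2.le
      nlinarith [abs_nonneg t]
    have h4 := Real.exp_le_exp.2 h3
    have h5 : 0 ≤ rootGap r * |t| := mul_nonneg hω.le (abs_nonneg t)
    nlinarith [mul_le_mul_of_nonneg_left h4 h5]
  · have hω := rootGap_pos h1
    rw [abs_div, abs_of_pos hω, div_le_iff₀ hω]
    have h3 : |Real.sin (rootGap r * t)| ≤ |rootGap r * t| := Real.abs_sin_le_abs
    rw [abs_mul, abs_of_pos hω] at h3
    nlinarith

theorem abs_genCosh_le (t r : ℝ) : |genCosh t r| ≤ Real.exp |t| := by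
  unfold genCosh
  split_ifs with h
  · rw [abs_of_pos (Real.cosh_pos _)]
    have h0 : 0 ≤ rootGap r := Real.sqrt_nonneg _
    have h1 : |rootGap r * t| ≤ |t| := by
      rw [abs_mul, abs_of_nonneg h0]
      nlinarith [abs_nonneg t, rootGap_le_half h]
    rw [← Real.cosh_abs, Real.cosh_eq]
    have h2 := Real.exp_le_exp.2 h1
    have h3 : Real.exp (-|rootGap r * t|) ≤ Real.exp |t| :=
      Real.exp_le_exp.2 (by linarith [abs_nonneg (rootGap r * t), abs_nonneg t])
    linarith
  · exact (Real.abs_cos_le_one _).trans (Real.one_le_exp (abs_nonneg t))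

theorem measurable_rootGap : Measurable rootGap := by
  unfold rootGap; fun_prop

theorem measurable_genSinhc (t : ℝ) : Measurable (genSinhc t) := by
  have h := measurable_rootGap
  unfold genSinhc
  refine Measurable.ite (measurableSet_eq_fun (by fun_prop) (by fun_prop)) (by fun_prop) ?_
  refine Measurable.ite (measurableSet_lt (by fun_prop) (by fun_prop)) ?_ ?_
  · exact (Real.measurable_sinh.comp (h.mul_const t)).div h
  · exact (Real.measurable_sin.comp (h.mul_const t)).div h

theorem measurable_genCosh (t : ℝ) : Measurable (genCosh t) := by
  have h := measurable_rootGap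
  unfold genCosh
  refine Measurable.ite (measurableSet_le (by fun_prop) (by fun_prop)) ?_ ?_
  · exact Real.measurable_cosh.comp (h.mul_const t)
  · exact Real.measurable_cos.comp (h.mul_const t)

theorem memLp_mul_of_bounded {n : ℕ} {k : ℝ → ℝ} (hk : Measurable k) (B : ℝ)
    (hB : ∀ r, |k r| ≤ B) (f : L2 n) :
    MemLp (fun ξ => ((k (freq ξ) : ℝ) : ℂ) * f ξ) 2 volume := by
  have hm : Measurable (fun ξ : EuclideanSpace ℝ (Fin n) => ((k (freq ξ) : ℝ) : ℂ)) := by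
    refine Complex.measurable_ofReal.comp (hk.comp ?_)
    unfold freq; fun_prop
  refine (Lp.memLp f).of_le_mul (c := B)
    (hm.aestronglyMeasurable.mul (Lp.aestronglyMeasurable f)) (Eventually.of_forall fun ξ => ?_)
  rw [norm_mul, Complex.norm_real, Real.norm_eq_abs]
  exact mul_le_mul_of_nonneg_right (hB _) (norm_nonneg _)

theorem memLp_K1_mul {n : ℕ} (t : ℝ) (f : L2 n) :
    MemLp (fun ξ => ((K1 t (freq ξ) : ℝ) : ℂ) * f ξ) 2 volume := by
  refine memLp_mul_of_bounded (k := K1 t) ((measurable_genSinhc t).const_mul _)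
    (Real.exp (-t / 2) * (|t| * Real.exp |t|)) (fun r => ?_) f
  rw [K1, abs_mul, abs_of_pos (Real.exp_pos _)]
  exact mul_le_mul_of_nonneg_left (abs_genSinhc_le t r) (Real.exp_pos _).le

theorem memLp_K0_mul {n : ℕ} (t : ℝ) (f : L2 n) :
    MemLp (fun ξ => ((K0 t (freq ξ) : ℝ) : ℂ) * f ξ) 2 volume := by
  refine memLp_mul_of_bounded (k := K0 t)
    (((measurable_genCosh t).add ((measurable_genSinhc t).div_const 2)).const_mul _)
    (Real.exp (-t / 2) * (Real.exp |t| + |t| * Real.exp |t|)) (fun r => ?_) f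
  rw [K0, abs_mul, abs_of_pos (Real.exp_pos _)]
  refine mul_le_mul_of_nonneg_left ?_ (Real.exp_pos _).le
  have h1 := abs_genCosh_le t r
  have h2 := abs_genSinhc_le t r
  have h3 := abs_add_le (genCosh t r) (genSinhc t r / 2)
  rw [abs_div, abs_two] at h3
  linarith [abs_nonneg (genSinhc t r)]

/-- `E₀(t) ∗ f`, where `E₀` is the fundamental solution of `v_tt - Δv + v_t = 0` with data
`(δ₀, 0)`: the Fourier multiplier with symbol `K₀(t, 2π|ξ|)`. -/
noncomputable def E0 {n : ℕ} (t : ℝ) (f : L2 n) : L2 n :=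
  𝓕⁻ ((memLp_K0_mul t (𝓕 f : L2 n)).toLp _ : L2 n)

/-- `E₁(t) ∗ f`, where `E₁` is the fundamental solution of `v_tt - Δv + v_t = 0` with data
`(0, δ₀)`: the Fourier multiplier with symbol `K₁(t, 2π|ξ|)`. -/
noncomputable def E1 {n : ℕ} (t : ℝ) (f : L2 n) : L2 n :=
  𝓕⁻ ((memLp_K1_mul t (𝓕 f : L2 n)).toLp _ : L2 n)

/-- The function `|f|^p`. -/
noncomputable def absPow {n : ℕ} (p : ℝ) (f : L2 n) : EuclideanSpace ℝ (Fin n) → ℂ :=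
  fun x => ((‖f x‖ ^ p : ℝ) : ℂ)

open Classical in
/-- `|f|^p` as an element of `L²`. The value when `|f|^p ∉ L²` is irrelevant: solutions are
required to satisfy `|u(t)|^p ∈ L²`. -/
noncomputable def absPowL2 {n : ℕ} (p : ℝ) (f : L2 n) : L2 n :=
  if h : MemLp (absPow p f) 2 volume then h.toLp _ else 0

/-- `u ∈ C([0,∞), H^s)`; only the values `u t` with `t ≥ 0` matter. -/
def ContinuousInSobolev {n : ℕ} (s : ℝ) (u : ℝ → L2 n) : Prop :=
  (∀ t, 0 ≤ t → sobolevNorm s (u t) < ∞) ∧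
  ∀ t, 0 ≤ t → Tendsto (fun τ => sobolevNorm s (u τ - u t)) (𝓝[Set.Ici 0] t) (𝓝 0)

/-- `u` is a global (in time) Sobolev solution, i.e. a mild solution in `C([0,∞), H^s)`, of
`u_tt - Δu + u_t = |u|^p` with data `u(0) = v₀`, `u_t(0) = v₁`: for all `t ≥ 0`,
`u(t) = E₀(t) ∗ v₀ + E₁(t) ∗ v₁ + ∫₀ᵗ E₁(t-τ) ∗ |u(τ)|^p dτ`, where the nonlinear term takes
values in `L²` and the integral is an absolutely convergent `L²`-valued integral. -/
structure IsGlobalSobolevSolution {n : ℕ} (s p : ℝ) (v₀ v₁ : L2 n) (u : ℝ → L2 n) : Prop where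
  continuous : ContinuousInSobolev s u
  memLp_absPow : ∀ t, 0 ≤ t → MemLp (absPow p (u t)) 2 volume
  integrable : ∀ t, 0 ≤ t →
    IntervalIntegrable (fun τ => E1 (t - τ) (absPowL2 p (u τ))) volume 0 t
  duhamel : ∀ t, 0 ≤ t →
    u t = E0 t v₀ + E1 t v₁ + ∫ τ in (0 : ℝ)..t, E1 (t - τ) (absPowL2 p (u τ))

/-- The function is real-valued (almost everywhere). -/
def IsRealValued {n : ℕ} (f : L2 n) : Prop := ∀ᵐ x, (f x).im = 0

end DampedWave

open DampedWave

variable {n : ℕ}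

/-! The two decay rates are the statement that one weighted norm stays bounded. With R = √(1+t),
write u(t) as the multiplier `scaledSymbol s γ R` applied to an unknown w(t) in L². Boundedness of
‖w(t)‖ then says that R^γ ‖(1 + (R|ξ|)^s) û(t)‖ is bounded, which gives the L² and the Ḣ^s decay at
once. In this variable the problem is a fixed-point equation w = linear part + Duhamel part among
bounded continuous functions ℝ → L², with time frozen by `max t 0` so that all objects live on the
whole line.

Linear part: K₀ and K₁ decay like e^{-c r² t} for r ≤ 1 and exponentially in t for r ≥ 1, where K₁
also gains one derivative (`diffusiveDecay_K0`, `diffusiveDecay_K1`). A factor r^γ at low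
frequencies, paid for by the Ḣ^{-γ} norm of the data, buys t^{-γ/2} (`exists_linearPart_bound`).

Nonlinear part: Sobolev embedding and its dual, the Hardy–Littlewood–Sobolev inequality, bound |u|^p
in L² and in Ḣ^{-γ} by powers of R (`exists_nonlinear_estimate`). With β = (p-1)(n+2γ)/4, the Ḣ^{-γ}
norm of the source decays like (1+τ)^{-β} and the L² norm has an additional (1+τ)^{-γ/2}. In the
Duhamel integral, sources with τ ≤ t/2 are treated like initial data and those with τ ≥ t/2 through
their L² norm only; the resulting weight has an integral bounded in t exactly because β > 1 and s ≤
1 (`exists_norm_duhamel_le`, `integral_duhamelWeight_le`). Hence the Duhamel map is a contraction on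
a small ball, and its fixed point has size linear in the data.

Uniqueness holds in all of C([0,∞), H^s): the nonlinearity is locally Lipschitz from H^s to L², E₁
maps L² back to H^s, and Grönwall's lemma applies. Real data give a real solution because the
conjugate of a solution solves the same problem. -/

/-! ### Pointwise bounds for the symbols K₀ and K₁. -/

theorem one_add_rpow_mul_exp_le {b x : ℝ} (hb : 0 ≤ b) (hx : 0 ≤ x) :
    (1 + x) ^ b * Real.exp (-x / 8) ≤ Real.exp (1 / 8 + b * Real.log (8 * (b + 1))) := by
  rw [Real.rpow_def_of_pos (by linarith), ← Real.exp_add, Real.exp_le_exp]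
  have hc : 0 < 8 * (b + 1) := by linarith
  -- Dividing by 8(b+1) before using log y ≤ y - 1 gives x the slope b/(8(b+1)) ≤ 1/8, which the
  -- exponential absorbs.
  have h1 := Real.log_le_sub_one_of_pos (x := (1 + x) / (8 * (b + 1))) (by positivity)
  rw [Real.log_div (by linarith) hc.ne'] at h1
  have h2 : b * Real.log (1 + x)
      ≤ b * ((1 + x) / (8 * (b + 1)) + Real.log (8 * (b + 1))) :=
    mul_le_mul_of_nonneg_left (by linarith) hb
  have h3 : b * ((1 + x) / (8 * (b + 1))) ≤ (1 + x) / 8 := by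
    rw [← mul_div_assoc, div_le_div_iff₀ hc (by norm_num)]
    nlinarith
  linarith

theorem mul_exp_neg_div_le (t : ℝ) : t * Real.exp (-t / 8) ≤ 8 := by
  have h := Real.add_one_le_exp (t / 8)
  have h2 : Real.exp (t / 8) * Real.exp (-t / 8) = 1 := by
    rw [← Real.exp_add]; simp [neg_div]
  nlinarith [Real.exp_pos (-t / 8)]

theorem rootGap_sq_of_le {r : ℝ} (h : r ^ 2 ≤ 1 / 4) : rootGap r ^ 2 = 1 / 4 - r ^ 2 := by
  rw [rootGap, Real.sq_sqrt (abs_nonneg _), abs_of_nonneg (by linarith)]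

theorem rootGap_sq_of_ge {r : ℝ} (h : 1 / 4 ≤ r ^ 2) : rootGap r ^ 2 = r ^ 2 - 1 / 4 := by
  rw [rootGap, Real.sq_sqrt (abs_nonneg _), abs_of_nonpos (by linarith)]; ring

theorem rootGap_nonneg (r : ℝ) : 0 ≤ rootGap r := Real.sqrt_nonneg _

/-- The slow characteristic root -1/2 + ω is at most -r². This is the source of heat-like decay at
low frequencies. -/
theorem rootGap_le_half_sub {r : ℝ} (h : r ^ 2 ≤ 1 / 4) : rootGap r ≤ 1 / 2 - r ^ 2 :=
  abs_le_of_sq_le_sq' (by nlinarith [rootGap_sq_of_le h, sq_nonneg (r ^ 2)]) (by linarith) |>.2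

theorem exp_mul_genCosh_le {t r : ℝ} (ht : 0 ≤ t) (h1 : r ^ 2 ≤ 1) :
    Real.exp (-t / 2) * |genCosh t r| ≤ Real.exp (-(r ^ 2 * t) / 8) := by
  unfold genCosh
  split_ifs with h
  · rw [abs_of_pos (Real.cosh_pos _)]
    have hc : Real.cosh (rootGap r * t) ≤ Real.exp (rootGap r * t) := by
      rw [Real.cosh_eq]
      have := Real.exp_le_exp.2 (show -(rootGap r * t) ≤ rootGap r * t by
        nlinarith [mul_nonneg (rootGap_nonneg r) ht])
      linarith
    refine (mul_le_mul_of_nonneg_left hc (Real.exp_pos _).le).trans ?_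
    rw [← Real.exp_add, Real.exp_le_exp]
    nlinarith [mul_le_mul_of_nonneg_right (rootGap_le_half_sub h) ht, mul_nonneg (sq_nonneg r) ht]
  · refine (mul_le_of_le_one_right (Real.exp_pos _).le (Real.abs_cos_le_one _)).trans ?_
    rw [Real.exp_le_exp]
    nlinarith [mul_le_mul_of_nonneg_right h1 ht]

theorem abs_genSinhc_le_exp {t r : ℝ} (ht : 0 ≤ t) (h : r ^ 2 < 1 / 4) :
    |genSinhc t r| ≤ t * Real.exp (rootGap r * t) := by
  have hω := rootGap_pos h.ne
  rw [genSinhc, if_neg h.ne, if_pos h, abs_div, abs_of_pos hω, div_le_iff₀ hω]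
  have := DampedWave.abs_sinh_le (rootGap r * t)
  rw [abs_of_nonneg (mul_nonneg hω.le ht)] at this
  linarith

/-- Away from the double root (r² < 3/16) the denominator ω is at least 1/4, and the slow root gives
the decay. Near and beyond it the division by ω costs a factor t, which is harmless because e^{-t/4}
is still available and r² ≤ 1. -/
theorem abs_K1_le_of_le_one {t r : ℝ} (ht : 0 ≤ t) (h1 : r ^ 2 ≤ 1) :
    |K1 t r| ≤ 8 * Real.exp (-(r ^ 2 * t) / 8) := by
  have hkey : t * Real.exp (-t / 4) ≤ 8 * Real.exp (-(r ^ 2 * t) / 8) := by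
    have e : Real.exp (-t / 4) = Real.exp (-t / 8) * Real.exp (-t / 8) := by
      rw [← Real.exp_add]; ring_nf
    have h2 : Real.exp (-t / 8) ≤ Real.exp (-(r ^ 2 * t) / 8) := by
      rw [Real.exp_le_exp]; nlinarith
    rw [e, ← mul_assoc]
    exact mul_le_mul (mul_exp_neg_div_le t) h2 (Real.exp_pos _).le (by norm_num)
  rw [K1, abs_mul, abs_of_pos (Real.exp_pos _)]
  have hE := Real.exp_pos (-t / 2)
  rcases lt_or_ge (r ^ 2) (3 / 16) with h | h
  · have h4 : r ^ 2 < 1 / 4 := by linarith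
    have hω : 1 / 4 ≤ rootGap r :=
      abs_le_of_sq_le_sq' (by nlinarith [rootGap_sq_of_le h4.le]) (rootGap_nonneg r) |>.2
    have hω0 : 0 < rootGap r := by linarith
    have hs : |genSinhc t r| ≤ 8 * Real.exp (rootGap r * t) := by
      rw [genSinhc, if_neg h4.ne, if_pos h4, abs_div, abs_of_pos hω0, div_le_iff₀ hω0,
        abs_of_nonneg (Real.sinh_nonneg_iff.2 (mul_nonneg hω0.le ht)), Real.sinh_eq]
      nlinarith [Real.exp_pos (rootGap r * t), Real.exp_pos (-(rootGap r * t))]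
    refine (mul_le_mul_of_nonneg_left hs hE.le).trans ?_
    rw [mul_left_comm, ← Real.exp_add]
    gcongr
    nlinarith [mul_le_mul_of_nonneg_right (rootGap_le_half_sub h4.le) ht,
      mul_nonneg (sq_nonneg r) ht]
  refine le_trans ?_ hkey
  rcases lt_or_ge (r ^ 2) (1 / 4) with h4 | h4
  · refine (mul_le_mul_of_nonneg_left (abs_genSinhc_le_exp ht h4) hE.le).trans ?_
    rw [mul_left_comm, ← Real.exp_add]
    gcongr
    have : rootGap r ≤ 1 / 4 :=
      abs_le_of_sq_le_sq' (by nlinarith [rootGap_sq_of_le h4.le]) (by norm_num) |>.2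
    nlinarith
  · have hs : |genSinhc t r| ≤ t := by
      unfold genSinhc
      split_ifs with h5 h6
      · exact (abs_of_nonneg ht).le
      · linarith
      · have hω := rootGap_pos h5
        rw [abs_div, abs_of_pos hω, div_le_iff₀ hω]
        refine Real.abs_sin_le_abs.trans ?_
        rw [abs_of_nonneg (mul_nonneg hω.le ht)]; linarith
    refine (mul_le_mul_of_nonneg_left hs hE.le).trans ?_
    rw [mul_comm]
    exact mul_le_mul_of_nonneg_left (Real.exp_le_exp.2 (by linarith)) ht

/-- For r ≥ 1 the denominator satisfies ω ≥ r/2, which is the gain of one derivative. -/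
theorem mul_abs_K1_le_of_one_le {t r : ℝ} (ht : 0 ≤ t) (h1 : 1 ≤ r) :
    r * |K1 t r| ≤ 2 * Real.exp (-t / 8) := by
  have h4 : 1 / 4 < r ^ 2 := by nlinarith
  have hω := rootGap_pos h4.ne'
  have hω2 : r / 2 ≤ rootGap r :=
    abs_le_of_sq_le_sq' (by nlinarith [rootGap_sq_of_ge h4.le]) hω.le |>.2
  have hs : r * |genSinhc t r| ≤ 2 := by
    rw [genSinhc, if_neg h4.ne', if_neg (by linarith), abs_div, abs_of_pos hω, ← mul_div_assoc,
      div_le_iff₀ hω]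
    nlinarith [Real.abs_sin_le_one (rootGap r * t)]
  rw [K1, abs_mul, abs_of_pos (Real.exp_pos _), mul_left_comm, mul_comm]
  exact mul_le_mul hs (Real.exp_le_exp.2 (by linarith)) (Real.exp_pos _).le (by norm_num)

theorem abs_K0_le (t r : ℝ) :
    |K0 t r| ≤ Real.exp (-t / 2) * |genCosh t r| + |K1 t r| := by
  have : K0 t r = Real.exp (-t / 2) * genCosh t r + K1 t r / 2 := by rw [K0, K1]; ring
  rw [this]
  refine (abs_add_le _ _).trans ?_
  rw [abs_mul, abs_of_pos (Real.exp_pos _), abs_div, abs_two]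
  linarith [abs_nonneg (K1 t r)]

theorem abs_K0_le_of_le_one {t r : ℝ} (ht : 0 ≤ t) (h1 : r ^ 2 ≤ 1) :
    |K0 t r| ≤ 9 * Real.exp (-(r ^ 2 * t) / 8) := by
  linarith [abs_K0_le t r, exp_mul_genCosh_le ht h1, abs_K1_le_of_le_one ht h1]

theorem abs_K0_le_of_one_le {t r : ℝ} (ht : 0 ≤ t) (h1 : 1 ≤ r) :
    |K0 t r| ≤ 3 * Real.exp (-t / 8) := by
  have hc : Real.exp (-t / 2) * |genCosh t r| ≤ Real.exp (-t / 8) := by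
    rw [genCosh, if_neg (by nlinarith)]
    refine (mul_le_of_le_one_right (Real.exp_pos _).le (Real.abs_cos_le_one _)).trans ?_
    exact Real.exp_le_exp.2 (by linarith)
  have := mul_abs_K1_le_of_one_le ht h1
  nlinarith [abs_K0_le t r, abs_nonneg (K1 t r)]

/-- A family of symbols `k t r`, `t ≥ 0`, with parabolic decay at low frequencies, and with a
gain of `q` derivatives and arbitrary polynomial decay at high frequencies. -/
def DiffusiveDecay (q : ℝ) (k : ℝ → ℝ → ℝ) : Prop :=
  ∀ a : ℝ, 0 ≤ a → ∃ C : ℝ, 0 < C ∧ ∀ t r : ℝ, 0 ≤ t → 0 < r →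
    (r ≤ 1 → r ^ a * |k t r| ≤ C * (1 + t) ^ (-a / 2)) ∧
    (1 ≤ r → r ^ q * |k t r| ≤ C * (1 + t) ^ (-a / 2))

/-- For r ≤ 1 one has (r²(1+t))^{a/2} ≤ (1 + r²t)^{a/2}, so powers of r turn into powers of 1+t and
the exponential absorbs the rest. -/
theorem diffusiveDecay_of_exp_bound {q A : ℝ} {k : ℝ → ℝ → ℝ} (hA : 0 < A)
    (hlow : ∀ t r, 0 ≤ t → 0 < r → r ≤ 1 → |k t r| ≤ A * Real.exp (-(r ^ 2 * t) / 8))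
    (hhigh : ∀ t r, 0 ≤ t → 1 ≤ r → r ^ q * |k t r| ≤ A * Real.exp (-t / 8)) :
    DiffusiveDecay q k := by
  intro a ha
  have hb : 0 ≤ a / 2 := by linarith
  set M := Real.exp (1 / 8 + a / 2 * Real.log (8 * (a / 2 + 1))) with hM
  refine ⟨A * M, by positivity, fun t r ht hr => ⟨fun h1 => ?_, fun h1 => ?_⟩⟩
  · have ht1 : 0 < 1 + t := by linarith
    have hp : 0 < (1 + t) ^ (a / 2) := Real.rpow_pos_of_pos ht1 _
    rw [neg_div, Real.rpow_neg ht1.le, ← div_eq_mul_inv, le_div_iff₀ hp]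
    have h3 : r ^ a * (1 + t) ^ (a / 2) ≤ (1 + r ^ 2 * t) ^ (a / 2) := by
      have : r ^ a = (r ^ 2) ^ (a / 2) := by
        rw [← Real.rpow_natCast r 2, ← Real.rpow_mul hr.le]; congr 1; push_cast; ring
      rw [this, ← Real.mul_rpow (by positivity) ht1.le]
      exact Real.rpow_le_rpow (by positivity) (by nlinarith) hb
    calc r ^ a * |k t r| * (1 + t) ^ (a / 2) = (r ^ a * (1 + t) ^ (a / 2)) * |k t r| := by ring
      _ ≤ (1 + r ^ 2 * t) ^ (a / 2) * (A * Real.exp (-(r ^ 2 * t) / 8)) :=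
        mul_le_mul h3 (hlow t r ht hr h1) (abs_nonneg _) (by positivity)
      _ = A * ((1 + r ^ 2 * t) ^ (a / 2) * Real.exp (-(r ^ 2 * t) / 8)) := by ring
      _ ≤ A * M := mul_le_mul_of_nonneg_left (one_add_rpow_mul_exp_le hb (by positivity)) hA.le
  · have ht1 : 0 < 1 + t := by linarith
    have hp : 0 < (1 + t) ^ (a / 2) := Real.rpow_pos_of_pos ht1 _
    rw [neg_div, Real.rpow_neg ht1.le, ← div_eq_mul_inv, le_div_iff₀ hp]
    calc r ^ q * |k t r| * (1 + t) ^ (a / 2) ≤ A * Real.exp (-t / 8) * (1 + t) ^ (a / 2) :=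
        mul_le_mul_of_nonneg_right (hhigh t r ht h1) hp.le
      _ = A * ((1 + t) ^ (a / 2) * Real.exp (-t / 8)) := by ring
      _ ≤ A * M := mul_le_mul_of_nonneg_left (one_add_rpow_mul_exp_le hb ht) hA.le

theorem diffusiveDecay_K0 : DiffusiveDecay 0 K0 := by
  refine diffusiveDecay_of_exp_bound (A := 9) (by norm_num) (fun t r ht hr h1 => ?_)
    (fun t r ht h1 => ?_)
  · exact abs_K0_le_of_le_one ht (by nlinarith)
  · rw [Real.rpow_zero, one_mul]
    linarith [abs_K0_le_of_one_le ht h1, Real.exp_pos (-t / 8)]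

theorem diffusiveDecay_K1 : DiffusiveDecay 1 K1 := by
  refine diffusiveDecay_of_exp_bound (A := 8) (by norm_num) (fun t r ht hr h1 => ?_)
    (fun t r ht h1 => ?_)
  · exact abs_K1_le_of_le_one ht (by nlinarith)
  · rw [Real.rpow_one]
    linarith [mul_abs_K1_le_of_one_le ht h1, Real.exp_pos (-t / 8)]

/-! ### Regularity of the symbols in t and r. -/

theorem continuous_genSinhc (r : ℝ) : Continuous fun t => genSinhc t r := by
  unfold genSinhc
  split_ifs <;> fun_prop

theorem continuous_genCosh (r : ℝ) : Continuous fun t => genCosh t r := by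
  unfold genCosh
  split_ifs <;> fun_prop

theorem continuous_K1 (r : ℝ) : Continuous fun t => K1 t r := by
  have := continuous_genSinhc r
  unfold K1; fun_prop

theorem continuous_K0 (r : ℝ) : Continuous fun t => K0 t r := by
  have := continuous_genSinhc r
  have := continuous_genCosh r
  unfold K0; fun_prop

theorem measurable_K1 (t : ℝ) : Measurable (K1 t) := (measurable_genSinhc t).const_mul _

theorem measurable_K0 (t : ℝ) : Measurable (K0 t) :=
  ((measurable_genCosh t).add ((measurable_genSinhc t).div_const 2)).const_mul _

theorem freq_nonneg {n : ℕ} (ξ : EuclideanSpace ℝ (Fin n)) : 0 ≤ freq ξ := by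
  unfold freq; positivity

theorem measurable_freq {n : ℕ} : Measurable (freq (n := n)) := by
  unfold freq; fun_prop

/-- Allows symbols to be compared for r > 0 only, so the value of r^{-γ} at r = 0 never matters. -/
theorem ae_freq_pos {n : ℕ} [NeZero n] :
    ∀ᵐ ξ : EuclideanSpace ℝ (Fin n), 0 < freq ξ := by
  have : ∀ᵐ ξ : EuclideanSpace ℝ (Fin n), ξ ≠ 0 := by
    simp [ae_iff, measure_singleton]
  filter_upwards [this] with ξ hξ
  have := norm_pos_iff.2 hξ
  unfold freq; positivity

/-! ### Calculus of radial Fourier multipliers on L². -/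

/-- The function `ξ ↦ k(2π|ξ|) f̂(ξ)`. -/
noncomputable def symbolMul {n : ℕ} (k : ℝ → ℝ) (f : L2 n) : EuclideanSpace ℝ (Fin n) → ℂ :=
  fun ξ => ((k (freq ξ) : ℝ) : ℂ) * (𝓕 f : L2 n) ξ

open Classical in
/-- The Fourier multiplier with radial symbol `k(2π|ξ|)`, and `0` on functions that it does
not map to `L²`. -/
noncomputable def mult {n : ℕ} (k : ℝ → ℝ) (f : L2 n) : L2 n :=
  if h : MemLp (symbolMul k f) 2 volume then 𝓕⁻ (h.toLp _ : L2 n) else 0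

/-- Measurable symbols that are bounded on the positive half-line. -/
structure IsSymbol (k : ℝ → ℝ) : Prop where
  measurable : Measurable k
  bounded : ∃ B, ∀ r, 0 < r → |k r| ≤ B

theorem enorm_L2 (f : L2 n) : ‖f‖ₑ = eLpNorm f 2 volume := Lp.enorm_def f

theorem enorm_fourier (f : L2 n) : ‖(𝓕 f : L2 n)‖ₑ = ‖f‖ₑ := by
  rw [← ofReal_norm, ← ofReal_norm, Lp.norm_fourier_eq]

theorem aestronglyMeasurable_symbolMul {k : ℝ → ℝ} (hk : Measurable k) (f : L2 n) :
    AEStronglyMeasurable (symbolMul k f) volume :=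
  (Complex.measurable_ofReal.comp (hk.comp measurable_freq)).aestronglyMeasurable.mul
    (Lp.aestronglyMeasurable _)

theorem memLp_symbolMul [NeZero n] {k : ℝ → ℝ} (hk : IsSymbol k) (f : L2 n) :
    MemLp (symbolMul k f) 2 volume := by
  obtain ⟨B, hB⟩ := hk.bounded
  refine (Lp.memLp (𝓕 f : L2 n)).of_le_mul (c := B)
    (aestronglyMeasurable_symbolMul hk.measurable f) ?_
  filter_upwards [ae_freq_pos] with ξ hξ
  rw [symbolMul, norm_mul, Complex.norm_real, Real.norm_eq_abs]
  exact mul_le_mul_of_nonneg_right (hB _ hξ) (norm_nonneg _)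

theorem mult_of_memLp {k : ℝ → ℝ} {f : L2 n} (h : MemLp (symbolMul k f) 2 volume) :
    mult k f = 𝓕⁻ (h.toLp _ : L2 n) := dif_pos h

theorem fourier_mult {k : ℝ → ℝ} {f : L2 n} (h : MemLp (symbolMul k f) 2 volume) :
    (𝓕 (mult k f) : L2 n) =ᵐ[volume] symbolMul k f := by
  rw [mult_of_memLp h, FourierTransform.fourier_fourierInv_eq]
  exact h.coeFn_toLp

theorem enorm_mult {k : ℝ → ℝ} {f : L2 n} (h : MemLp (symbolMul k f) 2 volume) :
    ‖mult k f‖ₑ = eLpNorm (symbolMul k f) 2 volume := by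
  rw [← enorm_fourier, enorm_L2, eLpNorm_congr_ae (fourier_mult h)]

/-- The default value 0 of `mult` makes this true without any integrability assumption. -/
theorem enorm_mult_le (k : ℝ → ℝ) (f : L2 n) :
    ‖mult k f‖ₑ ≤ eLpNorm (symbolMul k f) 2 volume := by
  by_cases h : MemLp (symbolMul k f) 2 volume
  · exact (enorm_mult h).le
  · simp [mult, dif_neg h]

theorem fourier_injective : Function.Injective (fun f : L2 n => (𝓕 f : L2 n)) :=
  (Lp.fourierTransformₗᵢ (EuclideanSpace ℝ (Fin n)) ℂ).injective

theorem L2_ext_fourier {f g : L2 n} (h : (𝓕 f : L2 n) =ᵐ[volume] (𝓕 g : L2 n)) : f = g :=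
  fourier_injective (Lp.ext h)

theorem symbolMul_mult {k l : ℝ → ℝ} {f : L2 n} (h : MemLp (symbolMul k f) 2 volume) :
    symbolMul l (mult k f) =ᵐ[volume] symbolMul (fun r => l r * k r) f := by
  filter_upwards [fourier_mult h] with ξ hξ
  simp only [symbolMul] at hξ ⊢
  rw [hξ]; push_cast; ring

theorem mult_congr_ae {k l : ℝ → ℝ} {f g : L2 n}
    (h : symbolMul k f =ᵐ[volume] symbolMul l g) : mult k f = mult l g := by
  by_cases hk : MemLp (symbolMul k f) 2 volume
  · have hl := (memLp_congr_ae h).1 hk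
    rw [mult_of_memLp hk, mult_of_memLp hl, MemLp.toLp_congr hk hl h]
  · have hl := fun hl => hk ((memLp_congr_ae h).2 hl)
    rw [mult, mult, dif_neg hk, dif_neg hl]

theorem mult_mult {k l : ℝ → ℝ} {f : L2 n} (h : MemLp (symbolMul k f) 2 volume) :
    mult l (mult k f) = mult (fun r => l r * k r) f :=
  mult_congr_ae (symbolMul_mult h)

theorem symbolMul_congr [NeZero n] {k l : ℝ → ℝ} (h : ∀ r, 0 < r → k r = l r) (f : L2 n) :
    symbolMul k f =ᵐ[volume] symbolMul l f := by
  filter_upwards [ae_freq_pos] with ξ hξ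
  simp only [symbolMul, h _ hξ]

theorem mult_congr [NeZero n] {k l : ℝ → ℝ} (h : ∀ r, 0 < r → k r = l r) (f : L2 n) :
    mult k f = mult l f :=
  mult_congr_ae (symbolMul_congr h f)

theorem mult_one (f : L2 n) : mult (fun _ => 1) f = f := by
  have h : symbolMul (fun _ => 1) f = (𝓕 f : L2 n) := by ext; simp [symbolMul]
  have hm : MemLp (symbolMul (fun _ => 1) f) 2 volume := by rw [h]; exact Lp.memLp _
  refine L2_ext_fourier ((fourier_mult hm).trans ?_)
  rw [h]

theorem eLpNorm_symbolMul_mono [NeZero n] {k l : ℝ → ℝ} (f : L2 n)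
    (h : ∀ r, 0 < r → |k r| ≤ |l r|) :
    eLpNorm (symbolMul k f) 2 volume ≤ eLpNorm (symbolMul l f) 2 volume := by
  refine eLpNorm_mono_ae ?_
  filter_upwards [ae_freq_pos] with ξ hξ
  simp only [symbolMul, norm_mul, Complex.norm_real, Real.norm_eq_abs]
  exact mul_le_mul_of_nonneg_right (h _ hξ) (norm_nonneg _)

theorem eLpNorm_symbolMul_const_mul (c : ℝ) (k : ℝ → ℝ) (f : L2 n) :
    eLpNorm (symbolMul (fun r => c * k r) f) 2 volume
      = ENNReal.ofReal |c| * eLpNorm (symbolMul k f) 2 volume := by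
  have : symbolMul (fun r => c * k r) f = (c : ℂ) • symbolMul k f := by
    ext ξ; simp [symbolMul, mul_assoc]
  rw [this, eLpNorm_const_smul]
  congr 1
  rw [← ofReal_norm, Complex.norm_real, Real.norm_eq_abs]

theorem eLpNorm_symbolMul_one (f : L2 n) :
    eLpNorm (symbolMul (fun _ => 1) f) 2 volume = ‖f‖ₑ := by
  have h : symbolMul (fun _ => 1) f = (𝓕 f : L2 n) := by ext; simp [symbolMul]
  rw [h, ← enorm_L2, enorm_fourier]

theorem eLpNorm_symbolMul_add_le {k l : ℝ → ℝ} (hk : Measurable k) (hl : Measurable l)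
    (f : L2 n) :
    eLpNorm (symbolMul (fun r => k r + l r) f) 2 volume
      ≤ eLpNorm (symbolMul k f) 2 volume + eLpNorm (symbolMul l f) 2 volume := by
  have : symbolMul (fun r => k r + l r) f = symbolMul k f + symbolMul l f := by
    ext ξ; simp [symbolMul, add_mul]
  rw [this]
  exact eLpNorm_add_le (aestronglyMeasurable_symbolMul hk f)
    (aestronglyMeasurable_symbolMul hl f) (by norm_num)

/-- The multiplier of a bounded symbol is a bounded operator on `L²`. -/
theorem enorm_mult_le_of_bound [NeZero n] {k : ℝ → ℝ} {B : ℝ}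
    (hB : ∀ r, 0 < r → |k r| ≤ B) (f : L2 n) : ‖mult k f‖ₑ ≤ ENNReal.ofReal B * ‖f‖ₑ := by
  have hB0 : 0 ≤ B := (abs_nonneg _).trans (hB 1 one_pos)
  refine (enorm_mult_le k f).trans ?_
  rw [← eLpNorm_symbolMul_one f, ← abs_of_nonneg hB0, ← eLpNorm_symbolMul_const_mul]
  refine eLpNorm_symbolMul_mono f (fun r hr => ?_)
  rw [mul_one]
  exact (hB r hr).trans (le_abs_self _)

theorem norm_mult_le [NeZero n] {k : ℝ → ℝ} {B : ℝ}
    (hB : ∀ r, 0 < r → |k r| ≤ B) (f : L2 n) : ‖mult k f‖ ≤ B * ‖f‖ := by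
  have hB0 : 0 ≤ B := (abs_nonneg _).trans (hB 1 one_pos)
  have h := enorm_mult_le_of_bound hB f
  rw [← ofReal_norm, ← ofReal_norm, ← ENNReal.ofReal_mul hB0] at h
  exact (ENNReal.ofReal_le_ofReal_iff (by positivity)).1 h

theorem fourier_add_ae (f g : L2 n) :
    (𝓕 (f + g) : L2 n) =ᵐ[volume] (𝓕 f : L2 n) + (𝓕 g : L2 n) := by
  rw [FourierTransform.fourier_add]; exact Lp.coeFn_add _ _

theorem fourier_smul_ae (c : ℂ) (f : L2 n) :
    (𝓕 (c • f) : L2 n) =ᵐ[volume] c • ((𝓕 f : L2 n) : EuclideanSpace ℝ (Fin n) → ℂ) := by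
  rw [FourierTransform.fourier_smul]; exact Lp.coeFn_smul _ _

theorem symbolMul_add (k : ℝ → ℝ) (f g : L2 n) :
    symbolMul k (f + g) =ᵐ[volume] symbolMul k f + symbolMul k g := by
  filter_upwards [fourier_add_ae f g] with ξ hξ
  simp only [symbolMul, Pi.add_apply, hξ, mul_add]

theorem symbolMul_smul (k : ℝ → ℝ) (c : ℂ) (f : L2 n) :
    symbolMul k (c • f) =ᵐ[volume] c • symbolMul k f := by
  filter_upwards [fourier_smul_ae c f] with ξ hξ
  simp only [symbolMul, Pi.smul_apply, hξ, smul_eq_mul, mul_left_comm]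

theorem mult_add {k : ℝ → ℝ} {f g : L2 n} (hf : MemLp (symbolMul k f) 2 volume)
    (hg : MemLp (symbolMul k g) 2 volume) : mult k (f + g) = mult k f + mult k g := by
  have h := (memLp_congr_ae (symbolMul_add k f g)).2 (hf.add hg)
  rw [mult_of_memLp h, mult_of_memLp hf, mult_of_memLp hg,
    ← FourierTransform.fourierInv_add, ← MemLp.toLp_add hf hg]
  congr 1
  exact MemLp.toLp_congr h (hf.add hg) (symbolMul_add k f g)

theorem mult_smul {k : ℝ → ℝ} {f : L2 n} (hf : MemLp (symbolMul k f) 2 volume) (c : ℂ) :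
    mult k (c • f) = c • mult k f := by
  have h := (memLp_congr_ae (symbolMul_smul k c f)).2 (hf.const_smul c)
  rw [mult_of_memLp h, mult_of_memLp hf,
    ← FourierTransform.fourierInv_smul, ← MemLp.toLp_const_smul c hf]
  congr 1
  exact MemLp.toLp_congr h (hf.const_smul c) (symbolMul_smul k c f)

/-- The Fourier multiplier of a bounded symbol as a continuous linear map. -/
noncomputable def multCLM [NeZero n] (k : ℝ → ℝ) (hk : IsSymbol k) : L2 n →L[ℂ] L2 n :=
  LinearMap.mkContinuousOfExistsBound
    { toFun := mult k
      map_add' := fun f g => mult_add (memLp_symbolMul hk f) (memLp_symbolMul hk g)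
      map_smul' := fun c f => mult_smul (memLp_symbolMul hk f) c }
    (hk.bounded.imp fun _ hB f => norm_mult_le hB f)

@[simp] theorem multCLM_apply [NeZero n] (k : ℝ → ℝ) (hk : IsSymbol k) (f : L2 n) :
    multCLM k hk f = mult k f := rfl

theorem mult_sub [NeZero n] {k : ℝ → ℝ} (hk : IsSymbol k) (f g : L2 n) :
    mult k (f - g) = mult k f - mult k g := (multCLM k hk).map_sub f g

theorem isSymbol_mul {k l : ℝ → ℝ} (hk : IsSymbol k) (hl : IsSymbol l) :
    IsSymbol fun r => k r * l r := by
  obtain ⟨A, hA⟩ := hk.bounded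
  obtain ⟨B, hB⟩ := hl.bounded
  refine ⟨hk.measurable.mul hl.measurable, A * B, fun r hr => ?_⟩
  rw [abs_mul]
  exact mul_le_mul (hA r hr) (hB r hr) (abs_nonneg _) ((abs_nonneg _).trans (hA r hr))

theorem isSymbol_K1 (t : ℝ) : IsSymbol (K1 t) := by
  refine ⟨measurable_K1 t, Real.exp (-t / 2) * (|t| * Real.exp |t|), fun r _ => ?_⟩
  rw [K1, abs_mul, abs_of_pos (Real.exp_pos _)]
  exact mul_le_mul_of_nonneg_left (abs_genSinhc_le t r) (Real.exp_pos _).le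

theorem isSymbol_K0 (t : ℝ) : IsSymbol (K0 t) := by
  refine ⟨measurable_K0 t, Real.exp (-t / 2) * (|t| * Real.exp |t| + Real.exp |t|), fun r _ => ?_⟩
  rw [K0, abs_mul, abs_of_pos (Real.exp_pos _)]
  refine mul_le_mul_of_nonneg_left ?_ (Real.exp_pos _).le
  have h3 := abs_add_le (genCosh t r) (genSinhc t r / 2)
  rw [abs_div, abs_two] at h3
  linarith [abs_nonneg (genSinhc t r), abs_genSinhc_le t r, abs_genCosh_le t r]

theorem E1_eq_mult (t : ℝ) (f : L2 n) : E1 t f = mult (K1 t) f :=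
  (mult_of_memLp (memLp_K1_mul t (𝓕 f : L2 n))).symm

theorem E0_eq_mult (t : ℝ) (f : L2 n) : E0 t f = mult (K0 t) f :=
  (mult_of_memLp (memLp_K0_mul t (𝓕 f : L2 n))).symm

theorem norm_sub_eq_of_fourier {f g : L2 n} {φ ψ : EuclideanSpace ℝ (Fin n) → ℂ}
    (hf : (𝓕 f : L2 n) =ᵐ[volume] φ) (hg : (𝓕 g : L2 n) =ᵐ[volume] ψ) :
    ‖f - g‖ₑ ^ 2 = ∫⁻ ξ, ‖φ ξ - ψ ξ‖ₑ ^ 2 := by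
  have h : (𝓕 (f - g) : L2 n) = 𝓕 f - 𝓕 g :=
    (Lp.fourierTransformₗᵢ (EuclideanSpace ℝ (Fin n)) ℂ).map_sub f g
  have h2 : ((𝓕 (f - g) : L2 n) : EuclideanSpace ℝ (Fin n) → ℂ) =ᵐ[volume] fun ξ => φ ξ - ψ ξ := by
    rw [h]
    filter_upwards [Lp.coeFn_sub (𝓕 f : L2 n) (𝓕 g : L2 n), hf, hg] with ξ h1 h2 h3
    rw [h1, Pi.sub_apply, h2, h3]
  rw [← enorm_fourier, enorm_L2, eLpNorm_congr_ae h2,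
    eLpNorm_eq_lintegral_rpow_enorm_toReal (by norm_num) (by norm_num)]
  simp only [ENNReal.toReal_ofNat, ENNReal.rpow_ofNat, one_div]
  rw [← ENNReal.rpow_ofNat, ← ENNReal.rpow_mul]
  norm_num

/-- Strong continuity of a locally bounded, pointwise continuous family of multipliers. -/
theorem continuousAt_mult [NeZero n] {X : Type*} [TopologicalSpace X]
    [FirstCountableTopology X] {k : X → ℝ → ℝ} {x₀ : X} {B : ℝ}
    (hm : ∀ x, Measurable (k x)) (hB : ∀ᶠ x in 𝓝 x₀, ∀ r, 0 < r → |k x r| ≤ B)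
    (hc : ∀ r, 0 < r → ContinuousAt (fun x => k x r) x₀) {f : X → L2 n}
    (hf : ContinuousAt f x₀) : ContinuousAt (fun x => mult (k x) (f x)) x₀ := by
  have hB0 : 0 ≤ B := (abs_nonneg _).trans (hB.self_of_nhds 1 one_pos)
  have hsym : ∀ᶠ x in 𝓝 x₀, IsSymbol (k x) := by
    filter_upwards [hB] with x hx using ⟨hm x, B, hx⟩
  -- With the function fixed, dominated convergence on the Fourier side applies, with majorant
  -- (2B)²|f̂|². The variation of the function is handled afterwards by the uniform operator bound
  -- B.
  have hfix : Tendsto (fun x => mult (k x) (f x₀)) (𝓝 x₀) (𝓝 (mult (k x₀) (f x₀))) := by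
    rw [tendsto_iff_edist_tendsto_0]
    have hsq : Tendsto (fun x => ‖mult (k x) (f x₀) - mult (k x₀) (f x₀)‖ₑ ^ 2) (𝓝 x₀) (𝓝 0) := by
      have h1 : ∀ᶠ x in 𝓝 x₀, ∫⁻ ξ, ‖symbolMul (k x) (f x₀) ξ - symbolMul (k x₀) (f x₀) ξ‖ₑ ^ 2
          = ‖mult (k x) (f x₀) - mult (k x₀) (f x₀)‖ₑ ^ 2 := by
        filter_upwards [hsym] with x hx
        exact (norm_sub_eq_of_fourier (fourier_mult (memLp_symbolMul hx _))
          (fourier_mult (memLp_symbolMul hsym.self_of_nhds _))).symm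
      refine Tendsto.congr' h1 ?_
      have h0 : (0 : ℝ≥0∞) = ∫⁻ _ξ : EuclideanSpace ℝ (Fin n), 0 := by simp
      rw [h0]
      refine tendsto_lintegral_filter_of_dominated_convergence'
        (fun ξ => ENNReal.ofReal (2 * B) ^ 2 * ‖(𝓕 (f x₀) : L2 n) ξ‖ₑ ^ 2) ?_ ?_ ?_ ?_
      · refine Eventually.of_forall fun x => ?_
        exact (((aestronglyMeasurable_symbolMul (hm x) _).sub
          (aestronglyMeasurable_symbolMul (hm x₀) _)).enorm.pow_const 2)
      · filter_upwards [hB] with x hx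
        filter_upwards [ae_freq_pos] with ξ hξ
        rw [← mul_pow]
        gcongr
        simp only [symbolMul]
        rw [← sub_mul, enorm_mul, ← Complex.ofReal_sub, ← ofReal_norm, Complex.norm_real,
          Real.norm_eq_abs]
        gcongr
        have := hx _ hξ
        have := hB.self_of_nhds _ hξ
        have := abs_sub (k x (freq ξ)) (k x₀ (freq ξ))
        linarith
      · rw [lintegral_const_mul' _ _ (ENNReal.pow_ne_top ENNReal.ofReal_ne_top)]
        refine ENNReal.mul_ne_top (ENNReal.pow_ne_top ENNReal.ofReal_ne_top) ?_
        have h := (Lp.memLp (𝓕 (f x₀) : L2 n)).eLpNorm_lt_top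
        rw [eLpNorm_lt_top_iff_lintegral_rpow_enorm_lt_top (by norm_num) (by norm_num)] at h
        simpa using h.ne
      · filter_upwards [ae_freq_pos] with ξ hξ
        have h2 : ContinuousAt (fun x => ‖symbolMul (k x) (f x₀) ξ - symbolMul (k x₀) (f x₀) ξ‖ₑ ^ 2)
            x₀ := by
          have := hc _ hξ
          unfold symbolMul
          refine ContinuousAt.comp (g := fun y : ℝ≥0∞ => y ^ 2) (ENNReal.continuous_pow 2).continuousAt
            (continuous_enorm.continuousAt.comp ?_)
          fun_prop
        simpa [ContinuousAt] using h2
    have h3 := ((ENNReal.continuous_rpow_const (y := 1 / 2)).tendsto 0).comp hsq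
    simp only [edist_eq_enorm_sub]
    refine (h3.congr fun x => ?_).trans (by simp)
    simp only [Function.comp]
    rw [← ENNReal.rpow_ofNat, ← ENNReal.rpow_mul]
    norm_num
  have hdiff : Tendsto (fun x => mult (k x) (f x - f x₀)) (𝓝 x₀) (𝓝 0) := by
    have h1 : Tendsto (fun x => B * ‖f x - f x₀‖) (𝓝 x₀) (𝓝 0) := by
      have : Tendsto (fun x => f x - f x₀) (𝓝 x₀) (𝓝 0) := by
        simpa using hf.tendsto.sub_const (f x₀)
      simpa using this.norm.const_mul B
    refine squeeze_zero_norm' ?_ h1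
    filter_upwards [hB] with x hx using norm_mult_le hx _
  have := hdiff.add hfix
  rw [zero_add] at this
  refine this.congr' ?_
  filter_upwards [hsym] with x hx
  rw [mult_sub hx, sub_add_cancel]

/-! ### Fourier inversion and the Sobolev embedding. -/

/-- A square-integrable function with integrable Fourier transform is given by the Fourier
inversion integral. -/
theorem ae_eq_fourierInv_of_integrable (f : L2 n) (h : Integrable (𝓕 f : L2 n) volume) :
    (f : EuclideanSpace ℝ (Fin n) → ℂ) =ᵐ[volume]
      𝓕⁻ ((𝓕 f : L2 n) : EuclideanSpace ℝ (Fin n) → ℂ) := by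
  have hcont : Continuous (𝓕⁻ ((𝓕 f : L2 n) : EuclideanSpace ℝ (Fin n) → ℂ)) :=
    VectorFourier.fourierIntegral_continuous Real.continuous_fourierChar
      (by
        change Continuous fun p : EuclideanSpace ℝ (Fin n) × EuclideanSpace ℝ (Fin n) =>
          -(inner ℝ p.1 p.2)
        fun_prop) h
  refine ae_eq_of_integral_contDiff_smul_eq ?_ hcont.locallyIntegrable fun g hg hgc => ?_
  · exact ((Lp.memLp f).locallyIntegrable (by norm_num))
  have hφs : HasCompactSupport (fun x => (g x : ℂ)) := hgc.comp_left (g := fun y : ℝ => (y : ℂ)) rfl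
  set φ : SchwartzMap (EuclideanSpace ℝ (Fin n)) ℂ :=
    hφs.toSchwartzMap (Complex.ofRealCLM.contDiff.comp hg) with hφ
  have hφg : ∀ x, φ x = (g x : ℂ) := fun x => rfl
  -- Both sides of the inversion formula are tested against φ. This identity is the definition of
  -- the inverse transform of tempered distributions; `e2` is Fubini for the integrable function f̂.
  have e1 : (∫ x, φ x • f x) = ∫ ξ, (𝓕⁻ φ) ξ • (𝓕 f : L2 n) ξ := by
    have h1 := Lp.fourierInv_toTemperedDistribution_eq (𝓕 f : L2 n)
    rw [FourierTransform.fourierInv_fourier_eq] at h1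
    have h2 := congrArg (fun T => T φ) h1
    simp only [TemperedDistribution.fourierInv_apply, Lp.toTemperedDistribution_apply] at h2
    exact h2.symm
  have e2 : ∫ ξ, (𝓕⁻ (φ : EuclideanSpace ℝ (Fin n) → ℂ)) ξ • (𝓕 f : L2 n) ξ
      = ∫ x, φ x • 𝓕⁻ ((𝓕 f : L2 n) : EuclideanSpace ℝ (Fin n) → ℂ) x := by
    have := VectorFourier.integral_fourierIntegral_smul_eq_flip (μ := volume) (ν := volume)
      (L := -innerₗ (EuclideanSpace ℝ (Fin n))) Real.continuous_fourierChar
      (by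
        change Continuous fun p : EuclideanSpace ℝ (Fin n) × EuclideanSpace ℝ (Fin n) =>
          -(inner ℝ p.1 p.2)
        fun_prop) φ.integrable h
    have hflip : (-innerₗ (EuclideanSpace ℝ (Fin n))).flip = -innerₗ (EuclideanSpace ℝ (Fin n)) := by
      ext x y
      simp [real_inner_comm]
    rw [hflip] at this
    exact this
  rw [SchwartzMap.fourierInv_coe, e2] at e1
  simpa only [hφg, Complex.coe_smul] using e1

theorem ae_enorm_le_lintegral_fourier (f : L2 n) :
    ∀ᵐ x, ‖f x‖ₑ ≤ ∫⁻ ξ, ‖(𝓕 f : L2 n) ξ‖ₑ := by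
  by_cases h : Integrable (𝓕 f : L2 n) volume
  · filter_upwards [ae_eq_fourierInv_of_integrable f h] with x hx
    rw [hx, Real.fourierInv_eq]
    refine (enorm_integral_le_lintegral_enorm _).trans (lintegral_mono fun ξ => ?_)
    rw [← ofReal_norm, Circle.norm_smul, ofReal_norm]
  · have : ∫⁻ ξ, ‖(𝓕 f : L2 n) ξ‖ₑ = ∞ := by
      by_contra h'
      exact h ⟨Lp.aestronglyMeasurable _, lt_top_iff_ne_top.2 h'⟩
    simp [this]

/-- Polar coordinates: the radial integrand ρ^{n-1-2σ} is integrable at 0 because 2σ < n. -/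
theorem exists_setLIntegral_freq_rpow_le [NeZero n] {σ : ℝ} (hσ : 2 * σ < n) :
    ∃ c : ℝ, 0 < c ∧ ∀ A : ℝ, 0 < A →
      ∫⁻ ξ in {ξ : EuclideanSpace ℝ (Fin n) | freq ξ ≤ A}, ENNReal.ofReal (freq ξ ^ (-2 * σ))
        ≤ ENNReal.ofReal (c * A ^ (n - 2 * σ)) := by
  have hn : 1 ≤ n := NeZero.one_le
  have hE : Module.finrank ℝ (EuclideanSpace ℝ (Fin n)) = n := by simp
  have hb : 0 < (n : ℝ) - 2 * σ := by linarith
  have hpi : 0 < 2 * Real.pi := by positivity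
  set V := (volume : Measure (EuclideanSpace ℝ (Fin n))).real (Metric.ball 0 1)
  have hV : 0 ≤ V := measureReal_nonneg
  -- The summand 1 only makes the constant evidently positive.
  refine ⟨n * V * ((2 * Real.pi) ^ (-2 * σ) * (2 * Real.pi)⁻¹ ^ (n - 2 * σ) / (n - 2 * σ)) + 1,
    by positivity, fun A hA => ?_⟩
  set A' := (2 * Real.pi)⁻¹ * A with hA'
  have hA'0 : 0 < A' := by positivity
  set g : ℝ → ℝ := (Set.Iic A').indicator fun ρ => (2 * Real.pi * ρ) ^ (-2 * σ) with hg
  have hset : {ξ : EuclideanSpace ℝ (Fin n) | freq ξ ≤ A} = {ξ | ‖ξ‖ ∈ Set.Iic A'} := by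
    ext ξ
    simp only [Set.mem_ofPred_eq, Set.mem_Iic, hA', freq]
    rw [← div_eq_inv_mul, le_div_iff₀ hpi, mul_comm]
  have hms : MeasurableSet {ξ : EuclideanSpace ℝ (Fin n) | freq ξ ≤ A} :=
    measurableSet_le measurable_freq measurable_const
  have e1 : ∫⁻ ξ in {ξ : EuclideanSpace ℝ (Fin n) | freq ξ ≤ A}, ENNReal.ofReal (freq ξ ^ (-2 * σ))
      = ∫⁻ ξ : EuclideanSpace ℝ (Fin n), ENNReal.ofReal (g ‖ξ‖) := by
    rw [← lintegral_indicator hms]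
    refine lintegral_congr fun ξ => ?_
    rw [hset]
    by_cases h : ‖ξ‖ ≤ A'
    · simp [hg, h, freq]
    · simp [hg, h]
  have e2 : ∀ y ∈ Set.Ioi (0 : ℝ), y ^ (n - 1) • g y
      = (Set.Iic A').indicator (fun y => (2 * Real.pi) ^ (-2 * σ) * y ^ ((n : ℝ) - 1 - 2 * σ)) y := by
    intro y hy
    have hy' : 0 < y := hy
    by_cases h : y ≤ A'
    · rw [hg, Set.indicator_of_mem (show y ∈ Set.Iic A' from h),
        Set.indicator_of_mem (show y ∈ Set.Iic A' from h), smul_eq_mul,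
        Real.mul_rpow hpi.le hy'.le, mul_left_comm, ← Real.rpow_natCast, ← Real.rpow_add hy']
      congr 2
      push_cast [Nat.cast_sub hn]; ring
    · simp [hg, h]
  have hint : IntervalIntegrable (fun y : ℝ => (2 * Real.pi) ^ (-2 * σ) * y ^ ((n : ℝ) - 1 - 2 * σ))
      volume 0 A' :=
    (intervalIntegral.intervalIntegrable_rpow' (by linarith)).const_mul _
  have hIoc : Set.Ioi (0 : ℝ) ∩ Set.Iic A' = Set.Ioc 0 A' := by
    ext; simp
  have hgi : Integrable (fun ξ : EuclideanSpace ℝ (Fin n) => g ‖ξ‖) := by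
    rw [integrable_fun_norm_addHaar, hE, integrableOn_congr_fun e2 measurableSet_Ioi,
      IntegrableOn, integrable_indicator_iff measurableSet_Iic, IntegrableOn,
      Measure.restrict_restrict measurableSet_Iic, Set.inter_comm, hIoc]
    exact (intervalIntegrable_iff_integrableOn_Ioc_of_le hA'0.le).1 hint
  rw [e1, ← ofReal_integral_eq_lintegral_ofReal hgi]
  · refine ENNReal.ofReal_le_ofReal ?_
    rw [integral_fun_norm_addHaar, hE, setIntegral_congr_fun measurableSet_Ioi e2,
      setIntegral_indicator measurableSet_Iic, hIoc,
      ← intervalIntegral.integral_of_le hA'0.le, intervalIntegral.integral_const_mul,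
      integral_rpow (Or.inl (by linarith))]
    have : (n : ℝ) - 1 - 2 * σ + 1 = n - 2 * σ := by ring
    rw [this, Real.zero_rpow hb.ne', sub_zero, hA', Real.mul_rpow (by positivity) hA.le]
    have hAp : 0 < A ^ ((n : ℝ) - 2 * σ) := by positivity
    simp only [nsmul_eq_mul, smul_eq_mul]
    rw [add_mul, one_mul]
    refine le_trans (le_of_eq ?_) (le_add_of_nonneg_right hAp.le)
    change (n : ℝ) * (V * _) = _
    ring
  · refine Eventually.of_forall fun ξ => ?_
    change 0 ≤ g ‖ξ‖
    by_cases h : ‖ξ‖ ≤ A'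
    · rw [hg, Set.indicator_of_mem (show ‖ξ‖ ∈ Set.Iic A' from h)]
      positivity
    · simp [hg, h]

theorem mult_add_symbol {k l : ℝ → ℝ} {f : L2 n} (hk : MemLp (symbolMul k f) 2 volume)
    (hl : MemLp (symbolMul l f) 2 volume) :
    mult (fun r => k r + l r) f = mult k f + mult l f := by
  have h1 : symbolMul (fun r => k r + l r) f = symbolMul k f + symbolMul l f := by
    ext ξ; simp [symbolMul, add_mul]
  have h : MemLp (symbolMul (fun r => k r + l r) f) 2 volume := by rw [h1]; exact hk.add hl
  rw [mult_of_memLp h, mult_of_memLp hk, mult_of_memLp hl,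
    ← FourierTransform.fourierInv_add, ← MemLp.toLp_add hk hl]
  congr 1
  exact MemLp.toLp_congr h (hk.add hl) (by rw [h1])

theorem homSobolevNorm_eq (σ : ℝ) (f : L2 n) :
    homSobolevNorm σ f = eLpNorm (symbolMul (fun r => r ^ σ) f) 2 volume := rfl

theorem sobolevNorm_eq (s : ℝ) (f : L2 n) :
    sobolevNorm s f = eLpNorm (symbolMul (fun r => (1 + r ^ 2) ^ (s / 2)) f) 2 volume := rfl

theorem eLpNorm_two_sq {X : Type*} [MeasurableSpace X] {μ : Measure X} (g : X → ℂ) :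
    eLpNorm g 2 μ ^ 2 = ∫⁻ ξ, ‖g ξ‖ₑ ^ 2 ∂μ := by
  rw [eLpNorm_eq_lintegral_rpow_enorm_toReal (by norm_num) (by norm_num)]
  simp only [ENNReal.toReal_ofNat, ENNReal.rpow_ofNat, one_div]
  rw [← ENNReal.rpow_ofNat, ← ENNReal.rpow_mul]
  norm_num

theorem enorm_symbolMul_sq (k : ℝ → ℝ) (f : L2 n) (ξ : EuclideanSpace ℝ (Fin n)) :
    ‖symbolMul k f ξ‖ₑ ^ 2 = ENNReal.ofReal (k (freq ξ) ^ 2) * ‖(𝓕 f : L2 n) ξ‖ₑ ^ 2 := by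
  rw [symbolMul, enorm_mul, mul_pow, ← ofReal_norm, Complex.norm_real, Real.norm_eq_abs,
    ← ENNReal.ofReal_pow (abs_nonneg _), sq_abs]

/-- Bernstein's inequality, from `Ḣ^σ` to `L^∞`. -/
theorem exists_setLIntegral_fourier_le [NeZero n] {σ : ℝ} (hσ : 2 * σ < n) :
    ∃ c : ℝ, 0 < c ∧ ∀ A : ℝ, 0 < A → ∀ f : L2 n,
      ∫⁻ ξ in {ξ : EuclideanSpace ℝ (Fin n) | freq ξ ≤ A}, ‖(𝓕 f : L2 n) ξ‖ₑ
        ≤ ENNReal.ofReal (c * A ^ ((n : ℝ) / 2 - σ)) * homSobolevNorm σ f := by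
  obtain ⟨c, hc, hcA⟩ := exists_setLIntegral_freq_rpow_le (n := n) hσ
  refine ⟨Real.sqrt c, Real.sqrt_pos.2 hc, fun A hA f => ?_⟩
  set S := {ξ : EuclideanSpace ℝ (Fin n) | freq ξ ≤ A}
  -- Cauchy–Schwarz for the splitting |f̂| = |ξ|^{-σ} · |ξ|^σ |f̂| on the ball of radius A.
  set w : EuclideanSpace ℝ (Fin n) → ℝ≥0∞ := fun ξ => ENNReal.ofReal (freq ξ ^ (-σ)) with hw
  set v : EuclideanSpace ℝ (Fin n) → ℝ≥0∞ := fun ξ => ‖symbolMul (fun r => r ^ σ) f ξ‖ₑ with hv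
  have hwm : Measurable w := by have := measurable_freq (n := n); fun_prop
  have h1 : ∫⁻ ξ in S, ‖(𝓕 f : L2 n) ξ‖ₑ = ∫⁻ ξ in S, (w * v) ξ := by
    refine lintegral_congr_ae (ae_restrict_of_ae ?_)
    filter_upwards [ae_freq_pos] with ξ hξ
    rw [Pi.mul_apply, hw, hv]
    simp only [symbolMul]
    rw [enorm_mul, ← mul_assoc, ← ofReal_norm ((freq ξ ^ σ : ℝ) : ℂ), Complex.norm_real,
      Real.norm_of_nonneg (by positivity), ← ENNReal.ofReal_mul (by positivity),
      ← Real.rpow_add hξ]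
    simp
  rw [h1]
  refine (ENNReal.lintegral_mul_le_Lp_mul_Lq (volume.restrict S)
    (Real.holderConjugate_iff.2 ⟨by norm_num, by norm_num⟩ : Real.HolderConjugate 2 2)
    hwm.aemeasurable
    (aestronglyMeasurable_symbolMul (by fun_prop) f).enorm.restrict).trans ?_
  refine mul_le_mul' ?_ ?_
  · have h2 : ∫⁻ ξ in S, w ξ ^ (2 : ℝ)
        ≤ ENNReal.ofReal (c * A ^ (n - 2 * σ)) := by
      refine le_trans (le_of_eq ?_) (hcA A hA)
      refine lintegral_congr_ae (ae_restrict_of_ae ?_)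
      filter_upwards [ae_freq_pos] with ξ hξ
      rw [hw, ENNReal.ofReal_rpow_of_nonneg (by positivity) (by norm_num), ← Real.rpow_mul hξ.le]
      ring_nf
    refine (ENNReal.rpow_le_rpow h2 (by norm_num)).trans (le_of_eq ?_)
    rw [ENNReal.ofReal_rpow_of_nonneg (by positivity) (by norm_num),
      Real.mul_rpow hc.le (by positivity), ← Real.sqrt_eq_rpow, ← Real.rpow_mul hA.le]
    ring_nf
  · rw [homSobolevNorm_eq, eLpNorm_eq_lintegral_rpow_enorm_toReal (by norm_num) (by norm_num)]
    simp only [ENNReal.toReal_ofNat]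
    exact ENNReal.rpow_le_rpow (setLIntegral_le_lintegral _ _) (by norm_num)

/-- The inner integral of the layer-cake argument for the Sobolev embedding, once the integrations
in t and ξ are exchanged. -/
theorem setLIntegral_rpow_lt {q L : ℝ} (hq : 2 < q) (hL : 0 ≤ L) :
    ∫⁻ t in Set.Ioi (0 : ℝ), (if t < L then ENNReal.ofReal (t ^ (q - 3)) else 0)
      = ENNReal.ofReal (L ^ (q - 2) / (q - 2)) := by
  have h1 : (fun t : ℝ => if t < L then ENNReal.ofReal (t ^ (q - 3)) else 0)
      = (Set.Iio L).indicator fun t => ENNReal.ofReal (t ^ (q - 3)) := by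
    ext t; simp [Set.indicator_apply]
  have hint : IntervalIntegrable (fun t : ℝ => t ^ (q - 3)) volume 0 L :=
    intervalIntegral.intervalIntegrable_rpow' (by linarith)
  rw [h1, setLIntegral_indicator measurableSet_Iio, Set.inter_comm, Set.Ioi_inter_Iio,
    setLIntegral_congr Ioo_ae_eq_Ioc, ← ofReal_integral_eq_lintegral_ofReal
      ((intervalIntegrable_iff_integrableOn_Ioc_of_le hL).1 hint),
    ← intervalIntegral.integral_of_le hL, integral_rpow (Or.inl (by linarith))]
  · have : q - 3 + 1 = q - 2 := by ring
    rw [this, Real.zero_rpow (by linarith), sub_zero]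
  · refine (ae_restrict_iff' measurableSet_Ioc).2 (Eventually.of_forall fun t ht => ?_)
    have := ht.1
    change 0 ≤ t ^ (q - 3)
    positivity

/-- The distribution function of `f` is controlled by the high frequencies of `f`. -/
theorem meas_lt_norm_le [NeZero n] {σ c h : ℝ} (hσ : 2 * σ < n) (hc : 0 < c) (hh : 0 < h)
    (hB : ∀ A : ℝ, 0 < A → ∀ f : L2 n,
      ∫⁻ ξ in {ξ : EuclideanSpace ℝ (Fin n) | freq ξ ≤ A}, ‖(𝓕 f : L2 n) ξ‖ₑ
        ≤ ENNReal.ofReal (c * A ^ ((n : ℝ) / 2 - σ)) * homSobolevNorm σ f)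
    (f : L2 n) (hf : homSobolevNorm σ f = ENNReal.ofReal h) {t : ℝ} (ht : 0 < t) :
    volume {x | t < ‖f x‖} ≤ ENNReal.ofReal (4 * t ^ (-2 : ℝ)) *
      ∫⁻ ξ, if t < 2 * c * h * freq ξ ^ ((n : ℝ) / 2 - σ) then ‖(𝓕 f : L2 n) ξ‖ₑ ^ 2 else 0 := by
  have hb : 0 < (n : ℝ) / 2 - σ := by linarith
  set b := (n : ℝ) / 2 - σ
  set D := 2 * c * h with hD
  have hD0 : 0 < D := by positivity
  -- The cut-off for which Bernstein's inequality bounds the low-frequency part by exactly t/2: c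
  -- A^b h = t/2. Where |f| > t, the high-frequency part then exceeds t/2, and Chebyshev's
  -- inequality in L² applies to it.
  set A := (t / D) ^ b⁻¹ with hA
  have hA0 : 0 < A := by positivity
  have hAb : A ^ b = t / D := Real.rpow_inv_rpow (by positivity) hb.ne'
  have hiff : ∀ r : ℝ, 0 ≤ r → (t < D * r ^ b ↔ A < r) := by
    intro r hr
    rw [← Real.rpow_lt_rpow_iff hA0.le hr hb, hAb, div_lt_iff₀ hD0, mul_comm]
  set lo : ℝ → ℝ := fun r => if r ≤ A then 1 else 0 with hlo
  set hi : ℝ → ℝ := fun r => if r ≤ A then 0 else 1 with hhi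
  have hlos : IsSymbol lo := ⟨Measurable.ite measurableSet_Iic (by fun_prop) (by fun_prop), 1,
    fun r _ => by simp only [hlo]; split_ifs <;> simp⟩
  have hhis : IsSymbol hi := ⟨Measurable.ite measurableSet_Iic (by fun_prop) (by fun_prop), 1,
    fun r _ => by simp only [hhi]; split_ifs <;> simp⟩
  have hlom := memLp_symbolMul hlos f
  have hhim := memLp_symbolMul hhis f
  have hsum : f = mult lo f + mult hi f := by
    rw [← mult_add_symbol hlom hhim]
    conv_lhs => rw [← mult_one f]
    congr 1
    ext r; simp only [hlo, hhi]; split_ifs <;> simp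
  have hlow : ∀ᵐ x, ‖mult lo f x‖ₑ ≤ ENNReal.ofReal (t / 2) := by
    have h1 : ∫⁻ ξ, ‖(𝓕 (mult lo f) : L2 n) ξ‖ₑ
        = ∫⁻ ξ in {ξ : EuclideanSpace ℝ (Fin n) | freq ξ ≤ A}, ‖(𝓕 f : L2 n) ξ‖ₑ := by
      rw [← lintegral_indicator (measurableSet_le measurable_freq measurable_const)]
      refine lintegral_congr_ae ?_
      filter_upwards [fourier_mult hlom] with ξ hξ
      rw [hξ]
      by_cases hle : freq ξ ≤ A <;> simp [symbolMul, hlo, hle]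
    filter_upwards [ae_enorm_le_lintegral_fourier (mult lo f)] with x hx
    refine hx.trans (h1.trans_le ((hB A hA0 f).trans (le_of_eq ?_)))
    rw [hf, hAb, ← ENNReal.ofReal_mul (by positivity)]
    congr 1
    rw [hD]; field_simp
  have hsub : volume {x | t < ‖f x‖} ≤ volume {x | ENNReal.ofReal (t / 2) ≤ ‖mult hi f x‖ₑ} := by
    refine measure_mono_ae ?_
    have hadd : (f : EuclideanSpace ℝ (Fin n) → ℂ) =ᵐ[volume] mult lo f + mult hi f := by
      conv_lhs => rw [hsum]
      exact Lp.coeFn_add _ _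
    filter_upwards [hlow, hadd] with x hx1 hx2 hx3
    have hx3' : t < ‖f x‖ := hx3
    change ENNReal.ofReal (t / 2) ≤ ‖mult hi f x‖ₑ
    rw [← ofReal_norm] at hx1 ⊢
    have h1 := (ENNReal.ofReal_le_ofReal_iff (by positivity)).1 hx1
    refine ENNReal.ofReal_le_ofReal ?_
    rw [hx2] at hx3'
    have := norm_add_le (mult lo f x) (mult hi f x)
    rw [Pi.add_apply] at hx3'
    linarith
  have hcheb := mul_meas_ge_le_pow_eLpNorm' (μ := volume) (p := 2) (by norm_num) (by norm_num)
    (Lp.aestronglyMeasurable (mult hi f)) (ENNReal.ofReal (t / 2))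
  have hnorm : eLpNorm (mult hi f) 2 volume ^ 2
      = ∫⁻ ξ, if t < D * freq ξ ^ b then ‖(𝓕 f : L2 n) ξ‖ₑ ^ 2 else 0 := by
    rw [← enorm_L2, enorm_mult hhim, eLpNorm_two_sq]
    refine lintegral_congr fun ξ => ?_
    rw [enorm_symbolMul_sq]
    by_cases hle : freq ξ ≤ A
    · rw [if_neg (by rw [hiff _ (freq_nonneg ξ)]; exact not_lt.2 hle)]; simp [hhi, hle]
    · rw [if_pos ((hiff _ (freq_nonneg ξ)).2 (not_le.1 hle))]; simp [hhi, hle]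
  simp only [ENNReal.toReal_ofNat, ENNReal.rpow_ofNat] at hcheb
  rw [hnorm] at hcheb
  refine hsub.trans ?_
  have hinv : ENNReal.ofReal (4 * t ^ (-2 : ℝ)) * ENNReal.ofReal (t / 2) ^ 2 = 1 := by
    rw [← ENNReal.ofReal_pow (by positivity), ← ENNReal.ofReal_mul (by positivity),
      Real.rpow_neg ht.le, Real.rpow_two]
    rw [show 4 * (t ^ 2)⁻¹ * (t / 2) ^ 2 = 1 by field_simp; norm_num, ENNReal.ofReal_one]
  calc volume {x | ENNReal.ofReal (t / 2) ≤ ‖mult hi f x‖ₑ}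
      = ENNReal.ofReal (4 * t ^ (-2 : ℝ)) * (ENNReal.ofReal (t / 2) ^ 2 *
        volume {x | ENNReal.ofReal (t / 2) ≤ ‖mult hi f x‖ₑ}) := by
        rw [← mul_assoc, hinv, one_mul]
    _ ≤ _ := mul_le_mul_right hcheb _

/-- The Sobolev embedding `Ḣ^σ ⊂ L^q` with `1/q = 1/2 - σ/n`, `0 < σ < n/2`. -/
theorem exists_eLpNorm_le_homSobolevNorm [NeZero n] {σ q : ℝ} (hσ0 : 0 < σ) (hσ : 2 * σ < n)
    (hq : 0 < q) (hqσ : 1 / q = 1 / 2 - σ / n) :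
    ∃ C : ℝ, 0 < C ∧ ∀ f : L2 n,
      eLpNorm f (ENNReal.ofReal q) volume ≤ ENNReal.ofReal C * homSobolevNorm σ f := by
  obtain ⟨c, hc, hB⟩ := exists_setLIntegral_fourier_le (n := n) hσ
  have hn0 : (0 : ℝ) < n := by exact_mod_cast NeZero.pos n
  have hq2 : 2 < q := by
    have : 1 / q < 1 / 2 := by rw [hqσ]; linarith [div_pos hσ0 hn0]
    exact (one_div_lt_one_div hq (by norm_num)).1 this
  -- The scaling relation in the form that turns the weight (|ξ|^b)^{q-2} below into the weight
  -- |ξ|^{2σ} of the Ḣ^σ norm.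
  have hbq : ((n : ℝ) / 2 - σ) * (q - 2) = 2 * σ := by
    field_simp at hqσ ⊢
    linarith
  have hb : 0 < (n : ℝ) / 2 - σ := by linarith
  set b := (n : ℝ) / 2 - σ
  set M := q * (4 * ((2 * c) ^ (q - 2) / (q - 2))) with hM
  have hM0 : 0 < M := by have : 0 < q - 2 := by linarith
                         positivity
  refine ⟨M ^ q⁻¹, by positivity, fun f => ?_⟩
  by_cases htop : homSobolevNorm σ f = ∞
  · rw [htop, ENNReal.mul_top (by simpa using (by positivity : 0 < M ^ q⁻¹))]
    exact le_top
  -- The frequency cut-off depends on the Ḣ^σ norm, which must therefore be positive and finite.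
  by_cases hzero : homSobolevNorm σ f = 0
  · have hz : f = 0 := by
      refine L2_ext_fourier ?_
      rw [homSobolevNorm_eq, eLpNorm_eq_zero_iff (aestronglyMeasurable_symbolMul (by fun_prop) f)
        (by norm_num)] at hzero
      have h0 : (𝓕 (0 : L2 n) : L2 n) = 0 :=
        (Lp.fourierTransformₗᵢ (EuclideanSpace ℝ (Fin n)) ℂ).map_zero
      rw [h0]
      filter_upwards [hzero, ae_freq_pos, Lp.coeFn_zero ℂ 2 (volume : Measure (EuclideanSpace ℝ (Fin n)))]
        with ξ h1 h2 h3
      rw [h3]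
      have h4 : (freq ξ ^ σ : ℝ) ≠ 0 := (Real.rpow_pos_of_pos h2 _).ne'
      simpa [symbolMul, h4] using h1
    rw [hz, eLpNorm_congr_ae (Lp.coeFn_zero ℂ 2 volume)]
    simp
  set h := (homSobolevNorm σ f).toReal with hh
  have hfh : homSobolevNorm σ f = ENNReal.ofReal h := (ENNReal.ofReal_toReal htop).symm
  have hh0 : 0 < h := ENNReal.toReal_pos hzero htop
  set D := 2 * c * h with hD
  have hD0 : 0 < D := by positivity
  have hmeas : AEStronglyMeasurable ((𝓕 f : L2 n) : EuclideanSpace ℝ (Fin n) → ℂ) volume :=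
    Lp.aestronglyMeasurable _
  have key : ∫⁻ x, ‖f x‖ₑ ^ q ≤ ENNReal.ofReal (M * h ^ q) := by
    calc ∫⁻ x, ‖f x‖ₑ ^ q = ∫⁻ x, ENNReal.ofReal (‖f x‖ ^ q) := by
          refine lintegral_congr fun x => ?_
          rw [← ofReal_norm, ENNReal.ofReal_rpow_of_nonneg (norm_nonneg _) hq.le]
      _ = ENNReal.ofReal q * ∫⁻ t in Set.Ioi 0,
            volume {x | t < ‖f x‖} * ENNReal.ofReal (t ^ (q - 1)) :=
          lintegral_rpow_eq_lintegral_meas_lt_mul volume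
            (Eventually.of_forall fun x => norm_nonneg _)
            (Lp.aestronglyMeasurable f).norm.aemeasurable hq
      _ ≤ ENNReal.ofReal q * ∫⁻ t in Set.Ioi 0, ∫⁻ ξ,
            (if t < D * freq ξ ^ b then ENNReal.ofReal (t ^ (q - 3)) else 0) *
              (ENNReal.ofReal 4 * ‖(𝓕 f : L2 n) ξ‖ₑ ^ 2) := by
          refine mul_le_mul_right (setLIntegral_mono' measurableSet_Ioi fun t ht => ?_) _
          have ht' : 0 < t := ht
          refine (mul_le_mul_left (meas_lt_norm_le hσ hc hh0 hB f hfh ht') _).trans (le_of_eq ?_)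
          rw [mul_assoc, mul_comm (∫⁻ _, _), ← mul_assoc, ← ENNReal.ofReal_mul (by positivity),
            mul_assoc, ← Real.rpow_add ht', ← lintegral_const_mul' _ _ ENNReal.ofReal_ne_top]
          refine lintegral_congr fun ξ => ?_
          rw [show (-2 : ℝ) + (q - 1) = q - 3 by ring, ENNReal.ofReal_mul (by norm_num)]
          split_ifs
          · ring
          · simp
      _ = ENNReal.ofReal q * ∫⁻ ξ, ∫⁻ t in Set.Ioi 0,
            (if t < D * freq ξ ^ b then ENNReal.ofReal (t ^ (q - 3)) else 0) *
              (ENNReal.ofReal 4 * ‖(𝓕 f : L2 n) ξ‖ₑ ^ 2) := by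
          rw [lintegral_lintegral_swap]
          refine AEMeasurable.mul (Measurable.aemeasurable ?_) ?_
          · refine Measurable.ite (measurableSet_lt measurable_fst ?_) (by fun_prop) (by fun_prop)
            have := measurable_freq (n := n)
            fun_prop
          · exact ((hmeas.enorm.pow_const 2).const_mul _).comp_snd
      _ = ENNReal.ofReal q * ∫⁻ ξ, ENNReal.ofReal ((D * freq ξ ^ b) ^ (q - 2) / (q - 2)) *
              (ENNReal.ofReal 4 * ‖(𝓕 f : L2 n) ξ‖ₑ ^ 2) := by
          congr 1
          refine lintegral_congr fun ξ => ?_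
          rw [lintegral_mul_const' _ _ (ENNReal.mul_ne_top ENNReal.ofReal_ne_top (by simp)),
            setLIntegral_rpow_lt hq2]
          have := freq_nonneg ξ
          positivity
      _ = ENNReal.ofReal q * ∫⁻ ξ, ENNReal.ofReal (4 * (D ^ (q - 2) / (q - 2))) *
              ‖symbolMul (fun r => r ^ σ) f ξ‖ₑ ^ 2 := by
          congr 1
          refine lintegral_congr fun ξ => ?_
          have hf0 := freq_nonneg ξ
          have : 0 < q - 2 := by linarith
          rw [enorm_symbolMul_sq, ← mul_assoc, ← mul_assoc, ← ENNReal.ofReal_mul (by positivity),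
            ← ENNReal.ofReal_mul (by positivity), Real.mul_rpow hD0.le (by positivity),
            ← Real.rpow_mul hf0, hbq, ← Real.rpow_natCast, ← Real.rpow_mul hf0]
          congr 2
          push_cast
          rw [mul_comm σ 2]
          ring
      _ = ENNReal.ofReal (M * h ^ q) := by
          have : 0 < q - 2 := by linarith
          rw [lintegral_const_mul' _ _ ENNReal.ofReal_ne_top, ← eLpNorm_two_sq, ← homSobolevNorm_eq,
            hfh, ← ENNReal.ofReal_pow hh0.le, ← ENNReal.ofReal_mul (by positivity),
            ← ENNReal.ofReal_mul (by positivity), hM, hD, Real.mul_rpow (by positivity) hh0.le,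
            show h ^ q = h ^ (q - 2) * h ^ 2 by
              rw [← Real.rpow_natCast, ← Real.rpow_add hh0]; congr 1; push_cast; ring]
          congr 1
          ring
  rw [eLpNorm_eq_lintegral_rpow_enorm_toReal (by simpa using hq) ENNReal.ofReal_ne_top,
    ENNReal.toReal_ofReal hq.le, hfh, ← ENNReal.ofReal_mul (by positivity)]
  refine (ENNReal.rpow_le_rpow key (by positivity)).trans (le_of_eq ?_)
  rw [ENNReal.ofReal_rpow_of_nonneg (by positivity) (by positivity),
    Real.mul_rpow hM0.le (by positivity), ← Real.rpow_mul hh0.le, one_div, mul_inv_cancel₀ hq.ne',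
    Real.rpow_one]

theorem homSobolevNorm_zero [NeZero n] (f : L2 n) : homSobolevNorm 0 f = ‖f‖ₑ := by
  rw [homSobolevNorm_eq, ← eLpNorm_symbolMul_one]
  simp

/-- The Sobolev embedding `Ḣ^σ ⊂ L^q` with `1/q = 1/2 - σ/n`, `0 ≤ σ < n/2`. -/
theorem exists_eLpNorm_le_homSobolevNorm' [NeZero n] {σ q : ℝ} (hσ0 : 0 ≤ σ) (hσ : 2 * σ < n)
    (hq : 0 < q) (hqσ : 1 / q = 1 / 2 - σ / n) :
    ∃ C : ℝ, 0 < C ∧ ∀ f : L2 n,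
      eLpNorm f (ENNReal.ofReal q) volume ≤ ENNReal.ofReal C * homSobolevNorm σ f := by
  rcases hσ0.eq_or_lt with rfl | hσ0
  · refine ⟨1, one_pos, fun f => ?_⟩
    have : q = 2 := by
      rw [zero_div, sub_zero] at hqσ
      field_simp at hqσ; linarith
    rw [this, homSobolevNorm_zero, enorm_L2]
    simp
  · exact exists_eLpNorm_le_homSobolevNorm hσ0 hσ hq hqσ

/-! ### The Hardy–Littlewood–Sobolev inequality by duality. -/

theorem enorm_inner_le_mul_eLpNorm {p q : ℝ} (hpq : p.HolderConjugate q) (f g : L2 n) :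
    ‖(inner ℂ f g : ℂ)‖ₑ
      ≤ eLpNorm f (ENNReal.ofReal p) volume * eLpNorm g (ENNReal.ofReal q) volume := by
  rw [L2.inner_def]
  refine (enorm_integral_le_lintegral_enorm _).trans ?_
  have h1 : ∫⁻ x, ‖(inner ℂ (f x) (g x) : ℂ)‖ₑ
      = ∫⁻ x, ((fun x => ‖f x‖ₑ) * fun x => ‖g x‖ₑ) x := by
    refine lintegral_congr fun x => ?_
    rw [RCLike.inner_apply, enorm_mul, RCLike.enorm_conj, mul_comm]
    rfl
  rw [h1]
  refine (ENNReal.lintegral_mul_le_Lp_mul_Lq _ hpq (Lp.aestronglyMeasurable f).enorm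
    (Lp.aestronglyMeasurable g).enorm).trans ?_
  rw [eLpNorm_eq_lintegral_rpow_enorm_toReal (by simpa using hpq.pos) ENNReal.ofReal_ne_top,
    eLpNorm_eq_lintegral_rpow_enorm_toReal (by simpa using hpq.symm.pos) ENNReal.ofReal_ne_top,
    ENNReal.toReal_ofReal hpq.nonneg, ENNReal.toReal_ofReal hpq.symm.nonneg]

/-- The Hardy–Littlewood–Sobolev inequality `L^m ⊂ Ḣ^{-γ}` with `1/m = 1/2 + γ/n`,
`0 < γ < n/2`, for square-integrable functions. -/
theorem exists_homSobolevNorm_neg_le [NeZero n] {γ m : ℝ} (hγ0 : 0 < γ) (hγ : 2 * γ < n)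
    (hm : 0 < m) (hmγ : 1 / m = 1 / 2 + γ / n) :
    ∃ C : ℝ, 0 < C ∧ ∀ f : L2 n,
      homSobolevNorm (-γ) f ≤ ENNReal.ofReal C * eLpNorm f (ENNReal.ofReal m) volume := by
  have hn0 : (0 : ℝ) < n := by exact_mod_cast NeZero.pos n
  have hγn : γ / n < 1 / 2 := by rw [div_lt_div_iff₀ hn0 (by norm_num)]; linarith
  have hq0 : 0 < 1 / 2 - γ / n := by linarith
  set q := (1 / 2 - γ / n)⁻¹ with hq
  have hqpos : 0 < q := inv_pos.2 hq0
  obtain ⟨C, hC, hS⟩ := exists_eLpNorm_le_homSobolevNorm (n := n) hγ0 hγ hqpos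
    (by rw [hq, one_div, inv_inv])
  have hconj : m.HolderConjugate q := by
    have hm1 : 1 < m := by
      have : 1 / m < 1 / 1 := by rw [hmγ]; linarith
      exact (one_div_lt_one_div hm one_pos).1 this
    refine Real.holderConjugate_iff.2 ⟨hm1, ?_⟩
    rw [hq, inv_inv, ← one_div, hmγ]; ring
  refine ⟨C, hC, fun f => ?_⟩
  -- Duality with a truncated symbol k, since f is not yet known to lie in Ḣ^{-γ}. With g = k²f one
  -- has ⟨f, g⟩ = ‖kf‖² and, because r^γ k² = k, also ‖g‖_{Ḣ^γ} = ‖kf‖. Hölder and Sobolev bound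
  -- ‖kf‖² by C‖f‖_{L^m}‖kf‖, and the finite factor ‖kf‖ cancels.
  have trunc : ∀ δ : ℝ, 0 < δ →
      eLpNorm (symbolMul (fun r => if δ ≤ r then r ^ (-γ) else 0) f) 2 volume
        ≤ ENNReal.ofReal C * eLpNorm f (ENNReal.ofReal m) volume := by
    intro δ hδ
    set k : ℝ → ℝ := fun r => if δ ≤ r then r ^ (-γ) else 0 with hk
    have hks : IsSymbol k := by
      refine ⟨Measurable.ite measurableSet_Ici (by fun_prop) (by fun_prop), δ ^ (-γ), fun r hr => ?_⟩
      simp only [hk]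
      split_ifs with h
      · rw [abs_of_nonneg (by positivity)]
        exact Real.rpow_le_rpow_of_nonpos hδ h (by linarith)
      · simp; positivity
    have hkk := isSymbol_mul hks hks
    have hkm := memLp_symbolMul hks f
    have hkkm := memLp_symbolMul hkk f
    set g := mult (fun r => k r * k r) f
    set g₁ := mult k f
    have hinner : (inner ℂ f g : ℂ) = inner ℂ g₁ g₁ := by
      rw [← Lp.inner_fourier_eq f g, ← Lp.inner_fourier_eq g₁ g₁, L2.inner_def, L2.inner_def]
      refine integral_congr_ae ?_
      filter_upwards [fourier_mult hkm, fourier_mult hkkm] with ξ h1 h2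
      change inner ℂ ((𝓕 f : L2 n) ξ) ((𝓕 (mult (fun r => k r * k r) f) : L2 n) ξ)
        = inner ℂ ((𝓕 (mult k f) : L2 n) ξ) ((𝓕 (mult k f) : L2 n) ξ)
      rw [h1, h2, RCLike.inner_apply, RCLike.inner_apply]
      simp only [symbolMul, map_mul, Complex.conj_ofReal]
      push_cast
      ring
    have hg : homSobolevNorm γ g = ‖g₁‖ₑ := by
      rw [homSobolevNorm_eq, eLpNorm_congr_ae (symbolMul_mult hkkm), enorm_mult hkm]
      refine eLpNorm_congr_ae (symbolMul_congr (fun r hr => ?_) f)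
      simp only [hk]
      split_ifs
      · rw [← mul_assoc, ← Real.rpow_add hr]; simp
      · simp
    have hle : ‖g₁‖ₑ * ‖g₁‖ₑ
        ≤ ENNReal.ofReal C * eLpNorm f (ENNReal.ofReal m) volume * ‖g₁‖ₑ := by
      calc ‖g₁‖ₑ * ‖g₁‖ₑ = ‖(inner ℂ f g : ℂ)‖ₑ := by
            rw [hinner, inner_self_eq_norm_sq_to_K, enorm_pow, sq]
            have hr : ∀ x : ℝ, 0 ≤ x → ‖(RCLike.ofReal x : ℂ)‖ₑ = ENNReal.ofReal x := fun x hx => by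
              rw [← ofReal_norm, RCLike.norm_ofReal, abs_of_nonneg hx]
            rw [hr _ (norm_nonneg _), ofReal_norm]
        _ ≤ eLpNorm f (ENNReal.ofReal m) volume * eLpNorm g (ENNReal.ofReal q) volume :=
            enorm_inner_le_mul_eLpNorm hconj f g
        _ ≤ eLpNorm f (ENNReal.ofReal m) volume * (ENNReal.ofReal C * ‖g₁‖ₑ) := by
            rw [← hg]; exact mul_le_mul_right (hS g) _
        _ = _ := by ring
    rw [← enorm_mult hkm]
    by_cases h0 : ‖g₁‖ₑ = 0
    · change ‖g₁‖ₑ ≤ _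
      rw [h0]; exact zero_le
    · exact (ENNReal.mul_le_mul_iff_left h0 enorm_ne_top).1 hle
  -- The truncation is removed by monotone convergence along δ = 1/(j+1).
  have hsq : homSobolevNorm (-γ) f ^ 2
      ≤ (ENNReal.ofReal C * eLpNorm f (ENNReal.ofReal m) volume) ^ 2 := by
    have hδ : ∀ j : ℕ, (0 : ℝ) < 1 / ((j : ℝ) + 1) := fun j => by positivity
    have hlim : Tendsto (fun j : ℕ => ∫⁻ ξ, ‖symbolMul
          (fun r => if 1 / ((j : ℝ) + 1) ≤ r then r ^ (-γ) else 0) f ξ‖ₑ ^ 2) atTop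
        (𝓝 (∫⁻ ξ, ‖symbolMul (fun r => r ^ (-γ)) f ξ‖ₑ ^ 2)) := by
      refine lintegral_tendsto_of_tendsto_of_monotone (fun j => ?_) ?_ ?_
      · exact ((aestronglyMeasurable_symbolMul
          (Measurable.ite measurableSet_Ici (by fun_prop) (by fun_prop)) f).enorm.pow_const 2)
      · refine Eventually.of_forall fun ξ i j hij => ?_
        have h1 : 1 / ((j : ℝ) + 1) ≤ 1 / ((i : ℝ) + 1) :=
          one_div_le_one_div_of_le (by positivity) (by exact_mod_cast Nat.succ_le_succ hij)
        simp only [symbolMul]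
        split_ifs with h2 h3
        · exact le_rfl
        · exact absurd (h1.trans h2) h3
        · simp
        · exact le_rfl
      · filter_upwards [ae_freq_pos] with ξ hξ
        refine tendsto_const_nhds.congr' ?_
        have := (tendsto_one_div_add_atTop_nhds_zero_nat (𝕜 := ℝ)).eventually (eventually_lt_nhds hξ)
        filter_upwards [this] with j hj
        simp only [symbolMul]
        rw [if_pos hj.le]
    rw [homSobolevNorm_eq, eLpNorm_two_sq]
    refine le_of_tendsto' hlim fun j => ?_
    rw [← eLpNorm_two_sq]
    exact pow_le_pow_left' (trunc _ (hδ j)) 2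
  exact (ENNReal.pow_le_pow_left_iff two_ne_zero).1 hsq

/-! ### Lipschitz bounds for the power nonlinearity. -/

/-- Bernoulli's inequality for (b/a)^p, multiplied by a^p. -/
theorem rpow_sub_rpow_le_mul {a b p : ℝ} (hb : 0 ≤ b) (hab : b ≤ a) (hp : 1 ≤ p) :
    a ^ p - b ^ p ≤ p * (a - b) * a ^ (p - 1) := by
  rcases (hb.trans hab).eq_or_lt with h | ha
  · have : b = 0 := le_antisymm (by linarith) hb
    simp [← h, this]
  have h1 := one_add_mul_self_le_rpow_one_add (s := (b - a) / a)
    (by rw [le_div_iff₀ ha]; linarith) hp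
  have h2 : 1 + (b - a) / a = b / a := by field_simp; ring
  rw [h2, Real.div_rpow hb ha.le, le_div_iff₀ (by positivity)] at h1
  have h3 : a ^ p = a * a ^ (p - 1) := by
    rw [Real.rpow_sub_one ha.ne']; field_simp
  have h4 : (1 + p * ((b - a) / a)) * a ^ p = a ^ p - p * (a - b) * a ^ (p - 1) := by
    rw [h3]; field_simp; ring
  linarith

theorem abs_rpow_sub_rpow_le {a b p : ℝ} (ha : 0 ≤ a) (hb : 0 ≤ b) (hp : 1 ≤ p) :
    |a ^ p - b ^ p| ≤ p * |a - b| * (a + b) ^ (p - 1) := by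
  wlog hab : b ≤ a generalizing a b
  · rw [abs_sub_comm, abs_sub_comm a, add_comm]
    exact this hb ha (le_of_not_ge hab)
  rw [abs_of_nonneg (sub_nonneg.2 (Real.rpow_le_rpow hb hab (by linarith))),
    abs_of_nonneg (sub_nonneg.2 hab)]
  refine (rpow_sub_rpow_le_mul hb hab hp).trans ?_
  have : 0 ≤ a - b := sub_nonneg.2 hab
  have h2 : a ^ (p - 1) ≤ (a + b) ^ (p - 1) := Real.rpow_le_rpow ha (by linarith) (by linarith)
  exact mul_le_mul_of_nonneg_left h2 (by positivity)

/-- Hölder's inequality for the difference of two powers. -/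
theorem eLpNorm_rpow_sub_rpow_le {X : Type*} [MeasurableSpace X] {μ : Measure X} {f g : X → ℂ}
    (hf : AEStronglyMeasurable f μ) (hg : AEStronglyMeasurable g μ) {m p : ℝ} (hm : 0 < m)
    (hp : 1 < p) (hmp : 1 ≤ m * p) :
    eLpNorm (fun x => ((‖f x‖ ^ p : ℝ) : ℂ) - ((‖g x‖ ^ p : ℝ) : ℂ)) (ENNReal.ofReal m) μ
      ≤ ENNReal.ofReal p * (eLpNorm (f - g) (ENNReal.ofReal (m * p)) μ *
        (eLpNorm f (ENNReal.ofReal (m * p)) μ + eLpNorm g (ENNReal.ofReal (m * p)) μ) ^ (p - 1)) := by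
  have hp1 : 0 < p - 1 := by linarith
  set h : X → ℝ := fun x => ‖‖f x‖ + ‖g x‖‖ ^ (p - 1) with hh
  set d : X → ℂ := f - g with hd
  have hsum : AEStronglyMeasurable (fun x => ‖f x‖ + ‖g x‖) μ := hf.norm.add hg.norm
  have hhm : AEStronglyMeasurable h μ :=
    (hsum.norm.aemeasurable.pow_const (p - 1)).aestronglyMeasurable
  -- The Hölder relation 1/m = (p-1)/(mp) + 1/(mp): p-1 factors from the sum and one from the
  -- difference.
  have : ENNReal.HolderTriple (ENNReal.ofReal (m * p / (p - 1))) (ENNReal.ofReal (m * p))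
      (ENNReal.ofReal m) := by
    refine ⟨?_⟩
    rw [← ENNReal.ofReal_inv_of_pos (by positivity), ← ENNReal.ofReal_inv_of_pos (by positivity),
      ← ENNReal.ofReal_inv_of_pos (by positivity), ← ENNReal.ofReal_add (by positivity)
      (by positivity)]
    congr 1
    field_simp
    ring
  have h1 : eLpNorm (fun x => ((‖f x‖ ^ p : ℝ) : ℂ) - ((‖g x‖ ^ p : ℝ) : ℂ)) (ENNReal.ofReal m) μ
      ≤ ENNReal.ofReal p * eLpNorm (h • d) (ENNReal.ofReal m) μ := by
    refine eLpNorm_le_mul_eLpNorm_of_ae_le_mul (Eventually.of_forall fun x => ?_) _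
    rw [← Complex.ofReal_sub, Complex.norm_real, Real.norm_eq_abs, Pi.smul_apply', norm_smul,
      Real.norm_of_nonneg (show 0 ≤ h x from by positivity)]
    have hhx : h x = (‖f x‖ + ‖g x‖) ^ (p - 1) := by
      simp only [hh]; rw [Real.norm_of_nonneg (by positivity)]
    rw [hhx]
    refine (abs_rpow_sub_rpow_le (norm_nonneg _) (norm_nonneg _) hp.le).trans ?_
    rw [mul_comm ((‖f x‖ + ‖g x‖) ^ (p - 1)), ← mul_assoc]
    have := abs_norm_sub_norm_le (f x) (g x)
    rw [hd, Pi.sub_apply]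
    gcongr
  refine h1.trans (mul_le_mul_right ?_ _)
  refine (eLpNorm_smul_le_mul_eLpNorm (p := ENNReal.ofReal (m * p / (p - 1)))
    (q := ENNReal.ofReal (m * p)) (hf.sub hg) hhm).trans ?_
  rw [mul_comm]
  refine mul_le_mul_right ?_ _
  rw [hh, eLpNorm_norm_rpow _ hp1, ← ENNReal.ofReal_mul (by positivity),
    div_mul_cancel₀ _ hp1.ne']
  refine ENNReal.rpow_le_rpow ?_ hp1.le
  refine (eLpNorm_add_le hf.norm hg.norm (by simpa using hmp)).trans (le_of_eq ?_)
  rw [eLpNorm_norm, eLpNorm_norm]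

/-! ### Scaled variables and the nonlinear estimate. -/

/-- The symbol that relates `L²` isometrically to `H^s` with the norm
`R^γ ‖(1 + (R|ξ|)^s) û‖_{L²}`. -/
noncomputable def scaledSymbol (s γ R : ℝ) (r : ℝ) : ℝ := R ^ (-γ) / (1 + (R * r) ^ s)

theorem scaledSymbol_nonneg {s γ R r : ℝ} (hR : 0 < R) (hr : 0 < r) :
    0 ≤ scaledSymbol s γ R r := by
  unfold scaledSymbol; positivity

theorem measurable_scaledSymbol (s γ R : ℝ) : Measurable (scaledSymbol s γ R) := by
  unfold scaledSymbol; fun_prop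

/-- Since (Rr)^σ ≤ 1 + (Rr)^s, the scaled norm controls every intermediate Ḣ^σ norm with its natural
power of R. With R = √(1+t) these powers are the decay rates of the theorem. -/
theorem rpow_mul_scaledSymbol_le {s σ γ R r : ℝ} (hσ0 : 0 ≤ σ) (hσs : σ ≤ s) (hR : 0 < R)
    (hr : 0 < r) : r ^ σ * scaledSymbol s γ R r ≤ R ^ (-σ - γ) := by
  have hRr : 0 < R * r := mul_pos hR hr
  have h1 : (R * r) ^ σ ≤ 1 + (R * r) ^ s := by
    rcases le_total (R * r) 1 with h | h
    · have := Real.rpow_le_one hRr.le h hσ0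
      have : 0 ≤ (R * r) ^ s := by positivity
      linarith
    · have := Real.rpow_le_rpow_of_exponent_le h hσs
      linarith
  have h2 : r ^ σ = R ^ (-σ) * (R * r) ^ σ := by
    rw [Real.mul_rpow hR.le hr.le, ← mul_assoc, ← Real.rpow_add hR]; simp
  rw [scaledSymbol, ← mul_div_assoc, div_le_iff₀ (by positivity), sub_eq_add_neg,
    Real.rpow_add hR, h2]
  calc R ^ (-σ) * (R * r) ^ σ * R ^ (-γ) = R ^ (-σ) * R ^ (-γ) * (R * r) ^ σ := by ring
    _ ≤ _ := mul_le_mul_of_nonneg_left h1 (by positivity)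

theorem isSymbol_scaledSymbol {s γ R : ℝ} (hs : 0 ≤ s) (hR : 0 < R) :
    IsSymbol (scaledSymbol s γ R) :=
  ⟨measurable_scaledSymbol s γ R, R ^ (-0 - γ), fun r hr => by
    rw [abs_of_nonneg (scaledSymbol_nonneg hR hr)]
    simpa using rpow_mul_scaledSymbol_le (γ := γ) le_rfl hs hR hr⟩

theorem homSobolevNorm_mult_scaledSymbol_le [NeZero n] {s σ γ R : ℝ} (hσ0 : 0 ≤ σ) (hσs : σ ≤ s)
    (hR : 0 < R) (w : L2 n) :
    homSobolevNorm σ (mult (scaledSymbol s γ R) w) ≤ ENNReal.ofReal (R ^ (-σ - γ)) * ‖w‖ₑ := by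
  have hm := memLp_symbolMul (isSymbol_scaledSymbol (γ := γ) (hσ0.trans hσs) hR) w
  rw [homSobolevNorm_eq, eLpNorm_congr_ae (symbolMul_mult hm), ← eLpNorm_symbolMul_one w,
    ← abs_of_nonneg (show 0 ≤ R ^ (-σ - γ) by positivity), ← eLpNorm_symbolMul_const_mul]
  refine eLpNorm_symbolMul_mono w fun r hr => ?_
  have := scaledSymbol_nonneg (s := s) (γ := γ) hR hr
  rw [abs_of_nonneg (by positivity), mul_one, abs_of_nonneg (show 0 ≤ R ^ (-σ - γ) by positivity)]
  exact rpow_mul_scaledSymbol_le hσ0 hσs hR hr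

/-- The scale-invariant Gagliardo–Nirenberg inequality. -/
theorem exists_eLpNorm_mult_scaledSymbol_le [NeZero n] {s σ q : ℝ} (γ : ℝ) (hσ0 : 0 ≤ σ)
    (hσs : σ ≤ s) (hσ : 2 * σ < n) (hq : 0 < q) (hqσ : 1 / q = 1 / 2 - σ / n) :
    ∃ C : ℝ, 0 < C ∧ ∀ R : ℝ, 0 < R → ∀ w : L2 n,
      eLpNorm (mult (scaledSymbol s γ R) w) (ENNReal.ofReal q) volume
        ≤ ENNReal.ofReal (C * R ^ (-σ - γ) * ‖w‖) := by
  obtain ⟨C, hC, h⟩ := exists_eLpNorm_le_homSobolevNorm' (n := n) hσ0 hσ hq hqσ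
  refine ⟨C, hC, fun R hR w => (h _).trans ?_⟩
  rw [ENNReal.ofReal_mul (by positivity), ENNReal.ofReal_mul hC.le, mul_assoc, ofReal_norm]
  exact mul_le_mul_right (homSobolevNorm_mult_scaledSymbol_le hσ0 hσs hR w) _

theorem absPowL2_coeFn {p : ℝ} {u : L2 n} (h : MemLp (absPow p u) 2 volume) :
    (absPowL2 p u : EuclideanSpace ℝ (Fin n) → ℂ) =ᵐ[volume] absPow p u := by
  rw [absPowL2, dif_pos h]; exact h.coeFn_toLp

theorem eLpNorm_absPow_sub_le {u v : L2 n} {m p A a b d : ℝ} (hm : 0 < m)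
    (hp : 1 < p) (hmp : 1 ≤ m * p) (hA : 0 ≤ A) (ha : 0 ≤ a) (hb : 0 ≤ b) (hd : 0 ≤ d)
    (huv : eLpNorm (u - v : L2 n) (ENNReal.ofReal (m * p)) volume ≤ ENNReal.ofReal (A * d))
    (hu : eLpNorm u (ENNReal.ofReal (m * p)) volume ≤ ENNReal.ofReal (A * a))
    (hv : eLpNorm v (ENNReal.ofReal (m * p)) volume ≤ ENNReal.ofReal (A * b)) :
    eLpNorm (absPow p u - absPow p v) (ENNReal.ofReal m) volume
      ≤ ENNReal.ofReal (p * A ^ p * (d * (a + b) ^ (p - 1))) := by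
  have hp1 : 0 < p - 1 := by linarith
  refine (eLpNorm_rpow_sub_rpow_le (Lp.aestronglyMeasurable u) (Lp.aestronglyMeasurable v)
    hm hp hmp).trans ?_
  rw [← eLpNorm_congr_ae (Lp.coeFn_sub u v)]
  have h1 : eLpNorm u (ENNReal.ofReal (m * p)) volume + eLpNorm v (ENNReal.ofReal (m * p)) volume
      ≤ ENNReal.ofReal (A * (a + b)) := by
    rw [mul_add, ENNReal.ofReal_add (by positivity) (by positivity)]
    exact add_le_add hu hv
  refine (mul_le_mul_right (mul_le_mul' huv (ENNReal.rpow_le_rpow h1 hp1.le)) _).trans (le_of_eq ?_)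
  rw [ENNReal.ofReal_rpow_of_nonneg (by positivity) hp1.le, ← ENNReal.ofReal_mul (by positivity),
    ← ENNReal.ofReal_mul (by positivity), Real.mul_rpow hA (by positivity)]
  congr 1
  rcases hA.eq_or_lt with h | h
  · rw [← h, Real.zero_rpow (by linarith : p ≠ 0)]; simp
  · have : A ^ p = A * A ^ (p - 1) := by rw [Real.rpow_sub_one h.ne']; field_simp
    rw [this]; ring

theorem absPow_zero {p : ℝ} (hp : p ≠ 0) : absPow p (0 : L2 n) =ᵐ[volume] 0 := by
  filter_upwards with x
  simp [absPow, Real.zero_rpow hp]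

theorem aestronglyMeasurable_absPow (p : ℝ) (u : L2 n) :
    AEStronglyMeasurable (absPow p u) volume :=
  (Complex.measurable_ofReal.comp_aemeasurable
    ((Lp.aestronglyMeasurable u).norm.aemeasurable.pow_const p)).aestronglyMeasurable

/-- The nonlinearity in the scaled variables, in `L²` and in `Ḣ^{-γ}`. -/
theorem exists_nonlinear_estimate [NeZero n] {s γ p : ℝ} (hs0 : 0 < s)
    (hγ0 : 0 < γ) (hγ : 2 * γ < n) (hp : 1 < p) (hpγ : 1 + 2 * γ / n ≤ p)
    (hps : p * (n - 2 * s) ≤ n) :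
    ∃ C : ℝ, 0 < C ∧ ∀ R : ℝ, 0 < R → ∀ w w' : L2 n,
      MemLp (absPow p (mult (scaledSymbol s γ R) w)) 2 volume ∧
      ‖absPowL2 p (mult (scaledSymbol s γ R) w) - absPowL2 p (mult (scaledSymbol s γ R) w')‖
        ≤ C * R ^ (-((p - 1) * (n + 2 * γ) / 2) - γ)
          * (‖w - w'‖ * (‖w‖ + ‖w'‖) ^ (p - 1)) ∧
      homSobolevNorm (-γ)
          (absPowL2 p (mult (scaledSymbol s γ R) w) - absPowL2 p (mult (scaledSymbol s γ R) w'))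
        ≤ ENNReal.ofReal (C * R ^ (-((p - 1) * (n + 2 * γ) / 2))
          * (‖w - w'‖ * (‖w‖ + ‖w'‖) ^ (p - 1))) := by
  have hn0 : (0 : ℝ) < n := by exact_mod_cast NeZero.pos n
  have hp0 : 0 < p := by linarith
  have hpγ' : (n : ℝ) + 2 * γ ≤ p * n := by
    have := mul_le_mul_of_nonneg_right hpγ hn0.le
    rw [add_mul, div_mul_cancel₀ _ hn0.ne'] at this
    linarith
  -- The exponent with L^m ⊂ Ḣ^{-γ}: the Ḣ^{-γ} norm of |u|^p is estimated through its L^m norm.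
  set m := (1 / 2 + γ / n)⁻¹ with hm
  have hm0 : 0 < m := by positivity
  have hm1 : 1 / m = 1 / 2 + γ / n := by rw [hm, one_div, inv_inv]
  obtain ⟨c, hc, hHLS⟩ := exists_homSobolevNorm_neg_le (n := n) hγ0 hγ hm0 hm1
  -- σ₂ and σm are the orders with Ḣ^{σ₂} ⊂ L^{2p} and Ḣ^{σm} ⊂ L^{mp}, and both must lie in [0, s].
  -- The condition σm ≥ 0 is p ≥ 1 + 2γ/n, and σ₂ ≤ s is p(n - 2s) ≤ n; the other two inequalities
  -- are weaker.
  set σ₂ := n / 2 - n / (2 * p) with hσ₂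
  set σm := n / 2 - (n / 2 + γ) / p with hσm
  have e1 : n / (2 * p) * p = (n : ℝ) / 2 := by field_simp
  have e2 : (n / 2 + γ) / p * p = (n : ℝ) / 2 + γ := by field_simp
  have hpos1 : 0 < (n : ℝ) / (2 * p) := by positivity
  have hpos2 : 0 < ((n : ℝ) / 2 + γ) / p := by positivity
  have hσ₂0 : 0 ≤ σ₂ := by nlinarith
  have hσm0 : 0 ≤ σm := by nlinarith
  have hσ₂s : σ₂ ≤ s := by nlinarith
  have hσms : σm ≤ s := by nlinarith
  obtain ⟨C₂, hC₂, hG₂⟩ := exists_eLpNorm_mult_scaledSymbol_le (n := n) (q := 2 * p) γ hσ₂0 hσ₂s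
    (by linarith) (by positivity) (by rw [hσ₂]; field_simp; ring)
  obtain ⟨Cm, hCm, hGm⟩ := exists_eLpNorm_mult_scaledSymbol_le (n := n) (q := m * p) γ hσm0 hσms
    (by linarith) (by positivity) (by
      rw [one_div, mul_inv, ← one_div m, hm1, hσm]; field_simp; ring)
  refine ⟨p * C₂ ^ p + c * (p * Cm ^ p), by positivity, fun R hR w w' => ?_⟩
  have hsub : ∀ x y : L2 n, mult (scaledSymbol s γ R) x - mult (scaledSymbol s γ R) y
      = mult (scaledSymbol s γ R) (x - y) := fun x y =>
    (mult_sub (isSymbol_scaledSymbol hs0.le hR) x y).symm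
  have hmem : ∀ x : L2 n, MemLp (absPow p (mult (scaledSymbol s γ R) x)) 2 volume := by
    intro x
    refine ⟨aestronglyMeasurable_absPow p _, ?_⟩
    have h0 : mult (scaledSymbol s γ R) (0 : L2 n) = 0 :=
      (multCLM _ (isSymbol_scaledSymbol (s := s) (γ := γ) hs0.le hR)).map_zero
    -- Integrability of |u|^p is the difference estimate against zero.
    have h := eLpNorm_absPow_sub_le (u := mult (scaledSymbol s γ R) x) (v := 0) (m := 2) (p := p)
      (A := C₂ * R ^ (-σ₂ - γ)) (a := ‖x‖) (b := 0) (d := ‖x‖) (by norm_num) hp (by linarith)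
      (by positivity) (norm_nonneg _) le_rfl (norm_nonneg _) (by rw [sub_zero]; exact hG₂ R hR x)
      (hG₂ R hR x) (by rw [← h0]; simpa using hG₂ R hR 0)
    have h1 : absPow p (mult (scaledSymbol s γ R) x) - absPow p (0 : L2 n)
        =ᵐ[volume] absPow p (mult (scaledSymbol s γ R) x) := by
      filter_upwards [absPow_zero (n := n) hp0.ne'] with y hy
      simp [hy]
    rw [eLpNorm_congr_ae h1] at h
    rw [ENNReal.ofReal_ofNat] at h
    exact h.trans_lt ENNReal.ofReal_lt_top
  have hcoe : (absPowL2 p (mult (scaledSymbol s γ R) w) - absPowL2 p (mult (scaledSymbol s γ R) w')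
      : L2 n) =ᵐ[volume] absPow p (mult (scaledSymbol s γ R) w)
        - absPow p (mult (scaledSymbol s γ R) w') :=
    (Lp.coeFn_sub _ _).trans ((absPowL2_coeFn (hmem w)).sub (absPowL2_coeFn (hmem w')))
  set N := ‖w - w'‖ * (‖w‖ + ‖w'‖) ^ (p - 1) with hN
  have hN0 : 0 ≤ N := by positivity
  -- In L² the power of R is better by R^{-γ} than in Ḣ^{-γ} (`hRm`); the Duhamel estimate for τ
  -- near t uses this surplus.
  have hR2 : (C₂ * R ^ (-σ₂ - γ)) ^ p = C₂ ^ p * R ^ (-((p - 1) * (n + 2 * γ) / 2) - γ) := by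
    rw [Real.mul_rpow hC₂.le (by positivity), ← Real.rpow_mul hR.le]
    congr 2
    rw [hσ₂]; linear_combination e1
  have hRm : (Cm * R ^ (-σm - γ)) ^ p = Cm ^ p * R ^ (-((p - 1) * (n + 2 * γ) / 2)) := by
    rw [Real.mul_rpow hCm.le (by positivity), ← Real.rpow_mul hR.le]
    congr 2
    rw [hσm]; linear_combination e2
  refine ⟨hmem w, ?_, ?_⟩
  · have h := eLpNorm_absPow_sub_le (u := mult (scaledSymbol s γ R) w)
      (v := mult (scaledSymbol s γ R) w') (m := 2) (p := p)
      (A := C₂ * R ^ (-σ₂ - γ)) (a := ‖w‖) (b := ‖w'‖) (d := ‖w - w'‖) (by norm_num) hp (by linarith)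
      (by positivity) (norm_nonneg _) (norm_nonneg _) (norm_nonneg _)
      (by rw [hsub]; exact hG₂ R hR _) (hG₂ R hR w) (hG₂ R hR w')
    rw [← eLpNorm_congr_ae hcoe, ENNReal.ofReal_ofNat, ← enorm_L2, ← ofReal_norm, hR2] at h
    have h2 := (ENNReal.ofReal_le_ofReal_iff (by positivity)).1 h
    refine h2.trans ?_
    have h3 : 0 ≤ c * (p * Cm ^ p) * R ^ (-((p - 1) * (n + 2 * γ) / 2) - γ) * N := by positivity
    linarith
  · have h := eLpNorm_absPow_sub_le (u := mult (scaledSymbol s γ R) w)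
      (v := mult (scaledSymbol s γ R) w') (m := m) (p := p)
      (A := Cm * R ^ (-σm - γ)) (a := ‖w‖) (b := ‖w'‖) (d := ‖w - w'‖) hm0 hp
      (by
        rw [hm, inv_mul_eq_div, le_div_iff₀ (by positivity)]
        have : γ / n < 1 / 2 := by rw [div_lt_div_iff₀ hn0 (by norm_num)]; linarith
        linarith)
      (by positivity) (norm_nonneg _) (norm_nonneg _) (norm_nonneg _)
      (by rw [hsub]; exact hGm R hR _) (hGm R hR w) (hGm R hR w')
    rw [← eLpNorm_congr_ae hcoe, hRm] at h
    refine (hHLS _).trans ((mul_le_mul_right h _).trans ?_)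
    rw [← ENNReal.ofReal_mul hc.le]
    refine ENNReal.ofReal_le_ofReal ?_
    have h3 : 0 ≤ p * C₂ ^ p * R ^ (-((p - 1) * (n + 2 * γ) / 2)) * N := by positivity
    linarith

theorem continuous_of_norm_sub_le {E F : Type*} [NormedAddCommGroup E] [NormedAddCommGroup F]
    {G : E → F} {C q : ℝ} (hq : 0 ≤ q)
    (h : ∀ x y, ‖G x - G y‖ ≤ C * (‖x - y‖ * (‖x‖ + ‖y‖) ^ q)) : Continuous G := by
  refine continuous_iff_continuousAt.2 fun y => ?_
  rw [ContinuousAt, tendsto_iff_norm_sub_tendsto_zero]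
  have h1 : Continuous fun x => C * (‖x - y‖ * (‖x‖ + ‖y‖) ^ q) :=
    continuous_const.mul ((continuous_id.sub continuous_const).norm.mul
      ((continuous_norm.add continuous_const).rpow_const fun _ => Or.inr hq))
  have h2 := h1.tendsto y
  simp only [sub_self, norm_zero, zero_mul, mul_zero] at h2
  exact squeeze_zero (fun _ => norm_nonneg _) (fun x => h x y) h2

/-! ### Decay of the symbols in the scaled norm. -/

/-- The diffusive length scale `√(1+t)`, constant for `t ≤ 0`. -/
noncomputable def diffScale (t : ℝ) : ℝ := (1 + max t 0) ^ (1 / 2 : ℝ)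

theorem one_le_diffScale (t : ℝ) : 1 ≤ diffScale t :=
  Real.one_le_rpow (by linarith [le_max_right t 0]) (by norm_num)

theorem diffScale_pos (t : ℝ) : 0 < diffScale t := one_pos.trans_le (one_le_diffScale t)

theorem continuous_diffScale : Continuous diffScale := by
  unfold diffScale
  exact (by fun_prop : Continuous fun t : ℝ => 1 + max t 0).rpow_const
    fun _ => Or.inr (by norm_num)

theorem diffScale_rpow {t : ℝ} (ht : 0 ≤ t) (a : ℝ) : diffScale t ^ a = (1 + t) ^ (a / 2) := by
  rw [diffScale, max_eq_left ht, ← Real.rpow_mul (by linarith)]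
  congr 1; ring

theorem DiffusiveDecay.abs_le {q : ℝ} {k : ℝ → ℝ → ℝ} (h : DiffusiveDecay q k) (hq : 0 ≤ q) :
    ∃ C : ℝ, 0 < C ∧ ∀ t r : ℝ, 0 ≤ t → 0 < r → |k t r| ≤ C := by
  obtain ⟨C, hC, hk⟩ := h 0 le_rfl
  refine ⟨C, hC, fun t r ht hr => ?_⟩
  rcases le_total r 1 with h1 | h1
  · simpa using (hk t r ht hr).1 h1
  · have h2 := (hk t r ht hr).2 h1
    have h3 := Real.one_le_rpow h1 hq
    simp only [neg_zero, zero_div, Real.rpow_zero, mul_one] at h2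
    nlinarith [abs_nonneg (k t r)]

/-- Decay of a symbol in the scaled norm at time `t`, given a bound in `Ḣ^{-γ}` at low and in `H^q`
at high frequencies. -/
theorem DiffusiveDecay.exists_scaled_le {q s γ : ℝ} {k : ℝ → ℝ → ℝ} (h : DiffusiveDecay q k)
    (hs : 0 ≤ s) (hγ : 0 ≤ γ) :
    ∃ C : ℝ, 0 < C ∧ ∀ t θ r : ℝ, 0 ≤ t → 0 ≤ θ → t ≤ 2 * θ → 0 < r →
      (r ≤ 1 → diffScale t ^ γ * (1 + (diffScale t * r) ^ s) * |k θ r| ≤ C * r ^ (-γ)) ∧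
      (1 ≤ r → diffScale t ^ γ * (1 + (diffScale t * r) ^ s) * |k θ r| ≤ C * r ^ (s - q)) := by
  -- Decay of order γ serves the summand 1 of the weight, and decay of order γ + s serves (R r)^s.
  -- The weight sits at time t and the symbol at elapsed time θ ≥ t/2, whence the factors 2^{a/2}.
  obtain ⟨C₁, hC₁, h1⟩ := h γ hγ
  obtain ⟨C₂, hC₂, h2⟩ := h (γ + s) (add_nonneg hγ hs)
  refine ⟨C₁ * 2 ^ (γ / 2) + 2 * (C₂ * 2 ^ ((γ + s) / 2)), by positivity,
    fun t θ r ht hθ htθ hr => ?_⟩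
  have hR := diffScale_pos t
  have hsc : ∀ a : ℝ, 0 ≤ a → diffScale t ^ a * (1 + θ) ^ (-a / 2) ≤ 2 ^ (a / 2) := by
    intro a ha
    rw [diffScale_rpow ht, neg_div, Real.rpow_neg (by linarith), ← div_eq_mul_inv,
      ← Real.div_rpow (by linarith) (by linarith)]
    refine Real.rpow_le_rpow (by positivity) ?_ (by linarith)
    rw [div_le_iff₀ (by linarith)]; linarith
  have hg := hsc γ hγ
  have hgs := hsc (γ + s) (add_nonneg hγ hs)
  have hmul : (diffScale t * r) ^ s = diffScale t ^ s * r ^ s := Real.mul_rpow hR.le hr.le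
  have hRadd : diffScale t ^ (γ + s) = diffScale t ^ γ * diffScale t ^ s := Real.rpow_add hR _ _
  have hk := abs_nonneg (k θ r)
  constructor
  · intro hr1
    have hrγ : r ^ γ * r ^ (-γ) = 1 := by rw [← Real.rpow_add hr]; simp
    have a1 := (h1 θ r hθ hr).1 hr1
    have a2 := (h2 θ r hθ hr).1 hr1
    rw [Real.rpow_add hr] at a2
    have b1 : diffScale t ^ γ * (r ^ γ * |k θ r|) ≤ C₁ * 2 ^ (γ / 2) :=
      calc diffScale t ^ γ * (r ^ γ * |k θ r|)
          ≤ diffScale t ^ γ * (C₁ * (1 + θ) ^ (-γ / 2)) :=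
            mul_le_mul_of_nonneg_left a1 (by positivity)
        _ = C₁ * (diffScale t ^ γ * (1 + θ) ^ (-γ / 2)) := by ring
        _ ≤ _ := mul_le_mul_of_nonneg_left hg hC₁.le
    have b2 : diffScale t ^ (γ + s) * (r ^ γ * r ^ s * |k θ r|) ≤ C₂ * 2 ^ ((γ + s) / 2) :=
      calc diffScale t ^ (γ + s) * (r ^ γ * r ^ s * |k θ r|)
          ≤ diffScale t ^ (γ + s) * (C₂ * (1 + θ) ^ (-(γ + s) / 2)) :=
            mul_le_mul_of_nonneg_left a2 (by positivity)
        _ = C₂ * (diffScale t ^ (γ + s) * (1 + θ) ^ (-(γ + s) / 2)) := by ring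
        _ ≤ _ := mul_le_mul_of_nonneg_left hgs hC₂.le
    calc diffScale t ^ γ * (1 + (diffScale t * r) ^ s) * |k θ r|
        = diffScale t ^ γ * (1 + (diffScale t * r) ^ s) * |k θ r| * (r ^ γ * r ^ (-γ)) := by
          rw [hrγ, mul_one]
      _ = (diffScale t ^ γ * (r ^ γ * |k θ r|)
          + diffScale t ^ (γ + s) * (r ^ γ * r ^ s * |k θ r|)) * r ^ (-γ) := by
          rw [hmul, hRadd]; ring
      _ ≤ _ := by
          refine mul_le_mul_of_nonneg_right ?_ (by positivity)
          have : 0 ≤ C₂ * 2 ^ ((γ + s) / 2) := by positivity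
          linarith
  · intro hr1
    have a2 := (h2 θ r hθ hr).2 hr1
    have b2 : diffScale t ^ (γ + s) * (r ^ q * |k θ r|) ≤ C₂ * 2 ^ ((γ + s) / 2) :=
      calc diffScale t ^ (γ + s) * (r ^ q * |k θ r|)
          ≤ diffScale t ^ (γ + s) * (C₂ * (1 + θ) ^ (-(γ + s) / 2)) :=
            mul_le_mul_of_nonneg_left a2 (by positivity)
        _ = C₂ * (diffScale t ^ (γ + s) * (1 + θ) ^ (-(γ + s) / 2)) := by ring
        _ ≤ _ := mul_le_mul_of_nonneg_left hgs hC₂.le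
    have hbig : 1 + (diffScale t * r) ^ s ≤ 2 * (diffScale t ^ s * r ^ s) := by
      rw [hmul]
      have := Real.one_le_rpow (one_le_diffScale t) hs
      have := Real.one_le_rpow hr1 hs
      nlinarith
    have hrs : r ^ s = r ^ q * r ^ (s - q) := by rw [← Real.rpow_add hr]; congr 1; ring
    calc diffScale t ^ γ * (1 + (diffScale t * r) ^ s) * |k θ r|
        ≤ diffScale t ^ γ * (2 * (diffScale t ^ s * r ^ s)) * |k θ r| := by gcongr
      _ = 2 * (diffScale t ^ (γ + s) * (r ^ q * |k θ r|)) * r ^ (s - q) := by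
          rw [hrs, hRadd]; ring
      _ ≤ _ := by
          refine mul_le_mul_of_nonneg_right ?_ (by positivity)
          have : 0 ≤ C₁ * 2 ^ (γ / 2) := by positivity
          linarith

/-! ### The Duhamel symbol and the time integral. -/

/-- The symbol of the Duhamel term at time `t` from a source at time `τ`, in scaled variables. -/
noncomputable def duhamelSymbol (s γ t τ : ℝ) (r : ℝ) : ℝ :=
  diffScale t ^ γ * (1 + (diffScale t * r) ^ s) * K1 (max (t - τ) 0) r

theorem measurable_duhamelSymbol (s γ t τ : ℝ) : Measurable (duhamelSymbol s γ t τ) := by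
  have := measurable_K1 (max (t - τ) 0)
  unfold duhamelSymbol; fun_prop

theorem abs_duhamelSymbol {s γ t τ r : ℝ} (hr : 0 < r) :
    |duhamelSymbol s γ t τ r|
      = diffScale t ^ γ * (1 + (diffScale t * r) ^ s) * |K1 (max (t - τ) 0) r| := by
  have := diffScale_pos t
  rw [duhamelSymbol, abs_mul, abs_of_nonneg (by positivity)]

/-- For τ ≤ t/2 the elapsed time is comparable to t, so the symbol's decay pays for the whole time
weight, at the price of r^{-γ}. At high frequencies the derivative gained by K₁ covers s ≤ 1. -/
theorem exists_abs_duhamelSymbol_le_far {s γ : ℝ} (hs : 0 ≤ s) (hs1 : s ≤ 1) (hγ : 0 ≤ γ) :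
    ∃ C : ℝ, 0 < C ∧ ∀ t τ r : ℝ, 0 ≤ τ → 2 * τ ≤ t → 0 < r →
      |duhamelSymbol s γ t τ r| ≤ C * (1 + r ^ (-γ)) := by
  obtain ⟨C, hC, h⟩ := diffusiveDecay_K1.exists_scaled_le hs hγ
  refine ⟨C, hC, fun t τ r hτ ht hr => ?_⟩
  rw [abs_duhamelSymbol hr, max_eq_left (by linarith)]
  obtain ⟨h1, h2⟩ := h t (t - τ) r (by linarith) (by linarith) (by linarith) hr
  have hrγ : 0 ≤ r ^ (-γ) := by positivity
  rcases le_total r 1 with hr1 | hr1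
  · nlinarith [h1 hr1]
  · have h3 : r ^ (s - 1) ≤ 1 := Real.rpow_le_one_of_one_le_of_nonpos hr1 (by linarith)
    nlinarith [h2 hr1]

/-- Uses no singular weight in r, hence only the L² norm of the source. Only r^s is converted into
decay in t - τ, an exponent that stays integrable at the endpoint; the weight R^{γ+s} is left to the
source. -/
theorem exists_abs_duhamelSymbol_le_near {s : ℝ} (γ : ℝ) (hs : 0 ≤ s) (hs1 : s ≤ 1) :
    ∃ C : ℝ, 0 < C ∧ ∀ t τ r : ℝ, 0 ≤ τ → τ ≤ t → 0 < r →
      |duhamelSymbol s γ t τ r| ≤ C * ((1 + t) ^ ((γ + s) / 2) * (1 + (t - τ)) ^ (-s / 2)) := by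
  obtain ⟨C₁, hC₁, h1⟩ := diffusiveDecay_K1.abs_le zero_le_one
  obtain ⟨C₂, hC₂, h2⟩ := diffusiveDecay_K1 s hs
  refine ⟨C₁ + C₂, by positivity, fun t τ r hτ hτt hr => ?_⟩
  have ht : 0 ≤ t := hτ.trans hτt
  have hθ : 0 ≤ t - τ := by linarith
  have hR := diffScale_pos t
  rw [abs_duhamelSymbol hr, max_eq_left hθ, Real.mul_rpow hR.le hr.le, ← diffScale_rpow ht,
    Real.rpow_add hR]
  have a2 : r ^ s * |K1 (t - τ) r| ≤ C₂ * (1 + (t - τ)) ^ (-s / 2) := by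
    rcases le_total r 1 with hr1 | hr1
    · exact (h2 _ r hθ hr).1 hr1
    · refine le_trans ?_ ((h2 _ r hθ hr).2 hr1)
      gcongr
  have a1 : |K1 (t - τ) r| ≤ C₁ * (diffScale t ^ s * (1 + (t - τ)) ^ (-s / 2)) := by
    have : 1 ≤ diffScale t ^ s * (1 + (t - τ)) ^ (-s / 2) := by
      rw [diffScale_rpow ht, neg_div, Real.rpow_neg (by linarith), ← div_eq_mul_inv,
        one_le_div (by positivity)]
      exact Real.rpow_le_rpow (by linarith) (by linarith) (by linarith)
    nlinarith [h1 (t - τ) r hθ hr]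
  calc diffScale t ^ γ * (1 + diffScale t ^ s * r ^ s) * |K1 (t - τ) r|
      = diffScale t ^ γ * (|K1 (t - τ) r| + diffScale t ^ s * (r ^ s * |K1 (t - τ) r|)) := by ring
    _ ≤ diffScale t ^ γ * (C₁ * (diffScale t ^ s * (1 + (t - τ)) ^ (-s / 2))
        + diffScale t ^ s * (C₂ * (1 + (t - τ)) ^ (-s / 2))) := by gcongr
    _ = _ := by ring

/-- Covers symbols that may be singular at frequency zero, where the Ḣ^{-γ} norm takes over from the
L² norm. -/
theorem norm_mult_le_of_le_one_add_rpow [NeZero n] {k : ℝ → ℝ} {γ C A : ℝ} (hC : 0 ≤ C)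
    (hA : 0 ≤ A) (hk : ∀ r, 0 < r → |k r| ≤ C * (1 + r ^ (-γ))) {f : L2 n} (hf : ‖f‖ ≤ A)
    (hfγ : homSobolevNorm (-γ) f ≤ ENNReal.ofReal A) : ‖mult k f‖ ≤ 2 * C * A := by
  have h1 : ‖mult k f‖ₑ ≤ ENNReal.ofReal (2 * C * A) := by
    calc ‖mult k f‖ₑ ≤ eLpNorm (symbolMul k f) 2 volume := enorm_mult_le k f
      _ ≤ eLpNorm (symbolMul (fun r => C * (1 + r ^ (-γ))) f) 2 volume :=
          eLpNorm_symbolMul_mono f fun r hr => (hk r hr).trans (le_abs_self _)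
      _ ≤ ENNReal.ofReal C * (‖f‖ₑ + homSobolevNorm (-γ) f) := by
          rw [eLpNorm_symbolMul_const_mul, abs_of_nonneg hC, homSobolevNorm_eq,
            ← eLpNorm_symbolMul_one]
          exact mul_le_mul_right
            (eLpNorm_symbolMul_add_le measurable_const (by fun_prop) f) _
      _ ≤ ENNReal.ofReal C * (ENNReal.ofReal A + ENNReal.ofReal A) := by
          refine mul_le_mul_right (add_le_add ?_ hfγ) _
          rw [← ofReal_norm]; exact ENNReal.ofReal_le_ofReal hf
      _ = ENNReal.ofReal (2 * C * A) := by
          rw [← ENNReal.ofReal_add hA hA, ← ENNReal.ofReal_mul hC]; congr 1; ring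
  rw [← ofReal_norm] at h1
  exact (ENNReal.ofReal_le_ofReal_iff (by positivity)).1 h1

/-- The time weight that controls the Duhamel term. -/
noncomputable def duhamelWeight (s β t τ : ℝ) : ℝ :=
  (1 + τ) ^ (-β) + (1 + t) ^ (s / 2 - 1) * (1 + (t - τ)) ^ (-s / 2)

/-- The two summands of the weight come from the two halves of the time interval. Sources with τ ≤
t/2 use the Ḣ^{-γ} bound. For τ ≥ t/2 the L² decay at τ is decay at t, and its surplus γ/2 cancels
the weight R^γ. -/
theorem exists_norm_duhamel_le [NeZero n] {s γ β : ℝ} (hs : 0 ≤ s) (hs1 : s ≤ 1) (hγ : 0 ≤ γ)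
    (hβ : 1 < β) :
    ∃ C : ℝ, 0 < C ∧ ∀ t τ Q : ℝ, 0 ≤ τ → τ ≤ t → 0 ≤ Q → ∀ F : L2 n,
      ‖F‖ ≤ Q * (1 + τ) ^ (-β - γ / 2) →
      homSobolevNorm (-γ) F ≤ ENNReal.ofReal (Q * (1 + τ) ^ (-β)) →
      ‖mult (duhamelSymbol s γ t τ) F‖ ≤ C * Q * duhamelWeight s β t τ := by
  obtain ⟨C₁, hC₁, h1⟩ := exists_abs_duhamelSymbol_le_far (s := s) hs hs1 hγ
  obtain ⟨C₂, hC₂, h2⟩ := exists_abs_duhamelSymbol_le_near γ hs hs1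
  refine ⟨2 * C₁ + C₂ * 2 ^ (β + γ / 2), by positivity, fun t τ Q hτ hτt hQ F hF hFγ => ?_⟩
  have ht : 0 ≤ t := hτ.trans hτt
  have hθ : 0 ≤ t - τ := by linarith
  have hτ1 : 1 ≤ 1 + τ := by linarith
  have w1 : 0 ≤ (1 + τ) ^ (-β) := by positivity
  have w2 : 0 ≤ (1 + t) ^ (s / 2 - 1) * (1 + (t - τ)) ^ (-s / 2) := by positivity
  unfold duhamelWeight
  rcases le_total (2 * τ) t with hfar | hnear
  · have hF' : ‖F‖ ≤ Q * (1 + τ) ^ (-β) :=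
      hF.trans (mul_le_mul_of_nonneg_left
        (Real.rpow_le_rpow_of_exponent_le hτ1 (by linarith)) hQ)
    refine (norm_mult_le_of_le_one_add_rpow hC₁.le (by positivity)
      (fun r hr => h1 t τ r hτ hfar hr) hF' hFγ).trans ?_
    have : 0 ≤ C₂ * 2 ^ (β + γ / 2) := by positivity
    calc 2 * C₁ * (Q * (1 + τ) ^ (-β)) = 2 * C₁ * Q * (1 + τ) ^ (-β) := by ring
      _ ≤ _ := mul_le_mul (by nlinarith) (by linarith) w1 (by positivity)
  · refine (norm_mult_le (fun r hr => h2 t τ r hτ hτt hr) F).trans ?_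
    -- Here 1 + τ ≥ (1+t)/2. Weakening β to 1 leaves the power s/2 - 1 of 1+t, just enough for the
    -- τ-integral.
    have e1 : (1 + τ) ^ (-β - γ / 2) ≤ 2 ^ (β + γ / 2) * (1 + t) ^ (-1 - γ / 2) := by
      have e2 : (1 + τ) ^ (-β - γ / 2) ≤ ((1 + t) / 2) ^ (-β - γ / 2) :=
        Real.rpow_le_rpow_of_nonpos (by linarith) (by linarith) (by linarith)
      have e3 : ((1 + t) / 2) ^ (-β - γ / 2) = 2 ^ (β + γ / 2) * (1 + t) ^ (-β - γ / 2) := by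
        rw [div_eq_mul_inv, Real.mul_rpow (by linarith) (by norm_num), mul_comm,
          Real.inv_rpow (by norm_num), ← Real.rpow_neg (by norm_num)]
        congr 2; ring
      rw [e3] at e2
      refine e2.trans (mul_le_mul_of_nonneg_left ?_ (by positivity))
      exact Real.rpow_le_rpow_of_exponent_le (by linarith) (by linarith)
    have e4 : (1 + t) ^ ((γ + s) / 2) * (1 + t) ^ (-1 - γ / 2) = (1 + t) ^ (s / 2 - 1) := by
      rw [← Real.rpow_add (by linarith)]; congr 1; ring
    calc C₂ * ((1 + t) ^ ((γ + s) / 2) * (1 + (t - τ)) ^ (-s / 2)) * ‖F‖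
        ≤ C₂ * ((1 + t) ^ ((γ + s) / 2) * (1 + (t - τ)) ^ (-s / 2))
          * (Q * (2 ^ (β + γ / 2) * (1 + t) ^ (-1 - γ / 2))) := by
          refine mul_le_mul_of_nonneg_left (hF.trans ?_) (by positivity)
          exact mul_le_mul_of_nonneg_left e1 hQ
      _ = C₂ * 2 ^ (β + γ / 2) * Q * (((1 + t) ^ ((γ + s) / 2) * (1 + t) ^ (-1 - γ / 2))
          * (1 + (t - τ)) ^ (-s / 2)) := by ring
      _ = C₂ * 2 ^ (β + γ / 2) * Q * ((1 + t) ^ (s / 2 - 1) * (1 + (t - τ)) ^ (-s / 2)) := by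
          rw [e4]
      _ ≤ _ := mul_le_mul (by nlinarith) (by linarith) w2 (by positivity)

theorem intervalIntegrable_one_add_rpow {t : ℝ} (ht : 0 ≤ t) (a : ℝ) :
    IntervalIntegrable (fun τ : ℝ => (1 + τ) ^ a) volume 0 t := by
  refine ContinuousOn.intervalIntegrable fun τ hτ => ?_
  rw [Set.uIcc_of_le ht] at hτ
  exact ((by fun_prop : ContinuousAt (fun τ : ℝ => 1 + τ) τ).rpow_const
    (Or.inl (by linarith [hτ.1]))).continuousWithinAt

theorem integral_one_add_rpow {t : ℝ} (ht : 0 ≤ t) {a : ℝ} (ha : a ≠ -1) :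
    ∫ τ in (0 : ℝ)..t, (1 + τ) ^ a = ((1 + t) ^ (a + 1) - 1) / (a + 1) := by
  rw [intervalIntegral.integral_comp_add_left (fun x : ℝ => x ^ a), integral_rpow]
  · simp
  · refine Or.inr ⟨ha, ?_⟩
    rw [Set.uIcc_of_le (by linarith)]
    exact fun h => by linarith [h.1]

theorem intervalIntegrable_duhamelWeight {t : ℝ} (ht : 0 ≤ t) (s β : ℝ) :
    IntervalIntegrable (duhamelWeight s β t) volume 0 t := by
  refine (intervalIntegrable_one_add_rpow ht (-β)).add (IntervalIntegrable.const_mul ?_ _)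
  have := ((intervalIntegrable_one_add_rpow ht (-s / 2)).comp_sub_left t).symm
  simpa using this

/-- The first summand is integrable on the half-line because β > 1. In the second, the prefactor
cancels the growth of the integral up to 1/(1 - s/2) ≤ 2. -/
theorem integral_duhamelWeight_le {s β t : ℝ} (hs1 : s ≤ 1) (hβ : 1 < β) (ht : 0 ≤ t) :
    ∫ τ in (0 : ℝ)..t, duhamelWeight s β t τ ≤ 1 / (β - 1) + 2 := by
  have h2 := ((intervalIntegrable_one_add_rpow ht (-s / 2)).comp_sub_left t).symm
  simp only [sub_self, sub_zero] at h2
  unfold duhamelWeight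
  rw [intervalIntegral.integral_add (intervalIntegrable_one_add_rpow ht (-β)) (h2.const_mul _),
    intervalIntegral.integral_const_mul,
    intervalIntegral.integral_comp_sub_left (fun x : ℝ => (1 + x) ^ (-s / 2)), sub_self, sub_zero,
    integral_one_add_rpow ht (by linarith), integral_one_add_rpow ht (by linarith)]
  have ht1 : 0 < 1 + t := by linarith
  refine add_le_add ?_ ?_
  · rw [show -β + 1 = -(β - 1) by ring, div_neg, ← neg_div]
    have : 0 ≤ (1 + t) ^ (-(β - 1)) := by positivity
    exact div_le_div_of_nonneg_right (by linarith) (by linarith)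
  · have h3 : (0 : ℝ) < -s / 2 + 1 := by linarith
    rw [← mul_div_assoc, div_le_iff₀ h3, mul_sub, ← Real.rpow_add ht1]
    have h4 : s / 2 - 1 + (-s / 2 + 1) = 0 := by ring
    rw [h4, Real.rpow_zero]
    have : 0 ≤ (1 + t) ^ (s / 2 - 1) := by positivity
    linarith

/-! ### Passage to a fixed scale and continuity in time. -/

theorem scaledSymbol_one (s γ r : ℝ) : scaledSymbol s γ 1 r = 1 / (1 + r ^ s) := by
  simp [scaledSymbol]

theorem diffScale_max (t : ℝ) : diffScale (max t 0) = diffScale t := by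
  simp [diffScale]

/-- For R ≥ 1 the scaled norm dominates the norm at R = 1. Time-dependent weights can thus be
exchanged for the fixed H^s norm wherever continuity in time is at stake. -/
theorem rescale_le_one {s γ R r : ℝ} (hs : 0 ≤ s) (hγ : 0 ≤ γ) (hR : 1 ≤ R) (hr : 0 < r) :
    |(1 + r ^ s) * scaledSymbol s γ R r| ≤ 1 := by
  have hR0 : 0 < R := by linarith
  rw [abs_of_nonneg (mul_nonneg (by positivity) (scaledSymbol_nonneg hR0 hr)), scaledSymbol,
    ← mul_div_assoc, div_le_one (by positivity)]
  have h1 : R ^ (-γ) ≤ 1 := Real.rpow_le_one_of_one_le_of_nonpos hR (by linarith)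
  have h2 : r ^ s ≤ (R * r) ^ s := Real.rpow_le_rpow hr.le (by nlinarith) hs
  have h3 : 0 ≤ r ^ s := by positivity
  nlinarith

theorem isSymbol_rescale {s γ R : ℝ} (hs : 0 ≤ s) (hγ : 0 ≤ γ) (hR : 1 ≤ R) :
    IsSymbol fun r => (1 + r ^ s) * scaledSymbol s γ R r :=
  ⟨(by fun_prop : Measurable fun r : ℝ => 1 + r ^ s).mul (measurable_scaledSymbol s γ R), 1,
    fun _ hr => rescale_le_one hs hγ hR hr⟩

theorem mult_scaledSymbol_eq [NeZero n] {s γ R : ℝ} (hs : 0 ≤ s) (hγ : 0 ≤ γ) (hR : 1 ≤ R)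
    (w : L2 n) : mult (scaledSymbol s γ R) w
      = mult (scaledSymbol s γ 1) (mult (fun r => (1 + r ^ s) * scaledSymbol s γ R r) w) := by
  rw [mult_mult (memLp_symbolMul (isSymbol_rescale hs hγ hR) w)]
  refine mult_congr (fun r hr => ?_) w
  rw [scaledSymbol_one]
  have : 0 < 1 + r ^ s := by positivity
  field_simp

theorem continuous_diffScale_mul_rpow {s r : ℝ} (hr : 0 < r) :
    Continuous fun t => (diffScale t * r) ^ s :=
  (continuous_diffScale.mul continuous_const).rpow_const
    fun t => Or.inl (mul_pos (diffScale_pos t) hr).ne'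

theorem continuous_scaledSymbol {s γ r : ℝ} (hr : 0 < r) :
    Continuous fun t => scaledSymbol s γ (diffScale t) r := by
  unfold scaledSymbol
  refine (continuous_diffScale.rpow_const fun t => Or.inl (diffScale_pos t).ne').div
    (continuous_const.add (continuous_diffScale_mul_rpow hr)) fun t => ?_
  have := diffScale_pos t
  positivity

theorem continuous_rescale [NeZero n] {s γ : ℝ} (hs : 0 ≤ s) (hγ : 0 ≤ γ) {w : ℝ → L2 n}
    (hw : Continuous w) : Continuous fun t =>
      mult (fun r => (1 + r ^ s) * scaledSymbol s γ (diffScale t) r) (w t) :=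
  continuous_iff_continuousAt.2 fun _ => continuousAt_mult (B := 1)
    (fun _ => (isSymbol_rescale hs hγ (one_le_diffScale _)).measurable)
    (Eventually.of_forall fun _ _ hr => rescale_le_one hs hγ (one_le_diffScale _) hr)
    (fun _ hr => (continuous_const.mul (continuous_scaledSymbol hr)).continuousAt)
    hw.continuousAt

/-- The source term `|u(τ)|^p` in terms of the scaled unknown `w`. -/
noncomputable def source (s γ p : ℝ) (w : ℝ → L2 n) (τ : ℝ) : L2 n :=
  absPowL2 p (mult (scaledSymbol s γ (diffScale τ)) (w τ))

/-- The part `E₀(t) ∗ u₀` or `E₁(t) ∗ u₁` of the solution in scaled variables. -/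
noncomputable def linearSymbol (k : ℝ → ℝ → ℝ) (s γ t : ℝ) (r : ℝ) : ℝ :=
  diffScale t ^ γ * (1 + (diffScale t * r) ^ s) * k (max t 0) r

/-- The solution of the linear problem in scaled variables. -/
noncomputable def linearPart (s γ : ℝ) (u₀ u₁ : L2 n) (t : ℝ) : L2 n :=
  mult (linearSymbol K0 s γ t) u₀ + mult (linearSymbol K1 s γ t) u₁

/-- The Duhamel term in scaled variables. -/
noncomputable def duhamelPart (s γ p : ℝ) (w : ℝ → L2 n) (t : ℝ) : L2 n :=
  ∫ τ in (0 : ℝ)..max t 0, mult (duhamelSymbol s γ t τ) (source s γ p w τ)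

/-- A crude bound, locally uniform in t; it serves continuity and the local Grönwall argument, where
no decay is needed. -/
theorem exists_abs_duhamelSymbol_le {s : ℝ} (γ : ℝ) (hs : 0 ≤ s) (hs1 : s ≤ 1) :
    ∃ C : ℝ, 0 < C ∧ ∀ t τ r : ℝ, 0 < r →
      |duhamelSymbol s γ t τ r| ≤ C * diffScale t ^ (γ + s) := by
  obtain ⟨C₁, hC₁, h1⟩ := diffusiveDecay_K1.abs_le zero_le_one
  obtain ⟨C₂, hC₂, h2⟩ := diffusiveDecay_K1 s hs
  refine ⟨C₁ + C₂, by positivity, fun t τ r hr => ?_⟩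
  have hθ : 0 ≤ max (t - τ) 0 := le_max_right _ _
  have hR := diffScale_pos t
  rw [abs_duhamelSymbol hr, Real.mul_rpow hR.le hr.le, Real.rpow_add hR]
  set θ := max (t - τ) 0
  have a2 : r ^ s * |K1 θ r| ≤ C₂ := by
    have hle : C₂ * (1 + θ) ^ (-s / 2) ≤ C₂ :=
      mul_le_of_le_one_right hC₂.le
        (Real.rpow_le_one_of_one_le_of_nonpos (by linarith) (by linarith))
    rcases le_total r 1 with hr1 | hr1
    · exact ((h2 _ r hθ hr).1 hr1).trans hle
    · refine le_trans ?_ (((h2 _ r hθ hr).2 hr1).trans hle)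
      gcongr
  have a1 : |K1 θ r| ≤ C₁ * diffScale t ^ s := by
    have := Real.one_le_rpow (one_le_diffScale t) hs
    nlinarith [h1 θ r hθ hr]
  calc diffScale t ^ γ * (1 + diffScale t ^ s * r ^ s) * |K1 θ r|
      = diffScale t ^ γ * (|K1 θ r| + diffScale t ^ s * (r ^ s * |K1 θ r|)) := by ring
    _ ≤ diffScale t ^ γ * (C₁ * diffScale t ^ s + diffScale t ^ s * C₂) := by gcongr
    _ = _ := by ring

theorem isSymbol_duhamelSymbol {s : ℝ} (γ : ℝ) (hs : 0 ≤ s) (hs1 : s ≤ 1) (t τ : ℝ) :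
    IsSymbol (duhamelSymbol s γ t τ) := by
  obtain ⟨C, -, h⟩ := exists_abs_duhamelSymbol_le γ hs hs1
  exact ⟨measurable_duhamelSymbol s γ t τ, _, fun r hr => h t τ r hr⟩

theorem eventually_diffScale_rpow_le {X : Type*} [TopologicalSpace X] {f : X → ℝ}
    (hf : Continuous f) (a C : ℝ) (x : X) (hC : 0 ≤ C) :
    ∀ᶠ y in 𝓝 x, C * diffScale (f y) ^ a ≤ C * (diffScale (f x) ^ a + 1) := by
  have h : Continuous fun y => diffScale (f y) ^ a :=
    (continuous_diffScale.comp hf).rpow_const fun y => Or.inl (diffScale_pos _).ne'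
  filter_upwards [h.continuousAt.eventually (eventually_lt_nhds (lt_add_one _))] with y hy
  exact mul_le_mul_of_nonneg_left hy.le hC

theorem continuous_mult_duhamelSymbol [NeZero n] {s : ℝ} (γ : ℝ) (hs : 0 ≤ s) (hs1 : s ≤ 1)
    {F : ℝ → L2 n} (hF : Continuous F) :
    Continuous fun x : ℝ × ℝ => mult (duhamelSymbol s γ x.1 x.2) (F x.2) := by
  obtain ⟨C, hC, h⟩ := exists_abs_duhamelSymbol_le γ hs hs1
  refine continuous_iff_continuousAt.2 fun x => continuousAt_mult
    (k := fun y : ℝ × ℝ => duhamelSymbol s γ y.1 y.2) (f := fun y : ℝ × ℝ => F y.2)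
    (B := C * (diffScale x.1 ^ (γ + s) + 1))
    (fun y => measurable_duhamelSymbol s γ y.1 y.2) ?_ (fun r hr => ?_)
    (hF.comp continuous_snd).continuousAt
  · filter_upwards [eventually_diffScale_rpow_le continuous_fst (γ + s) C x hC.le] with y hy r hr
    exact (h y.1 y.2 r hr).trans hy
  · have h1 : Continuous fun y : ℝ × ℝ => diffScale y.1 ^ γ :=
      (continuous_diffScale.comp continuous_fst).rpow_const fun y => Or.inl (diffScale_pos _).ne'
    have h2 : Continuous fun y : ℝ × ℝ => (diffScale y.1 * r) ^ s :=
      (continuous_diffScale_mul_rpow hr).comp continuous_fst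
    have h3 : Continuous fun y : ℝ × ℝ => K1 (max (y.1 - y.2) 0) r :=
      (continuous_K1 r).comp (by fun_prop)
    exact ((h1.mul (continuous_const.add h2)).mul h3).continuousAt

theorem one_add_rpow_le {s r : ℝ} (hs : 0 ≤ s) (hr : 0 < r) :
    1 + r ^ s ≤ 2 * (1 + r ^ 2) ^ (s / 2) := by
  have h1 : 1 ≤ (1 + r ^ 2) ^ (s / 2) := Real.one_le_rpow (by nlinarith) (by linarith)
  have h2 : r ^ s ≤ (1 + r ^ 2) ^ (s / 2) := by
    have : r ^ s = (r ^ 2) ^ (s / 2) := by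
      rw [← Real.rpow_natCast r 2, ← Real.rpow_mul hr.le]; congr 1; push_cast; ring
    rw [this]
    exact Real.rpow_le_rpow (by positivity) (by linarith) (by linarith)
  linarith

/-- Subadditivity of x^{s/2}; with `one_add_rpow_le` it makes 1 + r^s an equivalent weight for H^s.
-/
theorem le_one_add_rpow {s r : ℝ} (hs : 0 ≤ s) (hs1 : s ≤ 1) (hr : 0 < r) :
    (1 + r ^ 2) ^ (s / 2) ≤ 1 + r ^ s := by
  have h := Real.rpow_add_le_add_rpow (p := s / 2) zero_le_one (sq_nonneg r) (by linarith)
    (by linarith)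
  rw [Real.one_rpow, ← Real.rpow_natCast r 2, ← Real.rpow_mul hr.le] at h
  have e : ((2 : ℕ) : ℝ) * (s / 2) = s := by push_cast; ring
  rw [e] at h
  rwa [← Real.rpow_natCast r 2]

/-- `(1 + (-Δ)^{s/2}) u`. -/
noncomputable def sobolevLift (s : ℝ) (u : L2 n) : L2 n := mult (fun r => 1 + r ^ s) u

theorem eLpNorm_symbolMul_one_add_rpow_le [NeZero n] {s : ℝ} (hs : 0 ≤ s) (u : L2 n) :
    eLpNorm (symbolMul (fun r => 1 + r ^ s) u) 2 volume ≤ 2 * sobolevNorm s u := by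
  have h2 : ENNReal.ofReal |2| = 2 := by simp
  rw [sobolevNorm_eq]
  refine le_of_le_of_eq
    (b := eLpNorm (symbolMul (fun r => 2 * (1 + r ^ 2) ^ (s / 2)) u) 2 volume) ?_
    (by rw [eLpNorm_symbolMul_const_mul, h2])
  refine eLpNorm_symbolMul_mono u fun r hr => ?_
  rw [abs_of_nonneg (by positivity)]
  exact (one_add_rpow_le hs hr).trans (le_abs_self _)

theorem memLp_sobolevLift [NeZero n] {s : ℝ} (hs : 0 ≤ s) {u : L2 n} (hu : sobolevNorm s u < ∞) :
    MemLp (symbolMul (fun r => 1 + r ^ s) u) 2 volume :=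
  ⟨aestronglyMeasurable_symbolMul (by fun_prop) u,
    (eLpNorm_symbolMul_one_add_rpow_le hs u).trans_lt (ENNReal.mul_lt_top (by simp) hu)⟩

/-- With the converse below, this identifies H^s with L². Finiteness of the H^s norm keeps the lift
away from its default value 0. -/
theorem mult_scaledSymbol_one_lift [NeZero n] {s : ℝ} (γ : ℝ) (hs : 0 ≤ s) {u : L2 n}
    (hu : sobolevNorm s u < ∞) : mult (scaledSymbol s γ 1) (sobolevLift s u) = u := by
  rw [sobolevLift, mult_mult (memLp_sobolevLift hs hu)]
  conv_rhs => rw [← mult_one u]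
  refine mult_congr (fun r hr => ?_) u
  have : 0 < 1 + r ^ s := by positivity
  rw [scaledSymbol_one]
  field_simp

theorem sobolevLift_mult_scaledSymbol_one [NeZero n] {s : ℝ} (γ : ℝ) (hs : 0 ≤ s) (w : L2 n) :
    sobolevLift s (mult (scaledSymbol s γ 1) w) = w := by
  rw [sobolevLift, mult_mult (memLp_symbolMul (isSymbol_scaledSymbol hs one_pos) w)]
  conv_rhs => rw [← mult_one w]
  refine mult_congr (fun r hr => ?_) w
  have : 0 < 1 + r ^ s := by positivity
  rw [scaledSymbol_one]
  field_simp

theorem sobolevNorm_mult_scaledSymbol_one_le [NeZero n] {s : ℝ} (γ : ℝ) (hs : 0 ≤ s) (hs1 : s ≤ 1)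
    (w : L2 n) : sobolevNorm s (mult (scaledSymbol s γ 1) w) ≤ ‖w‖ₑ := by
  have hm := memLp_symbolMul (isSymbol_scaledSymbol (γ := γ) hs one_pos) w
  rw [sobolevNorm_eq, eLpNorm_congr_ae (symbolMul_mult hm), ← eLpNorm_symbolMul_one w]
  refine eLpNorm_symbolMul_mono w fun r hr => ?_
  rw [scaledSymbol_one, abs_one, abs_of_nonneg (by positivity), mul_one_div,
    div_le_one (by positivity)]
  exact le_one_add_rpow hs hs1 hr

/-! ### The linear evolution in scaled variables. -/

theorem measurable_linearSymbol {k : ℝ → ℝ → ℝ} (hk : ∀ t, Measurable (k t)) (s γ t : ℝ) :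
    Measurable (linearSymbol k s γ t) := by
  have := hk (max t 0)
  unfold linearSymbol; fun_prop

theorem abs_linearSymbol {k : ℝ → ℝ → ℝ} {s γ t r : ℝ} (hr : 0 < r) :
    |linearSymbol k s γ t r|
      = diffScale t ^ γ * (1 + (diffScale t * r) ^ s) * |k (max t 0) r| := by
  have := diffScale_pos t
  rw [linearSymbol, abs_mul, abs_of_nonneg (by positivity)]

/-- A symbol gaining q derivatives needs data in H^{max(s-q,0)}: H^s for K₀ (q = 0) and L² for K₁ (q
= 1 ≥ s). -/
theorem exists_abs_linearSymbol_le {q s γ : ℝ} {k : ℝ → ℝ → ℝ} (h : DiffusiveDecay q k)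
    (hs : 0 ≤ s) (hγ : 0 ≤ γ) :
    ∃ C : ℝ, 0 < C ∧ ∀ t r : ℝ, 0 < r →
      |linearSymbol k s γ t r| ≤ C * ((1 + r ^ 2) ^ (max (s - q) 0 / 2) + r ^ (-γ)) := by
  obtain ⟨C, hC, h⟩ := h.exists_scaled_le hs hγ
  refine ⟨C, hC, fun t r hr => ?_⟩
  have ht : 0 ≤ max t 0 := le_max_right _ _
  rw [abs_linearSymbol hr, ← diffScale_max t]
  obtain ⟨h1, h2⟩ := h (max t 0) (max t 0) r ht ht (by linarith) hr
  have hrγ : 0 ≤ r ^ (-γ) := by positivity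
  have hr2 : 0 ≤ (1 + r ^ 2) ^ (max (s - q) 0 / 2) := by positivity
  rcases le_total r 1 with hr1 | hr1
  · nlinarith [h1 hr1]
  · have h3 : r ^ (s - q) ≤ (1 + r ^ 2) ^ (max (s - q) 0 / 2) := by
      calc r ^ (s - q) ≤ r ^ max (s - q) 0 :=
            Real.rpow_le_rpow_of_exponent_le hr1 (le_max_left _ _)
        _ = (r ^ 2) ^ (max (s - q) 0 / 2) := by
            rw [← Real.rpow_natCast r 2, ← Real.rpow_mul hr.le]; congr 1; push_cast; ring
        _ ≤ _ := Real.rpow_le_rpow (by positivity) (by linarith)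
            (by linarith [le_max_right (s - q) 0])
    nlinarith [h2 hr1]

theorem exists_eLpNorm_linearSymbol_le [NeZero n] {q s γ : ℝ} {k : ℝ → ℝ → ℝ}
    (h : DiffusiveDecay q k) (hs : 0 ≤ s) (hγ : 0 ≤ γ) :
    ∃ C : ℝ, 0 < C ∧ ∀ (t : ℝ) (f : L2 n),
      eLpNorm (symbolMul (linearSymbol k s γ t) f) 2 volume
        ≤ ENNReal.ofReal C * (sobolevNorm (max (s - q) 0) f + homSobolevNorm (-γ) f) := by
  obtain ⟨C, hC, h⟩ := exists_abs_linearSymbol_le h hs hγ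
  refine ⟨C, hC, fun t f => ?_⟩
  calc eLpNorm (symbolMul (linearSymbol k s γ t) f) 2 volume
      ≤ eLpNorm (symbolMul
          (fun r => C * ((1 + r ^ 2) ^ (max (s - q) 0 / 2) + r ^ (-γ))) f) 2 volume :=
        eLpNorm_symbolMul_mono f fun r hr => (h t r hr).trans (le_abs_self _)
    _ ≤ _ := by
        rw [eLpNorm_symbolMul_const_mul, abs_of_pos hC]
        exact mul_le_mul_right (eLpNorm_symbolMul_add_le (by fun_prop) (by fun_prop) f) _

theorem sobolevNorm_zero (f : L2 n) : sobolevNorm 0 f = ‖f‖ₑ := by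
  rw [sobolevNorm_eq, ← eLpNorm_symbolMul_one]
  simp

/-- The linear evolution is bounded in scaled variables. -/
theorem exists_linearPart_bound [NeZero n] {s γ : ℝ} (hs : 0 ≤ s) (hs1 : s ≤ 1) (hγ : 0 ≤ γ) :
    ∃ C : ℝ, 0 < C ∧ ∀ u₀ u₁ : L2 n,
      (∀ t, eLpNorm (symbolMul (linearSymbol K0 s γ t) u₀) 2 volume
        ≤ ENNReal.ofReal C * dataNorm s γ u₀ u₁) ∧
      (∀ t, eLpNorm (symbolMul (linearSymbol K1 s γ t) u₁) 2 volume
        ≤ ENNReal.ofReal C * dataNorm s γ u₀ u₁) ∧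
      ∀ t, ‖linearPart s γ u₀ u₁ t‖ₑ ≤ ENNReal.ofReal C * dataNorm s γ u₀ u₁ := by
  obtain ⟨C₀, hC₀, h0⟩ := exists_eLpNorm_linearSymbol_le (n := n) diffusiveDecay_K0 hs hγ
  obtain ⟨C₁, hC₁, h1⟩ := exists_eLpNorm_linearSymbol_le (n := n) diffusiveDecay_K1 hs hγ
  simp only [sub_zero, max_eq_left hs] at h0
  simp only [max_eq_right (show s - 1 ≤ 0 by linarith), sobolevNorm_zero] at h1
  refine ⟨C₀ + C₁, by positivity, fun u₀ u₁ => ?_⟩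
  have hle0 : ENNReal.ofReal C₀ ≤ ENNReal.ofReal (C₀ + C₁) :=
    ENNReal.ofReal_le_ofReal (by linarith)
  have hle1 : ENNReal.ofReal C₁ ≤ ENNReal.ofReal (C₀ + C₁) :=
    ENNReal.ofReal_le_ofReal (by linarith)
  refine ⟨fun t => (h0 t u₀).trans (mul_le_mul' hle0 le_self_add),
    fun t => (h1 t u₁).trans (mul_le_mul' hle1 le_add_self), fun t => ?_⟩
  refine (enorm_add_le _ _).trans ?_
  rw [dataNorm, mul_add]
  exact add_le_add ((enorm_mult_le _ _).trans ((h0 t u₀).trans (mul_le_mul_left hle0 _)))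
    ((enorm_mult_le _ _).trans ((h1 t u₁).trans (mul_le_mul_left hle1 _)))

/-- K₀ gains no derivative, so the bounds do not make the weighted symbol bounded in r. Factoring
through `sobolevLift` shifts r^s to the datum and leaves a locally bounded family. -/
theorem continuous_mult_linearSymbol_K0 [NeZero n] {s : ℝ} (γ : ℝ) (hs : 0 ≤ s) {u : L2 n}
    (hu : sobolevNorm s u < ∞) : Continuous fun t => mult (linearSymbol K0 s γ t) u := by
  obtain ⟨C, hC, h⟩ := diffusiveDecay_K0.abs_le le_rfl
  have hb : ∀ t r, 0 < r →
      |linearSymbol K0 s γ t r * scaledSymbol s 0 1 r| ≤ C * diffScale t ^ (γ + s) := by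
    intro t r hr
    have hR := diffScale_pos t
    have hk := h (max t 0) r (le_max_right _ _) hr
    rw [abs_mul, abs_linearSymbol hr, scaledSymbol_one,
      abs_of_nonneg (show 0 ≤ 1 / (1 + r ^ s) by positivity), mul_one_div, div_le_iff₀ (by positivity), Real.rpow_add hR, Real.mul_rpow hR.le hr.le]
    have h1 := Real.one_le_rpow (one_le_diffScale t) hs
    have h2 : 1 + diffScale t ^ s * r ^ s ≤ diffScale t ^ s * (1 + r ^ s) := by linarith
    calc diffScale t ^ γ * (1 + diffScale t ^ s * r ^ s) * |K0 (max t 0) r|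
        ≤ diffScale t ^ γ * (diffScale t ^ s * (1 + r ^ s)) * C := by gcongr
      _ = _ := by ring
  have hmeas : ∀ t, Measurable fun r => linearSymbol K0 s γ t r * scaledSymbol s 0 1 r :=
    fun t => (measurable_linearSymbol measurable_K0 s γ t).mul (measurable_scaledSymbol s 0 1)
  have heq : (fun t => mult (linearSymbol K0 s γ t) u) = fun t =>
      mult (fun r => linearSymbol K0 s γ t r * scaledSymbol s 0 1 r) (sobolevLift s u) := by
    ext1 t
    conv_lhs => rw [← mult_scaledSymbol_one_lift 0 hs hu]
    rw [mult_mult (memLp_symbolMul (isSymbol_scaledSymbol hs one_pos) _)]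
  rw [heq]
  refine continuous_iff_continuousAt.2 fun t => continuousAt_mult
    (B := C * (diffScale t ^ (γ + s) + 1)) hmeas ?_ (fun r hr => ?_) continuousAt_const
  · filter_upwards [eventually_diffScale_rpow_le continuous_id (γ + s) C t hC.le] with y hy r hr
    exact (hb y r hr).trans hy
  · unfold linearSymbol
    have h1 : Continuous fun t => diffScale t ^ γ :=
      continuous_diffScale.rpow_const fun y => Or.inl (diffScale_pos _).ne'
    have h2 : Continuous fun t => (diffScale t * r) ^ s := continuous_diffScale_mul_rpow hr
    have h3 : Continuous fun t => K0 (max t 0) r := (continuous_K0 r).comp (by fun_prop)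
    fun_prop

theorem linearSymbol_K1 (s γ t : ℝ) : linearSymbol K1 s γ t = duhamelSymbol s γ t 0 := by
  ext r; simp [linearSymbol, duhamelSymbol]

theorem continuous_linearPart [NeZero n] {s : ℝ} (γ : ℝ) (hs : 0 ≤ s) (hs1 : s ≤ 1) {u₀ : L2 n}
    (hu : sobolevNorm s u₀ < ∞) (u₁ : L2 n) : Continuous (linearPart s γ u₀ u₁) := by
  have hK1 : Continuous fun t => mult (linearSymbol K1 s γ t) u₁ := by
    have h := continuous_mult_duhamelSymbol γ hs hs1 (F := fun _ => u₁) continuous_const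
    have hc : Continuous fun t : ℝ => (t, (0 : ℝ)) := by fun_prop
    have h1 := h.comp hc
    simp only [Function.comp_def] at h1
    simp only [linearSymbol_K1]
    exact h1
  exact (continuous_mult_linearSymbol_K0 γ hs hu).add hK1

/-! ### The contraction argument. -/

/-- The conditions on the parameters in the form in which they are used. -/
structure Admissible (n : ℕ) (s γ p : ℝ) : Prop where
  s_pos : 0 < s
  s_le_one : s ≤ 1
  γ_pos : 0 < γ
  γ_lt : 2 * γ < n
  one_lt_p : 1 < p
  le_p : 1 + 2 * γ / n ≤ p
  p_le : p * (n - 2 * s) ≤ n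
  supercritical : 1 < (p - 1) * (n + 2 * γ) / 4

theorem Admissible.exists_nonlinear [NeZero n] {s γ p : ℝ} (h : Admissible n s γ p) :
    ∃ C : ℝ, 0 < C ∧ ∀ R : ℝ, 0 < R → ∀ w w' : L2 n,
      MemLp (absPow p (mult (scaledSymbol s γ R) w)) 2 volume ∧
      ‖absPowL2 p (mult (scaledSymbol s γ R) w) - absPowL2 p (mult (scaledSymbol s γ R) w')‖
        ≤ C * R ^ (-((p - 1) * (n + 2 * γ) / 2) - γ)
          * (‖w - w'‖ * (‖w‖ + ‖w'‖) ^ (p - 1)) ∧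
      homSobolevNorm (-γ)
          (absPowL2 p (mult (scaledSymbol s γ R) w) - absPowL2 p (mult (scaledSymbol s γ R) w'))
        ≤ ENNReal.ofReal (C * R ^ (-((p - 1) * (n + 2 * γ) / 2))
          * (‖w - w'‖ * (‖w‖ + ‖w'‖) ^ (p - 1))) :=
  exists_nonlinear_estimate h.s_pos h.γ_pos h.γ_lt h.one_lt_p h.le_p h.p_le

/-- The nonlinearity is locally Lipschitz from `H^s` to `L²`. -/
theorem Admissible.exists_norm_absPowL2_sub_le [NeZero n] {s γ p : ℝ} (h : Admissible n s γ p) :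
    ∃ C : ℝ, 0 < C ∧ ∀ w w' : L2 n,
      ‖absPowL2 p (mult (scaledSymbol s γ 1) w) - absPowL2 p (mult (scaledSymbol s γ 1) w')‖
        ≤ C * (‖w - w'‖ * (‖w‖ + ‖w'‖) ^ (p - 1)) := by
  obtain ⟨C, hC, hN⟩ := h.exists_nonlinear
  refine ⟨C, hC, fun w w' => ?_⟩
  simpa using (hN 1 one_pos w w').2.1

theorem Admissible.continuous_absPowL2 [NeZero n] {s γ p : ℝ} (h : Admissible n s γ p) :
    Continuous fun w : L2 n => absPowL2 p (mult (scaledSymbol s γ 1) w) := by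
  obtain ⟨C, -, hC⟩ := h.exists_norm_absPowL2_sub_le
  exact continuous_of_norm_sub_le (by linarith [h.one_lt_p]) hC

theorem Admissible.continuous_source [NeZero n] {s γ p : ℝ} (h : Admissible n s γ p)
    {w : ℝ → L2 n} (hw : Continuous w) : Continuous (source s γ p w) := by
  have h1 := h.continuous_absPowL2.comp (continuous_rescale h.s_pos.le h.γ_pos.le hw)
  refine h1.congr fun τ => ?_
  rw [source, mult_scaledSymbol_eq h.s_pos.le h.γ_pos.le (one_le_diffScale τ)]
  rfl

theorem Admissible.continuous_duhamel_integrand [NeZero n] {s γ p : ℝ} (h : Admissible n s γ p)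
    {w : ℝ → L2 n} (hw : Continuous w) : Continuous fun x : ℝ × ℝ =>
      mult (duhamelSymbol s γ x.1 x.2) (source s γ p w x.2) :=
  continuous_mult_duhamelSymbol γ h.s_pos.le h.s_le_one (h.continuous_source hw)

theorem Admissible.continuous_duhamel_integrand_left [NeZero n] {s γ p : ℝ}
    (h : Admissible n s γ p) {w : ℝ → L2 n} (hw : Continuous w) (t : ℝ) :
    Continuous fun τ => mult (duhamelSymbol s γ t τ) (source s γ p w τ) := by
  have h1 := (h.continuous_duhamel_integrand hw).comp (by fun_prop : Continuous fun τ : ℝ => (t, τ))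
  simp only [Function.comp_def] at h1
  exact h1

theorem Admissible.continuous_duhamelPart [NeZero n] {s γ p : ℝ} (h : Admissible n s γ p)
    {w : ℝ → L2 n} (hw : Continuous w) : Continuous (duhamelPart s γ p w) := by
  have h1 := h.continuous_duhamel_integrand hw
  exact intervalIntegral.continuous_parametric_intervalIntegral_of_continuous
    (f := fun t τ => mult (duhamelSymbol s γ t τ) (source s γ p w τ)) h1
    (s := fun t : ℝ => max t 0) (by fun_prop)

/-- The global-in-time Lipschitz estimate: the nonlinear bounds at scale √(1+τ) feed the Duhamel
estimate with β = (p-1)(n+2γ)/4, and the weight integrates to a constant free of t. The power p - 1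
> 0 of M supplies smallness. -/
theorem Admissible.exists_duhamelPart_sub_le [NeZero n] {s γ p : ℝ} (h : Admissible n s γ p) :
    ∃ Λ : ℝ, 0 < Λ ∧ ∀ w w' : ℝ → L2 n, Continuous w → Continuous w' → ∀ M d : ℝ,
      (∀ t, ‖w t‖ ≤ M) → (∀ t, ‖w' t‖ ≤ M) → (∀ t, ‖w t - w' t‖ ≤ d) →
      ∀ t, ‖duhamelPart s γ p w t - duhamelPart s γ p w' t‖ ≤ Λ * (d * (2 * M) ^ (p - 1)) := by
  obtain ⟨C, hC, hN⟩ := h.exists_nonlinear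
  set β := (p - 1) * (n + 2 * γ) / 4 with hβ
  have hβ1 : 1 < β := h.supercritical
  obtain ⟨A, hA, hD⟩ := exists_norm_duhamel_le (n := n) h.s_pos.le h.s_le_one h.γ_pos.le hβ1
  have hβ0 : 0 < β - 1 := by linarith
  refine ⟨A * C * (1 / (β - 1) + 2), by positivity, fun w w' hw hw' M d hM hM' hd t => ?_⟩
  have hp1 : 0 < p - 1 := by linarith [h.one_lt_p]
  have hM0 : 0 ≤ M := (norm_nonneg _).trans (hM 0)
  have hd0 : 0 ≤ d := (norm_nonneg _).trans (hd 0)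
  set T := max t 0 with hT
  have hT0 : 0 ≤ T := le_max_right _ _
  set Q := C * (d * (2 * M) ^ (p - 1)) with hQ
  have hQ0 : 0 ≤ Q := by positivity
  have hi1 := (h.continuous_duhamel_integrand_left hw t).intervalIntegrable (μ := volume) 0 T
  have hi2 := (h.continuous_duhamel_integrand_left hw' t).intervalIntegrable (μ := volume) 0 T
  have hNle : ∀ τ, ‖w τ - w' τ‖ * (‖w τ‖ + ‖w' τ‖) ^ (p - 1) ≤ d * (2 * M) ^ (p - 1) := by
    intro τ
    have := hM τ
    have := hM' τ
    exact mul_le_mul (hd τ) (Real.rpow_le_rpow (by positivity) (by linarith) hp1.le)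
      (by positivity) hd0
  have hbound : ∀ τ ∈ Set.Ioc 0 T,
      ‖mult (duhamelSymbol s γ t τ) (source s γ p w τ)
        - mult (duhamelSymbol s γ t τ) (source s γ p w' τ)‖ ≤ A * Q * duhamelWeight s β T τ := by
    intro τ hτ
    -- The interval (0, T] contains τ, so t cannot be nonpositive.
    have ht : T = t := by
      rcases le_total t 0 with h0 | h0
      · rw [hT, max_eq_right h0] at hτ
        exact absurd hτ.2 (not_le.2 hτ.1)
      · exact max_eq_left h0
    rw [← mult_sub (isSymbol_duhamelSymbol γ h.s_pos.le h.s_le_one t τ), ← ht]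
    have hτ0 := hτ.1.le
    obtain ⟨-, h2, h3⟩ := hN (diffScale τ) (diffScale_pos τ) (w τ) (w' τ)
    rw [diffScale_rpow hτ0] at h2 h3
    have e1 : (-((p - 1) * (n + 2 * γ) / 2) - γ) / 2 = -β - γ / 2 := by rw [hβ]; ring
    have e2 : -((p - 1) * (n + 2 * γ) / 2) / 2 = -β := by rw [hβ]; ring
    rw [e1] at h2
    rw [e2] at h3
    refine hD T τ Q hτ0 hτ.2 hQ0 _ ?_ ?_
    · refine h2.trans ?_
      calc C * (1 + τ) ^ (-β - γ / 2) * (‖w τ - w' τ‖ * (‖w τ‖ + ‖w' τ‖) ^ (p - 1))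
          ≤ C * (1 + τ) ^ (-β - γ / 2) * (d * (2 * M) ^ (p - 1)) :=
            mul_le_mul_of_nonneg_left (hNle τ) (by positivity)
        _ = _ := by rw [hQ]; ring
    · refine h3.trans (ENNReal.ofReal_le_ofReal ?_)
      calc C * (1 + τ) ^ (-β) * (‖w τ - w' τ‖ * (‖w τ‖ + ‖w' τ‖) ^ (p - 1))
          ≤ C * (1 + τ) ^ (-β) * (d * (2 * M) ^ (p - 1)) :=
            mul_le_mul_of_nonneg_left (hNle τ) (by positivity)
        _ = _ := by rw [hQ]; ring
  rw [duhamelPart, duhamelPart, ← intervalIntegral.integral_sub hi1 hi2]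
  refine (intervalIntegral.norm_integral_le_of_norm_le hT0
    (Eventually.of_forall fun τ => hbound τ)
    ((intervalIntegrable_duhamelWeight hT0 s β).const_mul _)).trans ?_
  rw [intervalIntegral.integral_const_mul]
  refine (mul_le_mul_of_nonneg_left (integral_duhamelWeight_le h.s_le_one hβ1 hT0)
    (by positivity)).trans (le_of_eq ?_)
  rw [hQ]; ring

theorem mult_zero [NeZero n] {k : ℝ → ℝ} (hk : IsSymbol k) : mult k (0 : L2 n) = 0 :=
  (multCLM k hk).map_zero

theorem absPowL2_zero {p : ℝ} (hp : p ≠ 0) : absPowL2 p (0 : L2 n) = 0 := by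
  have h := absPow_zero (n := n) hp
  have hm : MemLp (absPow p (0 : L2 n)) 2 volume := (memLp_congr_ae h).2 MemLp.zero
  refine Lp.ext ((absPowL2_coeFn hm).trans (h.trans (Lp.coeFn_zero ℂ 2 volume).symm))

theorem Admissible.duhamelPart_zero [NeZero n] {s γ p : ℝ} (h : Admissible n s γ p) (t : ℝ) :
    duhamelPart s γ p (fun _ => (0 : L2 n)) t = 0 := by
  have hp : p ≠ 0 := by linarith [h.one_lt_p]
  have h1 : ∀ τ, mult (duhamelSymbol s γ t τ) (source s γ p (fun _ => (0 : L2 n)) τ) = 0 := by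
    intro τ
    rw [source, mult_zero (isSymbol_scaledSymbol h.s_pos.le (diffScale_pos τ)), absPowL2_zero hp,
      mult_zero (isSymbol_duhamelSymbol γ h.s_pos.le h.s_le_one t τ)]
  simp [duhamelPart, h1]

/-- Besides existence, ‖x‖ ≤ ‖x‖/2 + ‖f 0‖ bounds the fixed point by the free term and not merely by
the radius; the estimates linear in the data come from here. -/
theorem exists_fixedPoint_closedBall {E : Type*} [NormedAddCommGroup E] [CompleteSpace E]
    {f : E → E} {M : ℝ} (hM : 2 * ‖f 0‖ ≤ M)
    (hf : ∀ x y, ‖x‖ ≤ M → ‖y‖ ≤ M → ‖f x - f y‖ ≤ 1 / 2 * ‖x - y‖) :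
    ∃ x, f x = x ∧ ‖x‖ ≤ 2 * ‖f 0‖ := by
  have hM0 : 0 ≤ M := le_trans (by positivity) hM
  have hf0 : ∀ x, ‖x‖ ≤ M → ‖f x‖ ≤ 1 / 2 * ‖x‖ + ‖f 0‖ := by
    intro x hx
    have h1 := hf x 0 hx (by simpa using hM0)
    rw [sub_zero] at h1
    have := norm_le_norm_sub_add (f x) (f 0)
    linarith
  have hmaps : Set.MapsTo f (Metric.closedBall 0 M) (Metric.closedBall 0 M) := by
    intro x hx
    rw [mem_closedBall_zero_iff] at hx ⊢
    linarith [hf0 x hx]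
  have hcontr : ContractingWith (1 / 2) (hmaps.restrict f _ _) := by
    refine ⟨by norm_num, LipschitzWith.of_dist_le_mul fun x y => ?_⟩
    have h1 := hf x y (mem_closedBall_zero_iff.1 x.2) (mem_closedBall_zero_iff.1 y.2)
    rw [Subtype.dist_eq, Subtype.dist_eq, dist_eq_norm, dist_eq_norm]
    simpa using h1
  obtain ⟨x, hx, hfx, -⟩ := hcontr.exists_fixedPoint' Metric.isClosed_closedBall.isComplete
    hmaps (x := 0) (by simpa using hM0) (edist_ne_top _ _)
  refine ⟨x, hfx, ?_⟩
  have h2 := hf0 x (mem_closedBall_zero_iff.1 hx)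
  rw [hfx.eq] at h2
  linarith

theorem Admissible.exists_scaled_solution [NeZero n] {s γ p : ℝ} (h : Admissible n s γ p) :
    ∃ δ : ℝ, 0 < δ ∧ ∀ L : ℝ → L2 n, Continuous L → ∀ B : ℝ, B ≤ δ → (∀ t, ‖L t‖ ≤ B) →
      ∃ w : ℝ → L2 n, Continuous w ∧ (∀ t, w t = L t + duhamelPart s γ p w t) ∧
        ∀ t, ‖w t‖ ≤ 2 * B := by
  obtain ⟨Λ, hΛ, hlip⟩ := h.exists_duhamelPart_sub_le
  have hp1 : 0 < p - 1 := by linarith [h.one_lt_p]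
  -- The radius at which the Lipschitz constant Λ(2M)^{p-1} equals 1/2.
  set M := (1 / (2 * Λ)) ^ (p - 1)⁻¹ / 2 with hM
  have hM0 : 0 < M := by positivity
  have hMp : Λ * (2 * M) ^ (p - 1) = 1 / 2 := by
    rw [hM, mul_div_cancel₀ _ (two_ne_zero), Real.rpow_inv_rpow (by positivity) hp1.ne']
    field_simp
  refine ⟨M / 2, by positivity, fun L hL B hB hLB => ?_⟩
  have hB0 : 0 ≤ B := (norm_nonneg _).trans (hLB 0)
  -- Comparison with w' = 0 shows that the Duhamel part is bounded, so the fixed-point map acts on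
  -- bounded continuous functions.
  have hzero : ∀ (w : BoundedContinuousFunction ℝ (L2 n)) t,
      ‖duhamelPart s γ p w t‖ ≤ Λ * (‖w‖ * (2 * ‖w‖) ^ (p - 1)) := by
    intro w t
    have := hlip w (fun _ => 0) w.continuous continuous_const ‖w‖ ‖w‖ w.norm_coe_le_norm
      (by simp) (fun t => by simpa using w.norm_coe_le_norm t) t
    rwa [h.duhamelPart_zero, sub_zero] at this
  let Φ : BoundedContinuousFunction ℝ (L2 n) → BoundedContinuousFunction ℝ (L2 n) := fun w =>
    BoundedContinuousFunction.ofNormedAddCommGroup (fun t => L t + duhamelPart s γ p w t)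
      (hL.add (h.continuous_duhamelPart w.continuous)) (B + Λ * (‖w‖ * (2 * ‖w‖) ^ (p - 1)))
      (fun t => (norm_add_le _ _).trans (add_le_add (hLB t) (hzero w t)))
  have hΦ0 : ‖Φ 0‖ ≤ B := by
    refine BoundedContinuousFunction.norm_ofNormedAddCommGroup_le _ hB0 fun t => ?_
    have : duhamelPart s γ p (⇑(0 : BoundedContinuousFunction ℝ (L2 n))) t = 0 :=
      h.duhamelPart_zero t
    rw [this, add_zero]
    exact hLB t
  obtain ⟨w, hw, hwB⟩ := exists_fixedPoint_closedBall (f := Φ) (M := M) (by linarith)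
    (fun x y hx hy => by
      refine (BoundedContinuousFunction.norm_le (by positivity)).2 fun t => ?_
      have h1 := hlip x y x.continuous y.continuous M ‖x - y‖
        (fun t => (x.norm_coe_le_norm t).trans hx) (fun t => (y.norm_coe_le_norm t).trans hy)
        (fun t => (x - y).norm_coe_le_norm t) t
      have h2 : (Φ x - Φ y) t = duhamelPart s γ p x t - duhamelPart s γ p y t := by
        change (L t + duhamelPart s γ p x t) - (L t + duhamelPart s γ p y t) = _
        abel
      rw [h2]
      refine h1.trans (le_of_eq ?_)
      rw [mul_left_comm, hMp, mul_comm])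
  refine ⟨w, w.continuous, fun t => ?_, fun t => ?_⟩
  · conv_lhs => rw [← hw]
    rfl
  · exact (w.norm_coe_le_norm t).trans (hwB.trans (by linarith))

/-! ### From scaled fixed points to Sobolev solutions. -/

theorem scaledSymbol_mul_cancel {s γ t r : ℝ} (hr : 0 < r) (x : ℝ) :
    scaledSymbol s γ (diffScale t) r * (diffScale t ^ γ * (1 + (diffScale t * r) ^ s) * x) = x := by
  have hR := diffScale_pos t
  have : 0 < 1 + (diffScale t * r) ^ s := by positivity
  have h2 : diffScale t ^ γ * diffScale t ^ (-γ) = 1 := by rw [← Real.rpow_add hR]; simp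
  rw [scaledSymbol]
  field_simp
  rw [mul_comm (diffScale t ^ (-γ)), h2, one_mul]

theorem E1_eq_mult_duhamelSymbol [NeZero n] {s t τ : ℝ} (γ : ℝ) (hs : 0 ≤ s) (hs1 : s ≤ 1)
    (hτ : τ ≤ t) (F : L2 n) :
    E1 (t - τ) F = mult (scaledSymbol s γ (diffScale t)) (mult (duhamelSymbol s γ t τ) F) := by
  rw [E1_eq_mult, mult_mult (memLp_symbolMul (isSymbol_duhamelSymbol γ hs hs1 t τ) _)]
  refine mult_congr (fun r hr => ?_) _
  rw [duhamelSymbol, scaledSymbol_mul_cancel hr, max_eq_left (by linarith)]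

/-- Fixed points of the scaled Duhamel map are global Sobolev solutions. -/
theorem Admissible.isGlobalSobolevSolution [NeZero n] {s γ p : ℝ} (h : Admissible n s γ p)
    {v₀ v₁ : L2 n} {w : ℝ → L2 n} (hw : Continuous w)
    (h0 : ∀ t, MemLp (symbolMul (linearSymbol K0 s γ t) v₀) 2 volume)
    (h1 : ∀ t, MemLp (symbolMul (linearSymbol K1 s γ t) v₁) 2 volume)
    (heq : ∀ t, w t = linearPart s γ v₀ v₁ t + duhamelPart s γ p w t) :
    IsGlobalSobolevSolution s p v₀ v₁ fun t => mult (scaledSymbol s γ (diffScale t)) (w t) := by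
  obtain ⟨C, hC, hN⟩ := h.exists_nonlinear
  have hs := h.s_pos.le
  -- The same solution at the fixed scale 1, where continuity in H^s is continuity of w₁ in L².
  set w₁ : ℝ → L2 n := fun t =>
    mult (fun r => (1 + r ^ s) * scaledSymbol s γ (diffScale t) r) (w t) with hw₁
  have hw₁c : Continuous w₁ := continuous_rescale hs h.γ_pos.le hw
  have hu : ∀ t, mult (scaledSymbol s γ (diffScale t)) (w t) = mult (scaledSymbol s γ 1) (w₁ t) :=
    fun t => mult_scaledSymbol_eq hs h.γ_pos.le (one_le_diffScale t) (w t)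
  have hcont : ∀ t, Continuous fun τ => multCLM _ (isSymbol_scaledSymbol (s := s) (γ := γ) hs
      (diffScale_pos t)) (mult (duhamelSymbol s γ t τ) (source s γ p w τ)) := fun t =>
    (multCLM _ _).continuous.comp (h.continuous_duhamel_integrand_left hw t)
  refine ⟨⟨fun t _ => ?_, fun t _ => ?_⟩, fun t _ => (hN _ (diffScale_pos t) (w t) 0).1,
    fun t ht => ?_, fun t ht => ?_⟩
  · simp only [hu]
    exact (sobolevNorm_mult_scaledSymbol_one_le γ hs h.s_le_one _).trans_lt enorm_lt_top
  · simp only [hu, ← mult_sub (isSymbol_scaledSymbol (γ := γ) hs one_pos)]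
    have h2 : Tendsto (fun τ => ‖w₁ τ - w₁ t‖ₑ) (𝓝[Set.Ici 0] t) (𝓝 0) := by
      have h3 : Continuous fun τ => ‖w₁ τ - w₁ t‖ₑ :=
        continuous_enorm.comp (hw₁c.sub continuous_const)
      simpa using (h3.tendsto t).mono_left nhdsWithin_le_nhds
    exact tendsto_of_tendsto_of_tendsto_of_le_of_le tendsto_const_nhds h2 (fun _ => zero_le)
      fun τ => sobolevNorm_mult_scaledSymbol_one_le γ hs h.s_le_one _
  · refine (intervalIntegrable_congr fun τ hτ => ?_).1 ((hcont t).intervalIntegrable 0 t)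
    rw [Set.uIoc_of_le ht] at hτ
    exact (E1_eq_mult_duhamelSymbol γ hs h.s_le_one hτ.2 _).symm
  · have hint : ∫ τ in (0 : ℝ)..t, E1 (t - τ) (source s γ p w τ)
        = mult (scaledSymbol s γ (diffScale t)) (duhamelPart s γ p w t) := by
      rw [duhamelPart, max_eq_left ht, ← multCLM_apply _ (isSymbol_scaledSymbol hs
        (diffScale_pos t)), ← ContinuousLinearMap.intervalIntegral_comp_comm _
        ((h.continuous_duhamel_integrand_left hw t).intervalIntegrable 0 t)]
      refine intervalIntegral.integral_congr fun τ hτ => ?_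
      rw [Set.uIcc_of_le ht] at hτ
      exact E1_eq_mult_duhamelSymbol γ hs h.s_le_one hτ.2 _
    have hadd : ∀ x y : L2 n, mult (scaledSymbol s γ (diffScale t)) (x + y)
        = mult (scaledSymbol s γ (diffScale t)) x + mult (scaledSymbol s γ (diffScale t)) y :=
      (multCLM _ (isSymbol_scaledSymbol hs (diffScale_pos t))).map_add
    have hl : ∀ (k : ℝ → ℝ → ℝ) (v : L2 n),
        MemLp (symbolMul (linearSymbol k s γ t) v) 2 volume →
        mult (scaledSymbol s γ (diffScale t)) (mult (linearSymbol k s γ t) v) = mult (k t) v := by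
      intro k v hm
      rw [mult_mult hm]
      refine mult_congr (fun r hr => ?_) _
      rw [linearSymbol, scaledSymbol_mul_cancel hr, max_eq_left ht]
    change mult (scaledSymbol s γ (diffScale t)) (w t)
      = E0 t v₀ + E1 t v₁ + ∫ τ in (0 : ℝ)..t, E1 (t - τ) (source s γ p w τ)
    rw [hint, heq t, hadd, linearPart, hadd, hl K0 v₀ (h0 t), hl K1 v₁ (h1 t), E0_eq_mult,
      E1_eq_mult]

/-! ### Unconditional uniqueness. -/

/-- Grönwall's lemma in integral form, with zero data. -/
theorem eq_zero_of_le_mul_integral {f : ℝ → ℝ} (hf : Continuous f) (h0 : ∀ t, 0 ≤ f t) {K T : ℝ}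
    (hT : 0 ≤ T) (h : ∀ t ∈ Set.Icc 0 T, f t ≤ K * ∫ τ in (0 : ℝ)..t, f τ) : f T = 0 := by
  have hderiv : ∀ t, HasDerivAt (fun t => ∫ τ in (0 : ℝ)..t, f τ) (f t) t := fun t =>
    intervalIntegral.integral_hasDerivAt_right (hf.intervalIntegrable 0 t)
      (hf.stronglyMeasurableAtFilter _ _) hf.continuousAt
  have hnn : ∀ t, 0 ≤ t → 0 ≤ ∫ τ in (0 : ℝ)..t, f τ := fun t ht =>
    intervalIntegral.integral_nonneg ht fun τ _ => h0 τ
  -- The differential form is applied to the primitive of f, which vanishes at 0.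
  have key := norm_le_gronwallBound_of_norm_deriv_right_le (δ := 0) (K := K) (ε := 0) (a := 0)
    (b := T) (f := fun t => ∫ τ in (0 : ℝ)..t, f τ) (f' := f)
    (fun t _ => (hderiv t).continuousAt.continuousWithinAt)
    (fun t _ => (hderiv t).hasDerivWithinAt) (by simp) (fun t ht => by
      rw [Real.norm_of_nonneg (h0 t), Real.norm_of_nonneg (hnn t ht.1), add_zero]
      exact h t ⟨ht.1, ht.2.le⟩) T ⟨hT, le_rfl⟩
  rw [gronwallBound_ε0_δ0] at key
  have hz : ∫ τ in (0 : ℝ)..T, f τ = 0 := norm_le_zero_iff.1 key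
  have := h T ⟨hT, le_rfl⟩
  rw [hz, mul_zero] at this
  exact le_antisymm this (h0 T)

theorem sobolevLift_sub [NeZero n] {s : ℝ} (hs : 0 ≤ s) {u v : L2 n} (hu : sobolevNorm s u < ∞)
    (hv : sobolevNorm s v < ∞) : sobolevLift s (u - v) = sobolevLift s u - sobolevLift s v := by
  have h : u - v = mult (scaledSymbol s 0 1) (sobolevLift s u - sobolevLift s v) := by
    rw [mult_sub (isSymbol_scaledSymbol hs one_pos), mult_scaledSymbol_one_lift 0 hs hu,
      mult_scaledSymbol_one_lift 0 hs hv]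
  rw [h, sobolevLift_mult_scaledSymbol_one 0 hs]

theorem enorm_sobolevLift_le [NeZero n] {s : ℝ} (hs : 0 ≤ s) (u : L2 n) :
    ‖sobolevLift s u‖ₑ ≤ 2 * sobolevNorm s u :=
  (enorm_mult_le _ _).trans (eLpNorm_symbolMul_one_add_rpow_le hs u)

theorem continuous_sobolevLift [NeZero n] {s : ℝ} (hs : 0 ≤ s) {u : ℝ → L2 n}
    (hu : ContinuousInSobolev s u) : Continuous fun t => sobolevLift s (u (max t 0)) := by
  refine continuous_iff_continuousAt.2 fun t => ?_
  rw [ContinuousAt, tendsto_iff_edist_tendsto_0]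
  have hm : ∀ t : ℝ, 0 ≤ max t 0 := fun t => le_max_right t 0
  have hmax : Tendsto (fun τ : ℝ => max τ 0) (𝓝 t) (𝓝[Set.Ici 0] (max t 0)) :=
    tendsto_nhdsWithin_iff.2 ⟨(by fun_prop : Continuous fun τ : ℝ => max τ 0).tendsto t,
      Eventually.of_forall hm⟩
  have h1 := (hu.2 _ (hm t)).comp hmax
  have h2 := ENNReal.Tendsto.const_mul h1 (Or.inr (ENNReal.ofNat_ne_top (n := 2)))
  rw [mul_zero] at h2
  refine tendsto_of_tendsto_of_tendsto_of_le_of_le tendsto_const_nhds h2 (fun _ => zero_le)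
    fun τ => ?_
  rw [edist_eq_enorm_sub, ← sobolevLift_sub hs (hu.1 _ (hm τ)) (hu.1 _ (hm t))]
  exact enorm_sobolevLift_le hs _

/-- Unconditional uniqueness in `C([0,∞), H^s)`. -/
theorem Admissible.unique [NeZero n] {s γ p : ℝ} (h : Admissible n s γ p) {v₀ v₁ : L2 n}
    {u v : ℝ → L2 n} (hu : IsGlobalSobolevSolution s p v₀ v₁ u)
    (hv : IsGlobalSobolevSolution s p v₀ v₁ v) {T : ℝ} (hT : 0 ≤ T) : u T = v T := by
  have hs := h.s_pos.le
  obtain ⟨C, hC, hlip⟩ := h.exists_norm_absPowL2_sub_le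
  obtain ⟨A, hA, hdS⟩ := exists_abs_duhamelSymbol_le γ hs h.s_le_one
  -- The lifts measure u and v in H^s; freezing them for t < 0 makes them continuous on ℝ.
  set U : ℝ → L2 n := fun t => sobolevLift s (u (max t 0)) with hU
  set V : ℝ → L2 n := fun t => sobolevLift s (v (max t 0)) with hV
  have hUc : Continuous U := continuous_sobolevLift hs hu.continuous
  have hVc : Continuous V := continuous_sobolevLift hs hv.continuous
  have hUu : ∀ t, 0 ≤ t → mult (scaledSymbol s γ 1) (U t) = u t := fun t ht => by
    rw [hU]
    simp only [max_eq_left ht]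
    exact mult_scaledSymbol_one_lift γ hs (hu.continuous.1 t ht)
  have hVv : ∀ t, 0 ≤ t → mult (scaledSymbol s γ 1) (V t) = v t := fun t ht => by
    rw [hV]
    simp only [max_eq_left ht]
    exact mult_scaledSymbol_one_lift γ hs (hv.continuous.1 t ht)
  set F : ℝ → L2 n := fun τ => absPowL2 p (mult (scaledSymbol s γ 1) (U τ))
    - absPowL2 p (mult (scaledSymbol s γ 1) (V τ)) with hF
  have hFc : Continuous F :=
    (h.continuous_absPowL2.comp hUc).sub (h.continuous_absPowL2.comp hVc)
  obtain ⟨M₁, hM₁⟩ := isCompact_Icc.exists_bound_of_continuousOn (s := Set.Icc 0 T)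
    (f := fun τ => (‖U τ‖ + ‖V τ‖) ^ (p - 1)) (Continuous.continuousOn
      ((hUc.norm.add hVc.norm).rpow_const fun _ => Or.inr (by linarith [h.one_lt_p])))
  obtain ⟨M₂, hM₂⟩ := isCompact_Icc.exists_bound_of_continuousOn (s := Set.Icc 0 T)
    (f := fun t => diffScale t ^ (γ + s)) (Continuous.continuousOn
      (continuous_diffScale.rpow_const fun t => Or.inl (diffScale_pos t).ne'))
  have hM₂0 : 0 ≤ M₂ := (norm_nonneg _).trans (hM₂ 0 ⟨le_rfl, hT⟩)
  have hdc : ∀ t, Continuous fun τ => mult (duhamelSymbol s γ t τ) (F τ) := by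
    intro t
    have h1 := (continuous_mult_duhamelSymbol γ hs h.s_le_one hFc).comp
      (by fun_prop : Continuous fun τ : ℝ => (t, τ))
    simp only [Function.comp_def] at h1
    exact h1
  have hdiff : ∀ t, 0 ≤ t → u t - v t = mult (scaledSymbol s γ (diffScale t))
      (∫ τ in (0 : ℝ)..t, mult (duhamelSymbol s γ t τ) (F τ)) := by
    intro t ht
    rw [hu.duhamel t ht, hv.duhamel t ht, add_sub_add_left_eq_sub,
      ← intervalIntegral.integral_sub (hu.integrable t ht) (hv.integrable t ht),
      ← multCLM_apply _ (isSymbol_scaledSymbol hs (diffScale_pos t)),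
      ← ContinuousLinearMap.intervalIntegral_comp_comm _ ((hdc t).intervalIntegrable 0 t)]
    refine intervalIntegral.integral_congr fun τ hτ => ?_
    rw [Set.uIcc_of_le ht] at hτ
    simp only [hF]
    rw [hUu τ hτ.1, hVv τ hτ.1, multCLM_apply, ← E1_eq_mult_duhamelSymbol γ hs h.s_le_one hτ.2,
      E1_eq_mult, E1_eq_mult, E1_eq_mult, mult_sub (isSymbol_K1 _)]
  -- The Duhamel operator maps L² back to H^s, so the H^s norm of the difference is bounded by the
  -- time integral of the L² norm of the sources' difference, which is Lipschitz in H^s on bounded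
  -- sets.
  have hbound : ∀ t ∈ Set.Icc 0 T, ‖U t - V t‖
      ≤ A * M₂ * (C * M₁) * ∫ τ in (0 : ℝ)..t, ‖U τ - V τ‖ := by
    intro t ht
    have h1 : U t - V t = mult (fun r => (1 + r ^ s) * scaledSymbol s γ (diffScale t) r)
        (∫ τ in (0 : ℝ)..t, mult (duhamelSymbol s γ t τ) (F τ)) := by
      rw [← sobolevLift_mult_scaledSymbol_one γ hs (mult _ _),
        ← mult_scaledSymbol_eq hs h.γ_pos.le (one_le_diffScale t), ← hdiff t ht.1,
        sobolevLift_sub hs (hu.continuous.1 t ht.1) (hv.continuous.1 t ht.1)]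
      simp only [hU, hV, max_eq_left ht.1]
    rw [h1]
    refine (norm_mult_le (fun r hr => rescale_le_one hs h.γ_pos.le (one_le_diffScale t) hr) _).trans ?_
    rw [one_mul, ← intervalIntegral.integral_const_mul]
    refine intervalIntegral.norm_integral_le_of_norm_le ht.1 (Eventually.of_forall fun τ hτ => ?_)
      ((continuous_const.mul (hUc.sub hVc).norm).intervalIntegrable 0 t)
    have hτT : τ ∈ Set.Icc 0 T := ⟨hτ.1.le, hτ.2.trans ht.2⟩
    have b1 := (le_abs_self _).trans (hM₁ τ hτT)
    have b2 := (le_abs_self _).trans (hM₂ t ht)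
    calc ‖mult (duhamelSymbol s γ t τ) (F τ)‖ ≤ A * diffScale t ^ (γ + s) * ‖F τ‖ :=
          norm_mult_le (fun r hr => hdS t τ r hr) _
      _ ≤ A * M₂ * (C * (‖U τ - V τ‖ * M₁)) := by
          refine mul_le_mul (mul_le_mul_of_nonneg_left b2 hA.le)
            ((hlip (U τ) (V τ)).trans ?_) (norm_nonneg _) (by positivity)
          gcongr
      _ = _ := by ring
  have hz := eq_zero_of_le_mul_integral (hUc.sub hVc).norm (fun t => norm_nonneg _) hT hbound
  have : U T = V T := sub_eq_zero.1 (norm_eq_zero.1 hz)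
  rw [← hUu T hT, ← hVv T hT, this]

/-! ### Complex conjugation and real-valued solutions. -/

/-- Complex conjugation on `L²`. -/
noncomputable def conjL2 : L2 n →L[ℝ] L2 n :=
  ContinuousLinearMap.compLpL 2 volume (Complex.conjCLE : ℂ →L[ℝ] ℂ)

theorem conjL2_coeFn (f : L2 n) : conjL2 f =ᵐ[volume] fun x => (starRingEnd ℂ) (f x) :=
  ContinuousLinearMap.coeFn_compLpL _ f

theorem isRealValued_iff (f : L2 n) : IsRealValued f ↔ conjL2 f = f := by
  constructor
  · intro h
    refine Lp.ext ?_
    filter_upwards [conjL2_coeFn f, h] with x h1 h2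
    rw [h1, Complex.conj_eq_iff_im.2 h2]
  · intro h
    have h1 := conjL2_coeFn f
    rw [h] at h1
    filter_upwards [h1] with x hx
    exact Complex.conj_eq_iff_im.1 hx.symm

theorem measurePreserving_neg_euclidean :
    MeasurePreserving (fun x : EuclideanSpace ℝ (Fin n) => -x) volume volume :=
  Measure.measurePreserving_neg volume

/-- Both sides are continuous in f, so the identity reduces to Schwartz functions, where the
integral formula can be conjugated. -/
theorem fourier_conjL2 (f : L2 n) :
    (𝓕 (conjL2 f) : L2 n) =ᵐ[volume] fun ξ => (starRingEnd ℂ) ((𝓕 f : L2 n) (-ξ)) := by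
  set reflect : L2 n → L2 n := fun g =>
    Lp.compMeasurePreserving _ measurePreserving_neg_euclidean g
  have hr : ∀ g : L2 n, reflect g =ᵐ[volume] fun ξ => g (-ξ) := fun g =>
    Lp.coeFn_compMeasurePreserving g measurePreserving_neg_euclidean
  have hrc : Continuous reflect :=
    (Lp.isometry_compMeasurePreserving measurePreserving_neg_euclidean).continuous
  have key : (𝓕 (conjL2 f) : L2 n) = conjL2 (reflect (𝓕 f)) := by
    have hFc : Continuous fun g : L2 n => (𝓕 g : L2 n) :=
      (Lp.fourierTransformₗᵢ (EuclideanSpace ℝ (Fin n)) ℂ).continuous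
    refine DenseRange.induction_on (p := fun f : L2 n => (𝓕 (conjL2 f) : L2 n) = conjL2 (reflect (𝓕 f)))
      (SchwartzMap.denseRange_toLpCLM (p := 2) ENNReal.ofNat_ne_top) f
      (isClosed_eq (hFc.comp conjL2.continuous) (conjL2.continuous.comp (hrc.comp hFc))) fun φ => ?_
    set ψ : SchwartzMap (EuclideanSpace ℝ (Fin n)) ℂ :=
      φ.postcompCLM (Complex.conjCLE : ℂ →L[ℝ] ℂ)
    have hψ : conjL2 (φ.toLp 2) = ψ.toLp 2 := by
      refine Lp.ext ?_
      filter_upwards [conjL2_coeFn (φ.toLp 2), φ.coeFn_toLp 2, ψ.coeFn_toLp 2] with x h1 h2 h3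
      rw [h1, h2, h3]
      rfl
    change (𝓕 (conjL2 (φ.toLp 2)) : L2 n) = conjL2 (reflect (𝓕 (φ.toLp 2)))
    rw [hψ, SchwartzMap.toLp_fourier_eq, SchwartzMap.toLp_fourier_eq]
    have hφ : ∀ᵐ ξ : EuclideanSpace ℝ (Fin n), ((𝓕 φ).toLp 2 : L2 n) ξ = (𝓕 φ) ξ :=
      (𝓕 φ).coeFn_toLp 2 volume
    refine Lp.ext ?_
    filter_upwards [conjL2_coeFn (reflect ((𝓕 φ).toLp 2)), hr ((𝓕 φ).toLp 2),
      (𝓕 ψ).coeFn_toLp 2, measurePreserving_neg_euclidean.quasiMeasurePreserving.ae hφ] with ξ h1 h2 h3 h4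
    rw [h1, h2, h3, h4, SchwartzMap.fourier_coe, SchwartzMap.fourier_coe, Real.fourier_eq',
      Real.fourier_eq', ← integral_conj]
    refine integral_congr_ae (Eventually.of_forall fun x => ?_)
    change Complex.exp _ • (starRingEnd ℂ) (φ x) = (starRingEnd ℂ) (Complex.exp _ • φ x)
    rw [smul_eq_mul, smul_eq_mul, map_mul, ← Complex.exp_conj, map_mul, Complex.conj_ofReal,
      Complex.conj_I, inner_neg_right]
    push_cast
    ring_nf
  rw [key]
  filter_upwards [conjL2_coeFn (reflect (𝓕 f)), hr (𝓕 f)] with ξ h1 h2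
  rw [h1, h2]

theorem symbolMul_conjL2 (k : ℝ → ℝ) (f : L2 n) :
    symbolMul k (conjL2 f) =ᵐ[volume] fun ξ => (starRingEnd ℂ) (symbolMul k f (-ξ)) := by
  filter_upwards [fourier_conjL2 f] with ξ hξ
  have hfreq : freq (-ξ) = freq ξ := by simp [freq]
  simp only [symbolMul, hξ, map_mul, Complex.conj_ofReal, hfreq]

theorem eLpNorm_symbolMul_conjL2 {k : ℝ → ℝ} (hk : Measurable k) (f : L2 n) :
    eLpNorm (symbolMul k (conjL2 f)) 2 volume = eLpNorm (symbolMul k f) 2 volume := by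
  rw [eLpNorm_congr_ae (symbolMul_conjL2 k f),
    ← eLpNorm_comp_measurePreserving (aestronglyMeasurable_symbolMul hk f)
      measurePreserving_neg_euclidean]
  refine eLpNorm_congr_norm_ae (Eventually.of_forall fun ξ => ?_)
  simp

/-- Holds because the symbol is real and even in ξ. -/
theorem mult_conjL2 [NeZero n] {k : ℝ → ℝ} (hk : IsSymbol k) (f : L2 n) :
    mult k (conjL2 f) = conjL2 (mult k f) := by
  refine L2_ext_fourier ?_
  filter_upwards [fourier_mult (memLp_symbolMul hk (conjL2 f)), symbolMul_conjL2 k f,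
    fourier_conjL2 (mult k f), measurePreserving_neg_euclidean.quasiMeasurePreserving.ae
      (fourier_mult (memLp_symbolMul hk f))] with ξ h1 h2 h3 h4
  rw [h1, h2, h3, h4]

theorem sobolevNorm_conjL2 (s : ℝ) (f : L2 n) : sobolevNorm s (conjL2 f) = sobolevNorm s f := by
  rw [sobolevNorm_eq, sobolevNorm_eq]
  exact eLpNorm_symbolMul_conjL2 (k := fun r => (1 + r ^ 2) ^ (s / 2)) (by fun_prop) f

theorem absPow_conjL2 (p : ℝ) (f : L2 n) : absPow p (conjL2 f) =ᵐ[volume] absPow p f := by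
  filter_upwards [conjL2_coeFn f] with x hx
  simp [absPow, hx]

theorem absPowL2_conjL2 (p : ℝ) (f : L2 n) : absPowL2 p (conjL2 f) = absPowL2 p f := by
  have h := absPow_conjL2 p f
  by_cases hm : MemLp (absPow p f) 2 volume
  · have hm' := (memLp_congr_ae h).2 hm
    rw [absPowL2, absPowL2, dif_pos hm, dif_pos hm', MemLp.toLp_congr hm' hm h]
  · have hm' : ¬ MemLp (absPow p (conjL2 f)) 2 volume := fun h' => hm ((memLp_congr_ae h).1 h')
    rw [absPowL2, absPowL2, dif_neg hm, dif_neg hm']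

theorem conjL2_absPowL2 (p : ℝ) (f : L2 n) : conjL2 (absPowL2 p f) = absPowL2 p f := by
  by_cases hm : MemLp (absPow p f) 2 volume
  · refine (isRealValued_iff _).1 ?_
    filter_upwards [absPowL2_coeFn hm] with x hx
    rw [hx, absPow, Complex.ofReal_im]
  · rw [absPowL2, dif_neg hm, map_zero]

/-- The complex conjugate of a solution is a solution with conjugate data. -/
theorem isGlobalSobolevSolution_conjL2 [NeZero n] {s p : ℝ} {v₀ v₁ : L2 n} {u : ℝ → L2 n}
    (hu : IsGlobalSobolevSolution s p v₀ v₁ u) :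
    IsGlobalSobolevSolution s p (conjL2 v₀) (conjL2 v₁) fun t => conjL2 (u t) := by
  refine ⟨⟨fun t ht => ?_, fun t ht => ?_⟩, fun t ht => ?_, fun t ht => ?_, fun t ht => ?_⟩
  · rw [sobolevNorm_conjL2]; exact hu.continuous.1 t ht
  · simp only [← map_sub, sobolevNorm_conjL2]
    exact hu.continuous.2 t ht
  · exact (memLp_congr_ae (absPow_conjL2 p (u t))).2 (hu.memLp_absPow t ht)
  · simp only [absPowL2_conjL2]
    exact hu.integrable t ht
  · simp only [absPowL2_conjL2]
    have hE : ∀ τ, conjL2 (E1 (t - τ) (absPowL2 p (u τ))) = E1 (t - τ) (absPowL2 p (u τ)) := by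
      intro τ
      rw [E1_eq_mult, ← mult_conjL2 (isSymbol_K1 _), conjL2_absPowL2]
    have hint : conjL2 (∫ τ in (0 : ℝ)..t, E1 (t - τ) (absPowL2 p (u τ)))
        = ∫ τ in (0 : ℝ)..t, E1 (t - τ) (absPowL2 p (u τ)) := by
      rw [← ContinuousLinearMap.intervalIntegral_comp_comm _ (hu.integrable t ht)]
      simp only [hE]
    conv_lhs => rw [hu.duhamel t ht]
    rw [map_add, map_add, hint, E0_eq_mult, E1_eq_mult, E0_eq_mult, E1_eq_mult,
      mult_conjL2 (isSymbol_K0 _), mult_conjL2 (isSymbol_K1 _)]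

/-! ### Scaling of the data, the exponents, and the conclusion. -/

theorem eLpNorm_symbolMul_smul (k : ℝ → ℝ) {ε : ℝ} (hε : 0 ≤ ε) (f : L2 n) :
    eLpNorm (symbolMul k ((ε : ℂ) • f)) 2 volume
      = ENNReal.ofReal ε * eLpNorm (symbolMul k f) 2 volume := by
  rw [eLpNorm_congr_ae (symbolMul_smul k _ f), eLpNorm_const_smul, ← ofReal_norm,
    Complex.norm_real, Real.norm_of_nonneg hε]

theorem dataNorm_smul (s γ : ℝ) {ε : ℝ} (hε : 0 ≤ ε) (u₀ u₁ : L2 n) :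
    dataNorm s γ ((ε : ℂ) • u₀) ((ε : ℂ) • u₁) = ENNReal.ofReal ε * dataNorm s γ u₀ u₁ := by
  simp only [dataNorm, sobolevNorm_eq, homSobolevNorm_eq, ← eLpNorm_symbolMul_one,
    eLpNorm_symbolMul_smul _ hε]
  ring

/-- The proof needs both p > 1 + 4/(n+2γ) and p ≥ 1 + 2γ/n. The two thresholds agree exactly at γ =
γ̃, by the quadratic equation, so on either side the assumed bound implies the other. -/
theorem admissible_of_exponents {s γ p γt : ℝ} (hn : 1 ≤ n) (hs0 : 0 < s) (hs1 : s ≤ 1)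
    (hγ0 : 0 < γ) (hγn : γ < (n : ℝ) / 2) (hγt0 : 0 < γt)
    (hγt : 2 * γt ^ 2 + (n : ℝ) * γt - 2 * (n : ℝ) = 0) (hp : 1 < p)
    (hp_low : γ ≤ γt → 1 + 4 / ((n : ℝ) + 2 * γ) < p)
    (hp_high : γt < γ → 1 + 2 * γ / (n : ℝ) ≤ p)
    (hp_upper : 2 * s < (n : ℝ) → p ≤ (n : ℝ) / ((n : ℝ) - 2 * s)) : Admissible n s γ p := by
  have hn0 : (0 : ℝ) < n := by exact_mod_cast hn
  have hd : 0 < (n : ℝ) + 2 * γ := by linarith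
  have hp_le : p * (n - 2 * s) ≤ n := by
    rcases lt_or_ge (2 * s) (n : ℝ) with h | h
    · exact (le_div_iff₀ (by linarith)).1 (hp_upper h)
    · nlinarith
  rcases le_or_gt γ γt with h | h
  · have h1 : 4 < (p - 1) * (n + 2 * γ) := by
      have := hp_low h
      rw [← div_lt_iff₀ hd]; linarith
    have h2 : 2 * γ * (n + 2 * γ) ≤ 4 * n := by nlinarith
    refine ⟨hs0, hs1, hγ0, by linarith, hp, ?_, hp_le, by linarith⟩
    have h3 : 2 * γ / n ≤ 4 / ((n : ℝ) + 2 * γ) := by rwa [div_le_div_iff₀ hn0 hd]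
    linarith [hp_low h]
  · have h1 := hp_high h
    refine ⟨hs0, hs1, hγ0, by linarith, hp, h1, hp_le, ?_⟩
    have h2 : 2 * γ ≤ (p - 1) * n := by
      rw [← div_le_iff₀ hn0]; linarith
    have h3 : 2 * n < 2 * γ ^ 2 + n * γ := by nlinarith
    have h4 : 0 < p - 1 := by linarith
    nlinarith

theorem theorem2p1 (n : ℕ) (hn : 1 ≤ n) (s γ p γt : ℝ)
    (hs0 : 0 < s) (hs1 : s ≤ 1)
    (hγ0 : 0 < γ) (hγn : γ < (n : ℝ) / 2)
    (hγt0 : 0 < γt) (hγt : 2 * γt ^ 2 + (n : ℝ) * γt - 2 * (n : ℝ) = 0)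
    (hp : 1 < p)
    (hp_low : γ ≤ γt → 1 + 4 / ((n : ℝ) + 2 * γ) < p)
    (hp_high : γt < γ → 1 + 2 * γ / (n : ℝ) ≤ p)
    (hp_upper : 2 * s < (n : ℝ) → p ≤ (n : ℝ) / ((n : ℝ) - 2 * s)) :
    ∃ C : ℝ, 0 < C ∧ ∃ ε₀ : ℝ, 0 < ε₀ ∧ ∃ K : ℝ, 0 < K ∧
      ∀ ε : ℝ, 0 < ε → ε ≤ ε₀ →
      ∀ u₀ u₁ : L2 n, dataNorm s γ u₀ u₁ ≤ ENNReal.ofReal C →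
      ∃ u : ℝ → L2 n,
        IsGlobalSobolevSolution s p ((ε : ℂ) • u₀) ((ε : ℂ) • u₁) u ∧
        (∀ v : ℝ → L2 n, IsGlobalSobolevSolution s p ((ε : ℂ) • u₀) ((ε : ℂ) • u₁) v →
          ∀ t, 0 ≤ t → v t = u t) ∧
        (∀ t, 0 ≤ t → ‖u t‖ₑ ≤
          ENNReal.ofReal (K * ε * (1 + t) ^ (-γ / 2)) * dataNorm s γ u₀ u₁) ∧
        (∀ t, 0 ≤ t → homSobolevNorm s (u t) ≤
          ENNReal.ofReal (K * ε * (1 + t) ^ (-(s + γ) / 2)) * dataNorm s γ u₀ u₁) ∧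
        (IsRealValued u₀ → IsRealValued u₁ → ∀ t, 0 ≤ t → IsRealValued (u t)) := by
  have : NeZero n := ⟨by omega⟩
  have h := admissible_of_exponents hn hs0 hs1 hγ0 hγn hγt0 hγt hp hp_low hp_high hp_upper
  obtain ⟨C₁, hC₁, hlin⟩ := exists_linearPart_bound (n := n) hs0.le hs1 hγ0.le
  obtain ⟨δ, hδ, hfix⟩ := h.exists_scaled_solution
  -- C₁ bounds the linear part and δ is the smallness threshold of the fixed point, so C₁ε‖data‖ ≤ δ
  -- for ε ≤ 1. The factor 2 in K is the one in the fixed-point bound.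
  refine ⟨δ / C₁, by positivity, 1, one_pos, 2 * C₁, by positivity,
    fun ε hε hε1 u₀ u₁ hdata => ?_⟩
  set v₀ : L2 n := (ε : ℂ) • u₀ with hv₀
  set v₁ : L2 n := (ε : ℂ) • u₁ with hv₁
  set D := (dataNorm s γ u₀ u₁).toReal with hD
  have hDtop : dataNorm s γ u₀ u₁ ≠ ∞ := ne_top_of_le_ne_top ENNReal.ofReal_ne_top hdata
  have hDe : dataNorm s γ u₀ u₁ = ENNReal.ofReal D := (ENNReal.ofReal_toReal hDtop).symm
  have hD0 : 0 ≤ D := ENNReal.toReal_nonneg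
  have hDle : D ≤ δ / C₁ := by
    rw [hDe] at hdata
    exact (ENNReal.ofReal_le_ofReal_iff (by positivity)).1 hdata
  have hvD : ENNReal.ofReal C₁ * dataNorm s γ v₀ v₁ = ENNReal.ofReal (C₁ * ε * D) := by
    rw [dataNorm_smul s γ hε.le, hDe, ← ENNReal.ofReal_mul hε.le, ← ENNReal.ofReal_mul hC₁.le,
      mul_assoc]
  obtain ⟨hl0, hl1, hl⟩ := hlin v₀ v₁
  rw [hvD] at hl0 hl1 hl
  have hfin : sobolevNorm s v₀ < ∞ := by
    have h1 : dataNorm s γ v₀ v₁ < ∞ := by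
      rw [dataNorm_smul s γ hε.le]
      exact ENNReal.mul_lt_top ENNReal.ofReal_lt_top hDtop.lt_top
    exact (le_self_add.trans le_self_add).trans_lt h1
  obtain ⟨w, hwc, hweq, hwB⟩ := hfix (linearPart s γ v₀ v₁) (continuous_linearPart γ hs0.le hs1 hfin v₁)
    (C₁ * ε * D)
    (by
      rw [le_div_iff₀ hC₁] at hDle
      nlinarith [mul_nonneg hC₁.le hD0])
    (fun t => by
      have h1 := hl t
      rw [← ofReal_norm] at h1
      exact (ENNReal.ofReal_le_ofReal_iff (by positivity)).1 h1)
  have hsol := h.isGlobalSobolevSolution hwc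
    (fun t => ⟨aestronglyMeasurable_symbolMul (measurable_linearSymbol measurable_K0 s γ t) _,
      (hl0 t).trans_lt ENNReal.ofReal_lt_top⟩)
    (fun t => ⟨aestronglyMeasurable_symbolMul (measurable_linearSymbol measurable_K1 s γ t) _,
      (hl1 t).trans_lt ENNReal.ofReal_lt_top⟩) hweq
  -- Both decay estimates at once: σ = 0 is the L² bound and σ = s the Ḣ^s bound.
  have hdecay : ∀ σ t, 0 ≤ σ → σ ≤ s → 0 ≤ t →
      homSobolevNorm σ (mult (scaledSymbol s γ (diffScale t)) (w t))
        ≤ ENNReal.ofReal (2 * C₁ * ε * (1 + t) ^ (-(σ + γ) / 2)) * dataNorm s γ u₀ u₁ := by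
    intro σ t hσ0 hσs ht
    refine (homSobolevNorm_mult_scaledSymbol_le hσ0 hσs (diffScale_pos t) (w t)).trans ?_
    rw [diffScale_rpow ht, ← ofReal_norm, ← ENNReal.ofReal_mul (by positivity), hDe,
      ← ENNReal.ofReal_mul (by positivity)]
    refine ENNReal.ofReal_le_ofReal ?_
    rw [show -σ - γ = -(σ + γ) by ring]
    calc (1 + t) ^ (-(σ + γ) / 2) * ‖w t‖
        ≤ (1 + t) ^ (-(σ + γ) / 2) * (2 * (C₁ * ε * D)) :=
          mul_le_mul_of_nonneg_left (hwB t) (by positivity)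
      _ = _ := by ring
  refine ⟨_, hsol, fun v hv t ht => h.unique hv hsol ht, fun t ht => ?_,
    fun t ht => hdecay s t hs0.le le_rfl ht, fun hr0 hr1 t ht => ?_⟩
  · have h1 := hdecay 0 t le_rfl hs0.le ht
    rwa [homSobolevNorm_zero, zero_add] at h1
  · have hconj : ∀ f : L2 n, IsRealValued f → conjL2 ((ε : ℂ) • f) = (ε : ℂ) • f := by
      intro f hf
      refine (isRealValued_iff _).1 ?_
      filter_upwards [Lp.coeFn_smul (ε : ℂ) f, hf] with x h1 h2
      rw [h1]
      simp [h2]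
    -- For real data the conjugate solves the same problem, so uniqueness identifies it with u.
    have hc := isGlobalSobolevSolution_conjL2 hsol
    rw [hv₀, hv₁, hconj u₀ hr0, hconj u₁ hr1] at hc
    exact (isRealValued_iff _).2 (h.unique hc hsol ht)
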